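/- **Setting.** Let $p,n,d,K\ge 1$ be integers, $\beta\ge 0$, $x_1,\dots,x_n\in[0,1]^p$ and $y_1,\dots,y_n\in\mathbb R$. Let $L:\mathbb R^2\to[0,\infty)$ be twice differentiable in its second variable $z$, such that for every $y$ the function $z\mapsto\partial_z^2L(y,z)$ is positive and locally Lipschitz, and such that $\sup_{(y,z):L(y,z)\le C}|\partial_zL(y,z)/\partial_z^2L(y,z)|<\infty$ for every $C>0$. *Tree functions.* $\mathbb T$ is the space of functions $T:[0,1]^p\to\mathbb R$ of the form $T(x)=\mu_T([0,x])$, $[0,x]=\prod_j[0,x^j]$, with $\mu_T$ a (necessarily unique) finite signed Borel measure whose variation does not charge $[0,1]^p\setminus[0,1)^p$; $\|T\|_{\mathrm{TV}}=|\mu_T|([0,1]^p)$. $\mathbb T^+$ is the set of $T\in\mathbb T$ with $\mu_T\ge 0$. For $T\in\mathbb T$, $T^\pm\in\mathbb T^+$ are the tree functions of the positive and negative parts of $\mu_T$ in its Jordan decomposition, so $T=T^+-T^-$. *The space $L^2_{\mathbf x}$.* Let $\nu$ be the $p$-fold product of the probability measure $\frac13(\delta_0+\delta_1+\mathrm{Leb})$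 on $[0,1]$, $\nu_{\mathbf x}=\frac12\nu+\frac1{2n}\sum_i\delta_{x_i}$ and $L^2_{\mathbf x}=L^2([0,1]^p,\nu_{\mathbf x})$. The values $F(x_i)$ are well defined for $F\in L^2_{\mathbf x}$; $\mathbb T$ is regarded as a subset of $L^2_{\mathbf x}$, and $\overline{\mathbb T}^+$ is the closure of $\mathbb T^+$ in $L^2_{\mathbf x}$, with the induced metric. *Softmax gradient trees.* Let $F$ be a real function with values defined at the $x_i$, and $r_i=-\partial_zL(y_i,F(x_i))$. Starting from the root region $A_\emptyset=[0,1]^p$, each region $A_v$, where $v$ is a word in $0,1$ of length $<d$, is split as follows. Draw $K$ independent candidates $(j_k,u_k)$, uniform on $\{1,\dots,p\}\times(0,1)$. The candidate $(j,u)$ would split $A$ into $A_0=\{x\in A:x^{j}<a+u(b-a)\}$ and $A_1=\{x\in A:x^{j}\ge a+u(b-a)\}$, with $a=\inf_{x\in A}x^j$ and $b=\sup_{x\in A}x^j$; its score is $\Delta(j,u;A)=\mathrm{mse}(A)-\mathrm{mse}(A_0)-\mathrm{mse}(A_1)$, where $\mathrm{mse}(A)=\frac1n\sum_{i:x_i\in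 A}(r_i-\bar r(A))^2$ and $\bar r(A)$ is the mean of the $r_i$ with $x_i\in A$. One candidate is selected, the $k$-th with probability $e^{\beta\Delta(j_k,u_k;A_v)}/\sum_le^{\beta\Delta(j_l,u_l;A_v)}$, and yields $A_{v0}$ and $A_{v1}$. Let $\zeta$ be the auxiliary randomness: all candidate splits, and independent uniform variables on $[0,1]$, one for each internal node, which perform the selections. The softmax gradient tree is $$\widetilde T(\cdot;F,\zeta)=\sum_{v\in\{0,1\}^d}\tilde r(A_v)\mathbf 1_{A_v},\qquad \tilde r(A)=-\frac{\sum_{i:x_i\in A}\partial_zL(y_i,F(x_i))}{\sum_{i:x_i\in A}\partial_z^2L(y_i,F(x_i))}\quad(\tfrac00=0).$$ It belongs to $\mathbb T$. Put $\mathcal T(F)=\mathbb E_\zeta[\widetilde T(\cdot;F,\zeta)]$ and $\mathcal T^\pm(F)=\mathbb E_\zeta[\widetilde T^\pm(\cdot;F,\zeta)]$. *Boosting chain.* Suppose, for part (ii), that $z\mapsto\frac1n\sum_iL(y_i,z)$ has a minimizer $z_0$. For $\lambda>0$ and $\zeta_1,\zeta_2,\dots$ i.i.d. copies of $\zeta$,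 let $\hat F^{\lambda\pm}_0=\hat F_0^\pm$ be the positive and negative parts of the constant tree function $z_0$ and, for $m\ge 0$, $\hat F^{\lambda\pm}_{m+1}=\hat F^{\lambda\pm}_m+\lambda\widetilde T^\pm(\cdot;\hat F^\lambda_m,\zeta_{m+1})$ with $\hat F^\lambda_m=\hat F^{\lambda+}_m-\hat F^{\lambda-}_m$. **Theorem.** (i) For every $(F_0^+,F_0^-)\in L^2_{\mathbf x}\times L^2_{\mathbf x}$ there is a unique solution $(F^+(t),F^-(t))_{t\ge0}$, with values in $L^2_{\mathbf x}\times L^2_{\mathbf x}$ and started from $(F_0^+,F_0^-)$, of the system $$\tfrac{d}{dt}F^+(t)=\mathcal T^+(F(t)),\qquad \tfrac{d}{dt}F^-(t)=\mathcal T^-(F(t)),\qquad F(t)=F^+(t)-F^-(t),\quad t\ge0.$$ If moreover $(F_0^+,F_0^-)\in\mathbb T^+\times\mathbb T^+$, then $(F^+(t),F^-(t))\in\mathbb T^+\times\mathbb T^+$ for all $t\ge0$, and $(F(t))_{t\ge0}$ is equal to the unique solution of $F'(t)=\mathcal T(F(t))$, $t\ge 0$, in the Banach space $(\mathbb T,\|\cdot\|_{\mathrm{TV}})$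 started from $F_0^+-F_0^-$. (ii) As $\lambda\to0$, the processes $(\hat F^{\lambda+}_{\lfloor t/\lambda\rfloor},\hat F^{\lambda-}_{\lfloor t/\lambda\rfloor})_{t\ge0}$ converge in distribution in the Skorokhod space $\mathbb D([0,\infty),\overline{\mathbb T}^+\times\overline{\mathbb T}^+)$ with the $J_1$ topology to the (deterministic) solution of the system in (i) started from $(\hat F_0^+,\hat F_0^-)$. -/

import Mathlib

open MeasureTheory ProbabilityTheory Filter Topology Set
open scoped ENNReal NNReal

noncomputable section

namespace InfGB

/-! ### Skorokhod space with the J1 topology -/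

/-- Càdlàg paths from `[0, ∞)` to `E`. -/
structure CadlagPath (E : Type*) [TopologicalSpace E] where
  toFun : ℝ≥0 → E
  right_continuous : ∀ t, ContinuousWithinAt toFun (Ici t) t
  left_limit : ∀ t, ∃ l, Tendsto toFun (𝓝[<] t) (𝓝 l)

instance {E : Type*} [TopologicalSpace E] : CoeFun (CadlagPath E) (fun _ => ℝ≥0 → E) :=
  ⟨CadlagPath.toFun⟩

/-- Basic J1 neighbourhood of the path `f`: the paths `g` such that, for some time change `τ`
(an increasing bijection of `[0, ∞)`), `τ` is `ε`-close to the identity and `g` is `ε`-close to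
`f ∘ τ` on `[0, T]`. -/
def j1Nbhd {E : Type*} [PseudoMetricSpace E] (f : CadlagPath E) (T : ℝ≥0) (ε : ℝ) :
    Set (CadlagPath E) :=
  {g | ∃ τ : ℝ≥0 ≃o ℝ≥0, ∀ t ≤ T, dist (τ t) t < ε ∧ dist (g t) (f (τ t)) < ε}

lemma j1Nbhd_anti {E : Type*} [PseudoMetricSpace E] (f : CadlagPath E) {T T' : ℝ≥0} {ε ε' : ℝ}
    (hT : T' ≤ T) (hε : ε ≤ ε') : j1Nbhd f T ε ⊆ j1Nbhd f T' ε' := by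
  rintro g ⟨τ, h⟩
  exact ⟨τ, fun t ht => ⟨(h t (ht.trans hT)).1.trans_le hε, (h t (ht.trans hT)).2.trans_le hε⟩⟩

/-- The J1 topology. A set is open iff it contains a basic neighbourhood of each of its points;
`f_n → f` iff for every `T` there are time changes `τ_n` with `sup_{t ≤ T} |τ_n t - t| → 0` and
`sup_{t ≤ T} dist (f_n t) (f (τ_n t)) → 0`. -/
instance {E : Type*} [PseudoMetricSpace E] : TopologicalSpace (CadlagPath E) where
  IsOpen s := ∀ f ∈ s, ∃ T : ℝ≥0, ∃ ε : ℝ, 0 < ε ∧ j1Nbhd f T ε ⊆ s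
  isOpen_univ := fun _ _ => ⟨0, 1, one_pos, subset_univ _⟩
  isOpen_inter := by
    rintro s t hs ht f ⟨hfs, hft⟩
    obtain ⟨T, ε, hε, h⟩ := hs f hfs
    obtain ⟨T', ε', hε', h'⟩ := ht f hft
    exact ⟨max T T', min ε ε', lt_min hε hε', subset_inter
      ((j1Nbhd_anti f (le_max_left _ _) (min_le_left _ _)).trans h)
      ((j1Nbhd_anti f (le_max_right _ _) (min_le_right _ _)).trans h')⟩
  isOpen_sUnion := by
    rintro S hS f ⟨s, hs, hf⟩
    obtain ⟨T, ε, hε, h⟩ := hS s hs f hf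
    exact ⟨T, ε, hε, h.trans (subset_sUnion_of_mem hs)⟩

instance {E : Type*} [PseudoMetricSpace E] : MeasurableSpace (CadlagPath E) := borel _

instance {E : Type*} [PseudoMetricSpace E] : BorelSpace (CadlagPath E) := ⟨rfl⟩

/-! ### Tree functions -/

/-- The cube `[0,1]^p`. -/
abbrev Cube (p : ℕ) := Fin p → unitInterval

/-- `μ` belongs to `M₀`: its variation does not charge `[0,1]^p ∖ [0,1)^p`. -/
def IsM0 {p : ℕ} (μ : SignedMeasure (Cube p)) : Prop :=
  μ.totalVariation {c | ∃ j, c j = 1} = 0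

/-- `μ ∈ M₀` represents the function `T`, that is `T c = μ [0, c]` for all `c`. -/
def Represents {p : ℕ} (μ : SignedMeasure (Cube p)) (T : Cube p → ℝ) : Prop :=
  IsM0 μ ∧ ∀ c, T c = μ (Iic c)

/-- The space `𝕋` of tree functions. -/
def treeSpace (p : ℕ) : Set (Cube p → ℝ) := {T | ∃ μ, Represents μ T}

/-- The cone `𝕋⁺` of the tree functions with a nonnegative measure. -/
def treeCone (p : ℕ) : Set (Cube p → ℝ) := {T | ∃ μ, Represents μ T ∧ 0 ≤ μ}

open Classical in
/-- The (unique) signed measure `μ_T ∈ M₀` of a tree function `T` (`0` outside `𝕋`). -/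
def treeMeasure {p : ℕ} (T : Cube p → ℝ) : SignedMeasure (Cube p) :=
  if h : ∃ μ, Represents μ T then h.choose else 0

/-- The total variation norm `‖T‖_TV = ‖μ_T‖_TV = |μ_T|([0,1]^p)` of `T ∈ 𝕋`. -/
def tvNorm {p : ℕ} (T : Cube p → ℝ) : ℝ := ((treeMeasure T).totalVariation univ).toReal

/-- `T⁺`: the tree function of the positive part in the Jordan decomposition of `μ_T`. -/
def treePos {p : ℕ} (T : Cube p → ℝ) : Cube p → ℝ := fun c =>
  ((treeMeasure T).toJordanDecomposition.posPart (Iic c)).toReal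

/-- `T⁻`: the tree function of the negative part in the Jordan decomposition of `μ_T`. -/
def treeNeg {p : ℕ} (T : Cube p → ℝ) : Cube p → ℝ := fun c =>
  ((treeMeasure T).toJordanDecomposition.negPart (Iic c)).toReal

/-! ### The space `L²_x` -/

/-- The probability measure `ν = 3^{-p} ∑_{J, ε} Leb_{J, ε}` on the cube. The pair `(J, ε)`,
`J ⊆ {1, …, p}`, `ε ∈ {0,1}^{Jᶜ}`, is encoded by `s`, where `s j = none` means `j ∈ J` and
`s j = some b` means `j ∉ J` and `ε_j = b`. -/
def nu (p : ℕ) : Measure (Cube p) :=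
  ((3 : ℝ≥0∞) ^ p)⁻¹ • ∑ s : Fin p → Option Bool, Measure.pi fun j =>
    match s j with
    | none => (volume : Measure unitInterval)
    | some false => Measure.dirac 0
    | some true => Measure.dirac 1

/-- The probability measure `ν_x = ν / 2 + (1 / 2n) ∑ δ_{x_i}`. -/
def nuX {p n : ℕ} (x : Fin n → Cube p) : Measure (Cube p) :=
  (2 : ℝ≥0∞)⁻¹ • nu p + (2 * (n : ℝ≥0∞))⁻¹ • ∑ i, Measure.dirac (x i)

/-- The Hilbert space `L²_x = L²([0,1]^p, ν_x)`. Every `x i` is an atom of `ν_x`, so that the value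
of (the chosen representative of) `F : L2x x` at `x i` depends on the class only. -/
abbrev L2x {p n : ℕ} (x : Fin n → Cube p) := Lp ℝ 2 (nuX x)

/-- `𝕋⁺` as a subset of `L²_x`. -/
def treeConeL2 {p n : ℕ} (x : Fin n → Cube p) : Set (L2x x) :=
  {F | ∃ T ∈ treeCone p, F =ᵐ[nuX x] T}

/-- The closure of `𝕋⁺` in `L²_x`, with the induced metric. -/
abbrev TreeConeClosure {p n : ℕ} (x : Fin n → Cube p) := ↥(closure (treeConeL2 x))

/-! ### Softmax gradient trees -/

/-- A split `(j, u) ∈ {1, …, p} × (0,1)`. -/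
abbrev Split (p : ℕ) := Fin p × Ioo (0 : ℝ) 1

/-- Internal nodes of the binary tree of depth `d`: the words in `0, 1` of length `l < d`. -/
abbrev Node (d : ℕ) := Σ l : Fin d, (Fin l → Bool)

/-- The auxiliary randomness: `K` candidate splitting schemes and, for each internal node, the
number in `[0,1]` used for the softmax selection at this node. -/
abbrev Aux (p d K : ℕ) := (Fin K → Node d → Split p) × (Node d → unitInterval)

/-- The uniform distribution on `{1, …, p} × (0,1)`. -/
def splitLaw (p : ℕ) : Measure (Split p) :=
  (uniformOn (univ : Set (Fin p))).prod ((volume : Measure ℝ).comap Subtype.val)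

/-- The law of the auxiliary randomness: all candidate splits are uniform on `{1, …, p} × (0,1)`,
all selection variables are uniform on `[0,1]`, and everything is independent. -/
def auxLaw (p d K : ℕ) : Measure (Aux p d K) :=
  (Measure.pi fun _ => Measure.pi fun _ => splitLaw p).prod (Measure.pi fun _ => volume)

/-- The threshold `a^j + u (b^j - a^j)` of the split `(j, u)` of the region `A`. -/
def threshold {p : ℕ} (A : Set (Cube p)) (s : Split p) : ℝ :=
  sInf ((fun c : Cube p => (c s.1 : ℝ)) '' A) +
    (s.2 : ℝ) * (sSup ((fun c : Cube p => (c s.1 : ℝ)) '' A) -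
      sInf ((fun c : Cube p => (c s.1 : ℝ)) '' A))

/-- The two parts `A₀` (`b = false`) and `A₁` (`b = true`) of the split `s` of `A`. -/
def child {p : ℕ} (A : Set (Cube p)) (s : Split p) (b : Bool) : Set (Cube p) :=
  {c ∈ A | if b then threshold A s ≤ c s.1 else (c s.1 : ℝ) < threshold A s}

/-- The indicator function of `A`. -/
def ind {p : ℕ} (A : Set (Cube p)) (c : Cube p) : ℝ := A.indicator 1 c

/-- The mean of the `r i` with `x i ∈ A` (`0` if there are none). -/
def mean {p n : ℕ} (x : Fin n → Cube p) (r : Fin n → ℝ) (A : Set (Cube p)) : ℝ :=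
  (∑ i, r i * ind A (x i)) / ∑ i, ind A (x i)

/-- The empirical mean squared error on `A`. -/
def mse {p n : ℕ} (x : Fin n → Cube p) (r : Fin n → ℝ) (A : Set (Cube p)) : ℝ :=
  (∑ i, (r i - mean x r A) ^ 2 * ind A (x i)) / n

/-- The score (decrease of the mean squared error) of the split `s` of the region `A`. -/
def score {p n : ℕ} (x : Fin n → Cube p) (r : Fin n → ℝ) (s : Split p) (A : Set (Cube p)) : ℝ :=
  mse x r A - mse x r (child A s false) - mse x r (child A s true)

/-- The softmax function with parameter `β`. -/
def softmax {K : ℕ} (β : ℝ) (z : Fin K → ℝ) (k : Fin K) : ℝ :=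
  Real.exp (β * z k) / ∑ l, Real.exp (β * z l)

open Classical in
/-- Selection of an index with distribution `q` from a uniform number `γ`: the `k` with
`∑_{l < k} q l ≤ γ < ∑_{l ≤ k} q l` (for a probability vector `q` it exists if `γ < 1`). -/
def select {K : ℕ} [NeZero K] (q : Fin K → ℝ) (γ : ℝ) : Fin K :=
  if h : ∃ k, ∑ l ∈ Finset.Iio k, q l ≤ γ ∧ γ < ∑ l ∈ Finset.Iic k, q l then h.choose else 0

/-- The split performed at the internal node `v` with region `A`: one of the `K` candidate splits at
`v`, selected with probabilities `softmax_β (scores)`. -/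
def chosenSplit {p n d K : ℕ} [NeZero K] (β : ℝ) (x : Fin n → Cube p) (r : Fin n → ℝ)
    (ζ : Aux p d K) (v : Node d) (A : Set (Cube p)) : Split p :=
  ζ.1 (select (softmax β fun k => score x r (ζ.1 k v) A) (ζ.2 v : ℝ)) v

/-- The region `A_v` of the vertex `v` (a word of length `l ≤ d`) in the softmax regression tree with
parameter `(β, K, d)` fitted to the sample `(x_i, r_i)` with auxiliary randomness `ζ`. -/
def region {p n d K : ℕ} [NeZero K] (β : ℝ) (x : Fin n → Cube p) (r : Fin n → ℝ)
    (ζ : Aux p d K) : (l : ℕ) → l ≤ d → (Fin l → Bool) → Set (Cube p)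
  | 0, _, _ => univ
  | l + 1, h, w =>
    let A := region β x r ζ l (Nat.le_of_succ_le h) (Fin.init w)
    child A (chosenSplit β x r ζ ⟨⟨l, h⟩, Fin.init w⟩ A) (w (Fin.last l))

/-- The data and hyperparameters of gradient boosting: the sample `(x_i, y_i)`, the loss function
`L` and the softmax parameter `β`; the number `K` of proposals and the depth `d` are parameters
of the type. -/
structure BoostingData (p n d K : ℕ) where
  x : Fin n → Cube p
  y : Fin n → ℝ
  L : ℝ → ℝ → ℝ
  β : ℝ

/-- The assumption on the loss function. -/
structure LossAssumption (L : ℝ → ℝ → ℝ) : Prop where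
  nonneg : ∀ y z, 0 ≤ L y z
  differentiable : ∀ y, Differentiable ℝ (L y)
  differentiable_deriv : ∀ y, Differentiable ℝ (deriv (L y))
  second_deriv_pos : ∀ y z, 0 < deriv (deriv (L y)) z
  second_deriv_lipschitz : ∀ y, LocallyLipschitz (deriv (deriv (L y)))
  ratio_bounded : ∀ C > 0, ∃ M, ∀ y z, L y z ≤ C →
    |deriv (L y) z / deriv (deriv (L y)) z| ≤ M

namespace BoostingData

variable {p n d K : ℕ} [NeZero K] (B : BoostingData p n d K)

/-- The residuals `r_i = - ∂L/∂z (y_i, z_i)`, where `z_i = F(x_i)`. -/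
def residual (z : Fin n → ℝ) (i : Fin n) : ℝ := -deriv (B.L (B.y i)) (z i)

/-- The leaf value `r̃(A)` given by the one-step approximation of the line search (`0` if `A` contains
no `x i`), where `z_i = F(x_i)`. -/
def leafValue (z : Fin n → ℝ) (A : Set (Cube p)) : ℝ :=
  -((∑ i, deriv (B.L (B.y i)) (z i) * ind A (B.x i)) /
    ∑ i, deriv (deriv (B.L (B.y i))) (z i) * ind A (B.x i))

/-- The leaf `A_w`, `w ∈ {0,1}^d`, of the softmax regression tree fitted to the residuals. -/
def leaf (z : Fin n → ℝ) (ζ : Aux p d K) (w : Fin d → Bool) : Set (Cube p) :=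
  region B.β B.x (B.residual z) ζ d le_rfl w

/-- The softmax gradient tree `T̃(·; F, ζ)`, as a function of `z_i = F(x_i)`. -/
def gradTree (z : Fin n → ℝ) (ζ : Aux p d K) : Cube p → ℝ := fun c =>
  ∑ w : Fin d → Bool, B.leafValue z (B.leaf z ζ w) * ind (B.leaf z ζ w) c

/-- The infinitesimal boosting operator `𝒯(F) = E[T̃(·; F, ζ)]`, as a function of `z_i = F(x_i)`. -/
def op (z : Fin n → ℝ) : Cube p → ℝ := fun c => ∫ ζ, B.gradTree z ζ c ∂auxLaw p d K

/-- `𝒯⁺(F) = E[T̃⁺(·; F, ζ)]`, as a function of `z_i = F(x_i)`. -/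
def opPos (z : Fin n → ℝ) : Cube p → ℝ := fun c => ∫ ζ, treePos (B.gradTree z ζ) c ∂auxLaw p d K

/-- `𝒯⁻(F) = E[T̃⁻(·; F, ζ)]`, as a function of `z_i = F(x_i)`. -/
def opNeg (z : Fin n → ℝ) : Cube p → ℝ := fun c => ∫ ζ, treeNeg (B.gradTree z ζ) c ∂auxLaw p d K

/-- `t ↦ (F⁺(t), F⁻(t))` solves, on `[0, ∞)` and in `L²_x × L²_x`, the system
`dF^±/dt = 𝒯^±(F⁺ - F⁻)`. -/
def IsSolutionPM (F : ℝ → L2x B.x × L2x B.x) : Prop :=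
  ∀ t ≥ 0, ∃ V : L2x B.x × L2x B.x,
    V.1 =ᵐ[nuX B.x] B.opPos (fun i => ((F t).1 - (F t).2 : L2x B.x) (B.x i)) ∧
    V.2 =ᵐ[nuX B.x] B.opNeg (fun i => ((F t).1 - (F t).2 : L2x B.x) (B.x i)) ∧
    HasDerivWithinAt F V (Ici 0) t

/-- `t ↦ G(t)` solves, on `[0, ∞)` and in the Banach space `(𝕋, ‖·‖_TV)`, the equation
`dG/dt = 𝒯(G)`. -/
def IsTreeSolution (G : ℝ → Cube p → ℝ) : Prop :=
  ∀ t ≥ 0, G t ∈ treeSpace p ∧ B.op (fun i => G t (B.x i)) ∈ treeSpace p ∧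
    Tendsto (fun s => tvNorm fun c =>
      (G s c - G t c) / (s - t) - B.op (fun i => G t (B.x i)) c) (𝓝[Ici 0 \ {t}] t) (𝓝 0)

/-- The positive and negative components `(F̂_m^{λ+}, F̂_m^{λ-})` of gradient boosting with learning
rate `lam`, started from the positive and negative parts of the constant function `z₀` and driven by
the auxiliary randomness `ζ 0, ζ 1, …` (`ζ m` is used at the step from `m` to `m + 1`). -/
def chain (z₀ lam : ℝ) (ζ : ℕ → Aux p d K) : ℕ → (Cube p → ℝ) × (Cube p → ℝ)
  | 0 => (treePos fun _ => z₀, treeNeg fun _ => z₀)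
  | m + 1 =>
    let F := chain z₀ lam ζ m
    let z : Fin n → ℝ := fun i => F.1 (B.x i) - F.2 (B.x i)
    (F.1 + lam • treePos (B.gradTree z (ζ m)), F.2 + lam • treeNeg (B.gradTree z (ζ m)))

end BoostingData

end InfGB

end

open InfGB

open MeasureTheory ProbabilityTheory Filter Topology Set
open scoped ENNReal NNReal
open InfGB

noncomputable section

namespace InfGB

/-! ### Signed measures on the cube -/

variable {p : ℕ}

/-- The upper boundary of the cube, which the measures of tree functions do not charge. -/
def upperBoundary (p : ℕ) : Set (Cube p) := {c | ∃ j, c j = 1}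

lemma measurableSet_upperBoundary : MeasurableSet (upperBoundary p) := by
  have : upperBoundary p = ⋃ j, (fun c : Cube p => c j) ⁻¹' {1} := by
    ext c; simp [upperBoundary]
  rw [this]
  exact MeasurableSet.iUnion fun j => (measurable_pi_apply j) (measurableSet_singleton 1)

lemma measurableSet_Iic_cube (c : Cube p) : MeasurableSet (Iic c) := by
  have : Iic c = ⋂ j, (fun c : Cube p => c j) ⁻¹' (Iic (c j)) := by
    ext e; simp [Pi.le_def]
  rw [this]
  exact MeasurableSet.iInter fun j => (measurable_pi_apply j) measurableSet_Iic

lemma measurableSet_le_cube : MeasurableSet {q : Cube p × Cube p | q.1 ≤ q.2} := by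
  have : {q : Cube p × Cube p | q.1 ≤ q.2} = ⋂ j, {q | q.1 j ≤ q.2 j} := by
    ext q; simp [Pi.le_def]
  rw [this]
  exact MeasurableSet.iInter fun j => measurableSet_le
    ((measurable_pi_apply j).comp measurable_fst) ((measurable_pi_apply j).comp measurable_snd)

lemma generateFrom_Iic_cube :
    (inferInstance : MeasurableSpace (Cube p)) = MeasurableSpace.generateFrom (range Iic) := by
  apply le_antisymm
  · have h : ∀ j : Fin p, @Measurable _ _ (MeasurableSpace.generateFrom (range Iic)) _
        (fun c : Cube p => c j) := by
      intro j
      apply measurable_of_Iic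
      intro t
      apply MeasurableSpace.measurableSet_generateFrom
      refine ⟨fun k => if k = j then t else 1, ?_⟩
      ext c
      simp only [mem_Iic, Pi.le_def, mem_preimage]
      constructor
      · intro h; simpa using h j
      · intro h k
        split_ifs with hk
        · exact hk ▸ h
        · exact unitInterval.le_one' 
    exact iSup_le fun j => (h j).comap_le
  · apply MeasurableSpace.generateFrom_le
    rintro _ ⟨c, rfl⟩
    exact measurableSet_Iic_cube c

lemma isPiSystem_Iic_cube : IsPiSystem (range (Iic : Cube p → Set (Cube p))) := by
  rintro _ ⟨a, rfl⟩ _ ⟨b, rfl⟩ -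
  exact ⟨a ⊓ b, Iic_inter_Iic.symm⟩

lemma measure_ext_of_Iic {μ ν : Measure (Cube p)} [IsFiniteMeasure μ]
    (h : ∀ c, μ (Iic c) = ν (Iic c)) : μ = ν := by
  refine ext_of_generate_finite _ generateFrom_Iic_cube isPiSystem_Iic_cube ?_ ?_
  · rintro _ ⟨c, rfl⟩; exact h c
  · have : (univ : Set (Cube p)) = Iic 1 := by
      ext c; simp only [mem_univ, mem_Iic, true_iff, Pi.le_def]
      exact fun j => unitInterval.le_one'
    rw [this]; exact h _

lemma measureReal_ext_of_Iic {μ ν : Measure (Cube p)} [IsFiniteMeasure μ] [IsFiniteMeasure ν]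
    (h : ∀ c, μ.real (Iic c) = ν.real (Iic c)) : μ = ν :=
  measure_ext_of_Iic fun c => (measureReal_eq_measureReal_iff).1 (h c)

lemma signedMeasure_ext_of_Iic {μ ν : SignedMeasure (Cube p)}
    (h : ∀ c, μ (Iic c) = ν (Iic c)) : μ = ν := by
  have key : μ.toJordanDecomposition.posPart + ν.toJordanDecomposition.negPart =
      ν.toJordanDecomposition.posPart + μ.toJordanDecomposition.negPart := by
    refine measureReal_ext_of_Iic fun c => ?_
    have := h c
    rw [SignedMeasure.apply_eq_posPart_real_sub_negPart_real _ (measurableSet_Iic_cube c),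
      SignedMeasure.apply_eq_posPart_real_sub_negPart_real _ (measurableSet_Iic_cube c)] at this
    rw [measureReal_add_apply, measureReal_add_apply]
    linarith
  ext E hE
  rw [SignedMeasure.apply_eq_posPart_real_sub_negPart_real _ hE,
    SignedMeasure.apply_eq_posPart_real_sub_negPart_real _ hE]
  have : (_ : Measure (Cube p)).real E = (_ : Measure (Cube p)).real E :=
    congrArg (fun m : Measure (Cube p) => m.real E) key
  rw [measureReal_add_apply, measureReal_add_apply] at this
  linarith

lemma Represents.unique {μ ν : SignedMeasure (Cube p)} {T : Cube p → ℝ}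
    (hμ : Represents μ T) (hν : Represents ν T) : μ = ν :=
  signedMeasure_ext_of_Iic fun c => by rw [← hμ.2 c, ← hν.2 c]

lemma treeMeasure_eq {μ : SignedMeasure (Cube p)} {T : Cube p → ℝ} (h : Represents μ T) :
    treeMeasure T = μ := by
  have hex : ∃ μ, Represents μ T := ⟨μ, h⟩
  rw [treeMeasure, dif_pos hex]
  exact hex.choose_spec.unique h

lemma toJordanDecomposition_le {s : SignedMeasure (Cube p)} {P Q : Measure (Cube p)}
    [IsFiniteMeasure P] [IsFiniteMeasure Q] (h : s = P.toSignedMeasure - Q.toSignedMeasure) :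
    s.toJordanDecomposition.posPart ≤ P ∧ s.toJordanDecomposition.negPart ≤ Q := by
  have hs : ∀ E, MeasurableSet E → s E = P.real E - Q.real E := by
    intro E hE; rw [h, Measure.toSignedMeasure_sub_apply hE]
  obtain ⟨i, hi, hi₂, hi₃, hp, hq⟩ := s.toJordanDecomposition_spec
  constructor
  · refine Measure.le_iff.2 fun E hE => ?_
    rw [← ENNReal.toReal_le_toReal (measure_ne_top _ _) (measure_ne_top _ _)]
    rw [hp, SignedMeasure.toMeasureOfZeroLE_apply _ _ hi hE]
    simp only [ENNReal.coe_toReal]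
    change s (i ∩ E) ≤ P.real E
    rw [hs _ (hi.inter hE)]
    have h1 : P.real (i ∩ E) ≤ P.real E := measureReal_mono inter_subset_right
    have h2 : 0 ≤ Q.real (i ∩ E) := measureReal_nonneg
    linarith
  · refine Measure.le_iff.2 fun E hE => ?_
    rw [← ENNReal.toReal_le_toReal (measure_ne_top _ _) (measure_ne_top _ _)]
    rw [hq, SignedMeasure.toMeasureOfLEZero_apply _ _ hi.compl hE]
    simp only [ENNReal.coe_toReal]
    change -s (iᶜ ∩ E) ≤ Q.real E
    rw [hs _ (hi.compl.inter hE)]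
    have h1 : Q.real (iᶜ ∩ E) ≤ Q.real E := measureReal_mono inter_subset_right
    have h2 : 0 ≤ P.real (iᶜ ∩ E) := measureReal_nonneg
    linarith

lemma represents_sub {P Q : Measure (Cube p)} [IsFiniteMeasure P] [IsFiniteMeasure Q]
    (hP : P (upperBoundary p) = 0) (hQ : Q (upperBoundary p) = 0) {T : Cube p → ℝ}
    (hT : ∀ c, T c = P.real (Iic c) - Q.real (Iic c)) :
    Represents (P.toSignedMeasure - Q.toSignedMeasure) T := by
  constructor
  · obtain ⟨h1, h2⟩ := toJordanDecomposition_le (rfl : P.toSignedMeasure - Q.toSignedMeasure = _)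
    rw [IsM0, SignedMeasure.totalVariation, Measure.add_apply, add_eq_zero]
    exact ⟨nonpos_iff_eq_zero.1 ((h1 _).trans_eq hP), nonpos_iff_eq_zero.1 ((h2 _).trans_eq hQ)⟩
  · intro c
    rw [hT, Measure.toSignedMeasure_sub_apply (measurableSet_Iic_cube c)]

lemma mem_treeSpace_iff {T : Cube p → ℝ} : T ∈ treeSpace p ↔
    ∃ P Q : Measure (Cube p), IsFiniteMeasure P ∧ IsFiniteMeasure Q ∧
      P (upperBoundary p) = 0 ∧ Q (upperBoundary p) = 0 ∧
      P.real univ + Q.real univ = tvNorm T ∧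
      ∀ c, T c = P.real (Iic c) - Q.real (Iic c) := by
  constructor
  · rintro ⟨μ, hμ⟩
    have h0 := hμ.1
    rw [IsM0, SignedMeasure.totalVariation, Measure.add_apply, add_eq_zero] at h0
    refine ⟨_, _, inferInstance, inferInstance, h0.1, h0.2, ?_, fun c => ?_⟩
    · rw [tvNorm, treeMeasure_eq hμ, SignedMeasure.totalVariation, ← measureReal_add_apply]
      rfl
    · rw [hμ.2, SignedMeasure.apply_eq_posPart_real_sub_negPart_real _ (measurableSet_Iic_cube c)]
  · rintro ⟨P, Q, hP, hQ, hP0, hQ0, -, hT⟩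
    exact ⟨_, represents_sub hP0 hQ0 hT⟩

lemma treePos_of_mutuallySingular {P Q : Measure (Cube p)} [IsFiniteMeasure P] [IsFiniteMeasure Q]
    (hP : P (upperBoundary p) = 0) (hQ : Q (upperBoundary p) = 0) (hPQ : P ⟂ₘ Q) {T : Cube p → ℝ}
    (hT : ∀ c, T c = P.real (Iic c) - Q.real (Iic c)) (c : Cube p) :
    treePos T c = P.real (Iic c) ∧ treeNeg T c = Q.real (Iic c) := by
  have h := treeMeasure_eq (represents_sub hP hQ hT)
  have hJ : (treeMeasure T).toJordanDecomposition = ⟨P, Q, hPQ⟩ :=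
    SignedMeasure.toJordanDecomposition_eq h
  simp only [treePos, treeNeg, hJ]
  exact ⟨rfl, rfl⟩

lemma mem_treeSpace_of_sub {P Q : Measure (Cube p)} [IsFiniteMeasure P] [IsFiniteMeasure Q]
    (hP : P (upperBoundary p) = 0) (hQ : Q (upperBoundary p) = 0) {T : Cube p → ℝ}
    (hT : ∀ c, T c = P.real (Iic c) - Q.real (Iic c)) : T ∈ treeSpace p :=
  ⟨_, represents_sub hP hQ hT⟩

lemma tvNorm_le {P Q : Measure (Cube p)} [IsFiniteMeasure P] [IsFiniteMeasure Q]
    (hP : P (upperBoundary p) = 0) (hQ : Q (upperBoundary p) = 0) {T : Cube p → ℝ}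
    (hT : ∀ c, T c = P.real (Iic c) - Q.real (Iic c)) :
    tvNorm T ≤ P.real univ + Q.real univ := by
  obtain ⟨h1, h2⟩ := toJordanDecomposition_le (treeMeasure_eq (represents_sub hP hQ hT))
  rw [tvNorm, SignedMeasure.totalVariation, ← measureReal_def, measureReal_add_apply]
  exact add_le_add (ENNReal.toReal_mono (measure_ne_top _ _) (h1 _))
    (ENNReal.toReal_mono (measure_ne_top _ _) (h2 _))

lemma mem_treeCone_of {P : Measure (Cube p)} [IsFiniteMeasure P]
    (hP : P (upperBoundary p) = 0) {T : Cube p → ℝ} (hT : ∀ c, T c = P.real (Iic c)) :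
    T ∈ treeCone p := by
  have h := represents_sub (Q := 0) hP (by simp) (T := T) (by simpa using hT)
  refine ⟨_, h, ?_⟩
  rw [VectorMeasure.le_iff]
  intro E hE
  rw [Measure.toSignedMeasure_sub_apply hE]
  simp

lemma mem_treeCone_iff {T : Cube p → ℝ} : T ∈ treeCone p ↔
    ∃ P : Measure (Cube p), IsFiniteMeasure P ∧ P (upperBoundary p) = 0 ∧
      ∀ c, T c = P.real (Iic c) := by
  constructor
  · rintro ⟨μ, hμ, h0⟩
    have hr := VectorMeasure.restrict_le_restrict_iff 0 μ MeasurableSet.univ |>.2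
      fun {E} hE _ => (VectorMeasure.le_iff.1 h0) E hE
    have h1 := hμ.1
    rw [IsM0, SignedMeasure.totalVariation, Measure.add_apply, add_eq_zero] at h1
    have hn : μ.toJordanDecomposition.negPart = 0 := by
      obtain ⟨i, hi, hi₂, hi₃, hp, hq⟩ := μ.toJordanDecomposition_spec
      ext E hE
      rw [hq, SignedMeasure.toMeasureOfLEZero_apply _ _ hi.compl hE]
      have a1 : 0 ≤ μ (iᶜ ∩ E) := (VectorMeasure.le_iff.1 h0) _ (hi.compl.inter hE)
      have a2 : μ (iᶜ ∩ E) ≤ 0 :=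
        (VectorMeasure.restrict_le_restrict_iff μ 0 hi.compl).1 hi₃ (hi.compl.inter hE)
          inter_subset_left
      have a3 := le_antisymm a2 a1
      simp [a3]
    refine ⟨_, inferInstance, h1.1, fun c => ?_⟩
    rw [hμ.2, SignedMeasure.apply_eq_posPart_real_sub_negPart_real _ (measurableSet_Iic_cube c), hn]
    simp
  · rintro ⟨P, hP, h0, hT⟩
    exact mem_treeCone_of h0 hT

lemma treeCone_subset_treeSpace : treeCone p ⊆ treeSpace p := fun _ ⟨μ, h, _⟩ => ⟨μ, h⟩

lemma add_mem_treeCone {S T : Cube p → ℝ} (hS : S ∈ treeCone p) (hT : T ∈ treeCone p) :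
    S + T ∈ treeCone p := by
  obtain ⟨P, hP, hP0, hPS⟩ := mem_treeCone_iff.1 hS
  obtain ⟨Q, hQ, hQ0, hQT⟩ := mem_treeCone_iff.1 hT
  refine mem_treeCone_of (P := P + Q) (by simp [hP0, hQ0]) fun c => ?_
  rw [Pi.add_apply, hPS, hQT, measureReal_add_apply]

lemma smul_mem_treeCone {T : Cube p → ℝ} (hT : T ∈ treeCone p) {r : ℝ} (hr : 0 ≤ r) :
    r • T ∈ treeCone p := by
  obtain ⟨Q, hQ, hQ0, hQT⟩ := mem_treeCone_iff.1 hT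
  refine mem_treeCone_of (P := r.toNNReal • Q) (by simp [hQ0]) fun c => ?_
  rw [Pi.smul_apply, hQT, measureReal_nnreal_smul_apply, Real.coe_toNNReal _ hr, smul_eq_mul]

lemma treePos_mem_treeCone {T : Cube p → ℝ} (hT : T ∈ treeSpace p) : treePos T ∈ treeCone p := by
  obtain ⟨μ, hμ⟩ := hT
  have h0 := hμ.1
  rw [IsM0, SignedMeasure.totalVariation, Measure.add_apply, add_eq_zero] at h0
  refine mem_treeCone_of h0.1 fun c => ?_
  rw [treePos, treeMeasure_eq hμ]; rfl

lemma treeNeg_mem_treeCone {T : Cube p → ℝ} (hT : T ∈ treeSpace p) : treeNeg T ∈ treeCone p := by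
  obtain ⟨μ, hμ⟩ := hT
  have h0 := hμ.1
  rw [IsM0, SignedMeasure.totalVariation, Measure.add_apply, add_eq_zero] at h0
  refine mem_treeCone_of h0.2 fun c => ?_
  rw [treeNeg, treeMeasure_eq hμ]; rfl

lemma treePos_sub_treeNeg {T : Cube p → ℝ} (hT : T ∈ treeSpace p) (c : Cube p) :
    treePos T c - treeNeg T c = T c := by
  obtain ⟨μ, hμ⟩ := hT
  rw [treePos, treeNeg, treeMeasure_eq hμ, hμ.2 c,
    SignedMeasure.apply_eq_posPart_real_sub_negPart_real _ (measurableSet_Iic_cube c)]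
  rfl

/-- The space of tree functions as a linear subspace of the space of functions on the cube. -/
def treeSubmodule (p : ℕ) : Submodule ℝ (Cube p → ℝ) where
  carrier := treeSpace p
  zero_mem' := mem_treeSpace_of_sub (P := 0) (Q := 0) (by simp) (by simp) (by simp)
  add_mem' := by
    intro S T hS hT
    obtain ⟨P, Q, hP, hQ, hP0, hQ0, -, hS⟩ := mem_treeSpace_iff.1 hS
    obtain ⟨P', Q', hP', hQ', hP0', hQ0', -, hT⟩ := mem_treeSpace_iff.1 hT
    refine mem_treeSpace_of_sub (P := P + P') (Q := Q + Q') (by simp [hP0, hP0'])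
      (by simp [hQ0, hQ0']) fun c => ?_
    rw [Pi.add_apply, hS, hT, measureReal_add_apply, measureReal_add_apply]; ring
  smul_mem' := by
    intro r S hS
    obtain ⟨P, Q, hP, hQ, hP0, hQ0, -, hS⟩ := mem_treeSpace_iff.1 hS
    rcases le_total 0 r with hr | hr
    · refine mem_treeSpace_of_sub (P := r.toNNReal • P) (Q := r.toNNReal • Q) (by simp [hP0])
        (by simp [hQ0]) fun c => ?_
      rw [Pi.smul_apply, hS, measureReal_nnreal_smul_apply, measureReal_nnreal_smul_apply,
        Real.coe_toNNReal _ hr, smul_eq_mul]; ring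
    · refine mem_treeSpace_of_sub (P := (-r).toNNReal • Q) (Q := (-r).toNNReal • P) (by simp [hQ0])
        (by simp [hP0]) fun c => ?_
      rw [Pi.smul_apply, hS, measureReal_nnreal_smul_apply, measureReal_nnreal_smul_apply,
        Real.coe_toNNReal _ (neg_nonneg.2 hr), smul_eq_mul]; ring

lemma abs_le_tvNorm {T : Cube p → ℝ} (hT : T ∈ treeSpace p) (c : Cube p) : |T c| ≤ tvNorm T := by
  obtain ⟨P, Q, hP, hQ, hP0, hQ0, hn, hS⟩ := mem_treeSpace_iff.1 hT
  rw [hS, ← hn]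
  have h1 : P.real (Iic c) ≤ P.real univ := measureReal_mono (subset_univ _)
  have h2 : Q.real (Iic c) ≤ Q.real univ := measureReal_mono (subset_univ _)
  have h3 : 0 ≤ P.real (Iic c) := measureReal_nonneg
  have h4 : 0 ≤ Q.real (Iic c) := measureReal_nonneg
  rw [abs_le]; constructor <;> linarith

lemma measurable_measureReal_Iic (P : Measure (Cube p)) [IsFiniteMeasure P] :
    Measurable fun c => P.real (Iic c) := by
  apply Measurable.ennreal_toReal
  exact measurable_measure_prodMk_left (ν := P) (s := {q : Cube p × Cube p | q.2 ≤ q.1})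
    (measurable_swap measurableSet_le_cube)

lemma measurable_of_mem_treeSpace {T : Cube p → ℝ} (hT : T ∈ treeSpace p) : Measurable T := by
  obtain ⟨P, Q, hP, hQ, -, -, -, hS⟩ := mem_treeSpace_iff.1 hT
  rw [show T = fun c => P.real (Iic c) - Q.real (Iic c) from funext hS]
  exact (measurable_measureReal_Iic P).sub (measurable_measureReal_Iic Q)

end InfGB

end

noncomputable section

namespace InfGB

/-! ### Superpositions of step functions -/

variable {p : ℕ}

open Classical in
/-- The tree function of the Dirac mass at `q`. -/
def step (q c : Cube p) : ℝ := if q ≤ c then 1 else 0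

lemma step_nonneg (q c : Cube p) : 0 ≤ step q c := by unfold step; split_ifs <;> norm_num

lemma step_le_one (q c : Cube p) : step q c ≤ 1 := by unfold step; split_ifs <;> norm_num

lemma abs_step_le_one (q c : Cube p) : |step q c| ≤ 1 := by
  rw [abs_of_nonneg (step_nonneg q c)]; exact step_le_one q c

lemma measurable_step : Measurable fun q : Cube p × Cube p => step q.1 q.2 :=
  Measurable.ite measurableSet_le_cube measurable_const measurable_const

lemma abs_sum_mul_step_le {ι : Type*} [Fintype ι] (m : ι → ℝ) (q : ι → Cube p) (c : Cube p) :
    |∑ a, m a * step (q a) c| ≤ ∑ a, |m a| := by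
  refine (Finset.abs_sum_le_sum_abs _ _).trans (Finset.sum_le_sum fun a _ => ?_)
  rw [abs_mul]
  exact mul_le_of_le_one_right (abs_nonneg _) (abs_step_le_one _ _)

section PosMass

variable {ι : Type*} [Fintype ι] {α : Type*} [DecidableEq α]

/-- The number of indices with the same position as `a`. -/
def multiplicity (q : ι → α) (a : ι) : ℝ := ∑ b, if q b = q a then 1 else 0

/-- The total mass at the point `c` of the masses `m b` at the positions `q b`. -/
def massAt (m : ι → ℝ) (q : ι → α) (c : α) : ℝ := ∑ b, if q b = c then m b else 0

/-- The positive part of the total mass at the position of `a`, divided evenly between the indices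
with that position. -/
def posMass (m : ι → ℝ) (q : ι → α) (a : ι) : ℝ :=
  max (massAt m q (q a)) 0 / multiplicity q a

lemma one_le_multiplicity (q : ι → α) (a : ι) : 1 ≤ multiplicity q a := by
  unfold multiplicity
  have := Finset.single_le_sum (f := fun b => if q b = q a then (1 : ℝ) else 0) (s := Finset.univ)
    (fun b _ => by split_ifs <;> norm_num) (Finset.mem_univ a)
  simpa using this

lemma posMass_nonneg (m : ι → ℝ) (q : ι → α) (a : ι) : 0 ≤ posMass m q a :=
  div_nonneg (le_max_right _ _) (zero_le_one.trans (one_le_multiplicity q a))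

lemma massAt_neg (m : ι → ℝ) (q : ι → α) (c : α) : massAt (-m) q c = -massAt m q c := by
  simp only [massAt, Pi.neg_apply, ← Finset.sum_neg_distrib]
  exact Finset.sum_congr rfl fun b _ => by split_ifs <;> simp

lemma posMass_sub_posMass_neg (m : ι → ℝ) (q : ι → α) (a : ι) :
    posMass m q a - posMass (-m) q a = massAt m q (q a) / multiplicity q a := by
  rw [posMass, posMass, massAt_neg, ← sub_div]
  congr 1
  rcases le_total 0 (massAt m q (q a)) with h | h
  · rw [max_eq_left h, max_eq_right (by linarith)]; ring
  · rw [max_eq_right h, max_eq_left (by linarith)]; ring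

lemma sum_massAt_div_multiplicity (m : ι → ℝ) (q : ι → α) (f : α → ℝ) :
    ∑ a, massAt m q (q a) / multiplicity q a * f (q a) = ∑ a, m a * f (q a) := by
  have h1 : ∀ a, massAt m q (q a) / multiplicity q a * f (q a) =
      ∑ b, (if q b = q a then m b * f (q b) / multiplicity q b else 0) := by
    intro a
    rw [massAt, Finset.sum_div, Finset.sum_mul]
    refine Finset.sum_congr rfl fun b _ => ?_
    split_ifs with h
    · simp only [multiplicity, h]; ring
    · simp
  simp_rw [h1]
  rw [Finset.sum_comm]
  refine Finset.sum_congr rfl fun b _ => ?_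
  have h2 : ∀ a, (if q b = q a then m b * f (q b) / multiplicity q b else 0) =
      (m b * f (q b) / multiplicity q b) * (if q a = q b then 1 else 0) := by
    intro a
    by_cases h : q b = q a
    · simp [h]
    · simp [h, Ne.symm h]
  simp_rw [h2]
  rw [← Finset.mul_sum]
  change _ * multiplicity q b = _
  have := one_le_multiplicity q b
  field_simp

lemma abs_posMass_sub_le (m m' : ι → ℝ) (q : ι → α) (a : ι) :
    |posMass m q a - posMass m' q a| ≤ ∑ b, |m b - m' b| := by
  have h1 := one_le_multiplicity q a
  rw [posMass, posMass, ← sub_div, abs_div, abs_of_pos (by linarith : 0 < multiplicity q a)]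
  refine (div_le_self (abs_nonneg _) h1).trans ?_
  refine (abs_max_sub_max_le_abs _ _ _).trans ?_
  rw [massAt, massAt, ← Finset.sum_sub_distrib]
  refine (Finset.abs_sum_le_sum_abs _ _).trans (Finset.sum_le_sum fun b _ => ?_)
  split_ifs
  · exact le_rfl
  · simp

lemma posMass_zero (q : ι → α) (a : ι) : posMass (0 : ι → ℝ) q a = 0 := by
  simp [posMass, massAt]

lemma posMass_le (m : ι → ℝ) (q : ι → α) (a : ι) : posMass m q a ≤ ∑ b, |m b| := by
  have := abs_posMass_sub_le m 0 q a
  rw [posMass_zero, sub_zero, abs_of_nonneg (posMass_nonneg _ _ _)] at this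
  simpa using this

end PosMass

/-- The measure with the masses `m a` at the positions `q a`. -/
def atomicMeasure {ι : Type*} [Fintype ι] (m : ι → ℝ) (q : ι → Cube p) : Measure (Cube p) :=
  ∑ a, ENNReal.ofReal (m a) • Measure.dirac (q a)

section Atomic

variable {ι : Type*} [Fintype ι]

instance (m : ι → ℝ) (q : ι → Cube p) : IsFiniteMeasure (atomicMeasure m q) := by
  constructor
  simp [atomicMeasure]

lemma atomicMeasure_null {m : ι → ℝ} {q : ι → Cube p} {E : Set (Cube p)} (hE : MeasurableSet E)
    (h : ∀ a, q a ∈ E → m a ≤ 0) : atomicMeasure m q E = 0 := by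
  simp only [atomicMeasure, Measure.coe_finsetSum, Finset.sum_apply, Measure.smul_apply,
    smul_eq_mul, Finset.sum_eq_zero_iff, Finset.mem_univ, true_imp_iff]
  intro a
  by_cases ha : q a ∈ E
  · simp [ENNReal.ofReal_of_nonpos (h a ha)]
  · rw [Measure.dirac_apply' _ hE]; simp [ha]

lemma atomicMeasure_Iic {m : ι → ℝ} (hm : ∀ a, 0 ≤ m a) (q : ι → Cube p) (c : Cube p) :
    (atomicMeasure m q).real (Iic c) = ∑ a, m a * step (q a) c := by
  simp only [atomicMeasure, measureReal_def, Measure.coe_finsetSum, Finset.sum_apply,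
    Measure.smul_apply, smul_eq_mul]
  rw [ENNReal.toReal_sum]
  · refine Finset.sum_congr rfl fun a _ => ?_
    rw [Measure.dirac_apply' _ (measurableSet_Iic_cube c), ENNReal.toReal_mul,
      ENNReal.toReal_ofReal (hm a)]
    by_cases h : q a ≤ c <;> simp [step, h]
  · intro a _
    rw [Measure.dirac_apply' _ (measurableSet_Iic_cube c)]
    refine ENNReal.mul_ne_top ENNReal.ofReal_ne_top ?_
    by_cases h : q a ≤ c <;> simp [h]

open Classical in
/-- The positive and negative parts of a finite combination of step functions. -/
lemma treePos_sum_step {m : ι → ℝ} {q : ι → Cube p} (hq : ∀ a, q a ∉ upperBoundary p)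
    (c : Cube p) :
    treePos (fun c => ∑ a, m a * step (q a) c) c = ∑ a, posMass m q a * step (q a) c ∧
    treeNeg (fun c => ∑ a, m a * step (q a) c) c = ∑ a, posMass (-m) q a * step (q a) c := by
  have hE : ∀ m : ι → ℝ, atomicMeasure m q (upperBoundary p) = 0 := fun m =>
    atomicMeasure_null measurableSet_upperBoundary fun a ha => absurd ha (hq a)
  have hsing : atomicMeasure (posMass m q) q ⟂ₘ atomicMeasure (posMass (-m) q) q := by
    have hfin : (q '' {a | massAt m q (q a) ≤ 0}).Finite := (Set.toFinite _).image q
    refine ⟨q '' {a | massAt m q (q a) ≤ 0}, hfin.measurableSet, ?_, ?_⟩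
    · refine atomicMeasure_null hfin.measurableSet ?_
      rintro a ⟨b, hb, hba⟩
      rw [mem_ofPred_eq, hba] at hb
      simp [posMass, max_eq_right hb]
    · refine atomicMeasure_null hfin.measurableSet.compl ?_
      intro a ha
      have : ¬ massAt m q (q a) ≤ 0 := fun h => ha ⟨a, h, rfl⟩
      rw [posMass, massAt_neg, max_eq_right (by linarith)]; simp
  have := treePos_of_mutuallySingular (hE _) (hE _) hsing
    (T := fun c => ∑ a, m a * step (q a) c) (fun c => ?_) c
  · rwa [atomicMeasure_Iic (posMass_nonneg _ _), atomicMeasure_Iic (posMass_nonneg _ _)] at this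
  · rw [atomicMeasure_Iic (posMass_nonneg _ _), atomicMeasure_Iic (posMass_nonneg _ _),
      ← Finset.sum_sub_distrib]
    simp_rw [← sub_mul, posMass_sub_posMass_neg]
    exact (sum_massAt_div_multiplicity m q fun x => step x c).symm

end Atomic

section Mixture

variable {ι : Type*} [Fintype ι] {Y : Type*} [MeasurableSpace Y]

/-- The measure which puts the masses `g a y` at the positions `q a y`, integrated over `y`. -/
def mixture (ρ : Measure Y) (g : ι → Y → ℝ) (q : ι → Y → Cube p) : Measure (Cube p) :=
  ∑ a, (ρ.withDensity fun y => ENNReal.ofReal (g a y)).map (q a)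

variable {ρ : Measure Y} {g : ι → Y → ℝ} {q : ι → Y → Cube p}

lemma isFiniteMeasure_mixture (hg : ∀ a, Integrable (g a) ρ) :
    IsFiniteMeasure (mixture ρ g q) := by
  have (a : ι) : IsFiniteMeasure (ρ.withDensity fun y => ENNReal.ofReal (g a y)) :=
    isFiniteMeasure_withDensity_ofReal (hg a).2
  unfold mixture
  infer_instance

lemma mixture_real (hg : ∀ a, Integrable (g a) ρ) (hq : ∀ a, Measurable (q a))
    {E : Set (Cube p)} (hE : MeasurableSet E) :
    (mixture ρ g q).real E = ∑ a, ∫ y in q a ⁻¹' E, max (g a y) 0 ∂ρ := by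
  have (a : ι) : IsFiniteMeasure (ρ.withDensity fun y => ENNReal.ofReal (g a y)) :=
    isFiniteMeasure_withDensity_ofReal (hg a).2
  simp only [mixture, measureReal_def, Measure.coe_finsetSum, Finset.sum_apply]
  rw [ENNReal.toReal_sum fun a _ => measure_ne_top _ _]
  refine Finset.sum_congr rfl fun a _ => ?_
  rw [Measure.map_apply (hq a) hE, withDensity_apply _ (hq a hE),
    integral_eq_lintegral_of_nonneg_ae (f := fun y => max (g a y) 0)
      (ae_of_all _ fun y => le_max_right _ _) ((hg a).pos_part.1.restrict)]
  congr 1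
  refine lintegral_congr fun y => ?_
  rcases le_total 0 (g a y) with h | h
  · rw [max_eq_left h]
  · rw [max_eq_right h, ENNReal.ofReal_of_nonpos h, ENNReal.ofReal_zero]

lemma mixture_Iic (hg : ∀ a, Integrable (g a) ρ) (hq : ∀ a, Measurable (q a)) (c : Cube p) :
    (mixture ρ g q).real (Iic c) = ∑ a, ∫ y, max (g a y) 0 * step (q a y) c ∂ρ := by
  rw [mixture_real hg hq (measurableSet_Iic_cube c)]
  refine Finset.sum_congr rfl fun a _ => ?_
  rw [← integral_indicator (hq a (measurableSet_Iic_cube c))]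
  refine integral_congr_ae (ae_of_all _ fun y => ?_)
  by_cases h : q a y ≤ c <;> simp [indicator, step, h]

lemma mixture_upperBoundary (hg : ∀ a, Integrable (g a) ρ) (hq : ∀ a, Measurable (q a))
    (hq' : ∀ a y, q a y ∉ upperBoundary p) : mixture ρ g q (upperBoundary p) = 0 := by
  have := isFiniteMeasure_mixture (q := q) hg
  rw [← measureReal_eq_zero_iff, mixture_real hg hq measurableSet_upperBoundary]
  refine Finset.sum_eq_zero fun a _ => ?_
  have : q a ⁻¹' upperBoundary p = ∅ := by
    ext y; simpa using hq' a y
  simp [this]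

lemma integrable_mul_step {g : Y → ℝ} {q : Y → Cube p} (hg : Integrable g ρ)
    (hq : Measurable q) (c : Cube p) : Integrable (fun y => g y * step (q y) c) ρ :=
  hg.mul_bdd (c := 1)
    ((measurable_step.comp (hq.prodMk measurable_const)).aestronglyMeasurable)
    (ae_of_all _ fun _ => abs_step_le_one _ _)

/-- A superposition of step functions is a tree function; its total variation is at most the total
variation of the coefficients. -/
lemma mem_treeSpace_mixture (hg : ∀ a, Integrable (g a) ρ) (hq : ∀ a, Measurable (q a))
    (hq' : ∀ a y, q a y ∉ upperBoundary p) {T : Cube p → ℝ}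
    (hT : ∀ c, T c = ∑ a, ∫ y, g a y * step (q a y) c ∂ρ) :
    T ∈ treeSpace p ∧ tvNorm T ≤ ∑ a, ∫ y, |g a y| ∂ρ := by
  have hg' : ∀ a, Integrable (fun y => -g a y) ρ := fun a => (hg a).neg
  have i1 := isFiniteMeasure_mixture (q := q) hg
  have i2 := isFiniteMeasure_mixture (q := q) hg'
  have key : ∀ c, T c = (mixture ρ g q).real (Iic c) -
      (mixture ρ (fun a y => -g a y) q).real (Iic c) := by
    intro c
    rw [mixture_Iic hg hq, mixture_Iic hg' hq, hT, ← Finset.sum_sub_distrib]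
    refine Finset.sum_congr rfl fun a _ => ?_
    rw [← integral_sub (integrable_mul_step (hg a).pos_part (hq a) c)
      (integrable_mul_step (hg' a).pos_part (hq a) c)]
    refine integral_congr_ae (ae_of_all _ fun y => ?_)
    dsimp only
    rw [← sub_mul, max_zero_sub_eq_self]
  refine ⟨mem_treeSpace_of_sub (mixture_upperBoundary hg hq hq')
    (mixture_upperBoundary hg' hq hq') key, ?_⟩
  refine (tvNorm_le (mixture_upperBoundary hg hq hq')
    (mixture_upperBoundary hg' hq hq') key).trans_eq ?_
  rw [mixture_real hg hq MeasurableSet.univ, mixture_real hg' hq MeasurableSet.univ,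
    ← Finset.sum_add_distrib]
  refine Finset.sum_congr rfl fun a _ => ?_
  rw [preimage_univ, Measure.restrict_univ,
    ← integral_add (hg a).pos_part (hg' a).pos_part]
  refine integral_congr_ae (ae_of_all _ fun y => ?_)
  dsimp only
  rcases le_total 0 (g a y) with h | h
  · rw [max_eq_left h, max_eq_right (by linarith), abs_of_nonneg h]; ring
  · rw [max_eq_right h, max_eq_left (by linarith), abs_of_nonpos h]; ring

lemma mem_treeCone_mixture (hg : ∀ a, Integrable (g a) ρ) (hq : ∀ a, Measurable (q a))
    (hq' : ∀ a y, q a y ∉ upperBoundary p) (h0 : ∀ a y, 0 ≤ g a y) {T : Cube p → ℝ}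
    (hT : ∀ c, T c = ∑ a, ∫ y, g a y * step (q a y) c ∂ρ) :
    T ∈ treeCone p := by
  have i1 := isFiniteMeasure_mixture (q := q) hg
  refine mem_treeCone_of (mixture_upperBoundary hg hq hq') fun c => ?_
  rw [mixture_Iic hg hq, hT]
  refine Finset.sum_congr rfl fun a _ => integral_congr_ae (ae_of_all _ fun y => ?_)
  dsimp only
  rw [max_eq_left (h0 a y)]

end Mixture

end InfGB

end

noncomputable section

namespace InfGB

/-! ### Boxes and their splits -/

variable {p d : ℕ}

/-- The lower and upper bounds of a box. -/
abbrev Bounds (p : ℕ) := (Fin p → ℝ) × (Fin p → ℝ)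

/-- The bounds of a nonempty box in the cube. -/
def Bounds.Valid (b : Bounds p) : Prop := ∀ k, 0 ≤ b.1 k ∧ b.1 k < b.2 k ∧ b.2 k ≤ 1

/-- The box with given bounds, closed below, and open above except at the boundary of the cube. -/
def box (b : Bounds p) : Set (Cube p) :=
  {c | ∀ k, b.1 k ≤ c k ∧ ((c k : ℝ) < b.2 k ∨ b.2 k = 1)}

/-- The bounds of the two parts of a box. -/
def splitBounds (b : Bounds p) (u : Split p) (e : Bool) : Bounds p :=
  (fun k => if e = true ∧ u.1 = k then b.1 k + u.2 * (b.2 k - b.1 k) else b.1 k,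
   fun k => if e = false ∧ u.1 = k then b.1 k + u.2 * (b.2 k - b.1 k) else b.2 k)

lemma Bounds.Valid.lt_threshold {b : Bounds p} (hb : b.Valid) (u : Split p) (k : Fin p) :
    b.1 k < b.1 k + u.2 * (b.2 k - b.1 k) ∧ b.1 k + u.2 * (b.2 k - b.1 k) < b.2 k := by
  have h1 := (hb k).2.1
  have h2 := u.2.2.1
  have h3 := u.2.2.2
  constructor <;> nlinarith

lemma Bounds.Valid.split {b : Bounds p} (hb : b.Valid) (u : Split p) (e : Bool) :
    (splitBounds b u e).Valid := by
  intro k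
  have h0 := hb k
  have h1 := hb.lt_threshold u k
  cases e <;> simp only [splitBounds] <;> by_cases hk : u.1 = k <;> simp [hk] <;>
    refine ⟨?_, ?_, ?_⟩ <;> linarith

lemma Bounds.Valid.threshold_box {b : Bounds p} (hb : b.Valid) (u : Split p) :
    threshold (box b) u = b.1 u.1 + u.2 * (b.2 u.1 - b.1 u.1) := by
  set j := u.1 with hj
  have hpt : ∀ t : ℝ, ∀ h0 : b.1 j ≤ t, ∀ h1 : t < b.2 j,
      t ∈ (fun c : Cube p => (c j : ℝ)) '' box b := by
    intro t h0 h1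
    refine ⟨fun k => if k = j then ⟨t, (hb j).1.trans h0, (h1.trans_le (hb j).2.2).le⟩ else
      ⟨b.1 k, (hb k).1, (hb k).2.1.le.trans (hb k).2.2⟩, fun k => ?_, by simp⟩
    by_cases hk : k = j
    · subst hk; simpa using ⟨h0, Or.inl h1⟩
    · simpa [hk] using Or.inl (hb k).2.1
  have hinf : sInf ((fun c : Cube p => (c j : ℝ)) '' box b) = b.1 j := by
    refine IsLeast.csInf_eq ⟨hpt _ le_rfl (hb j).2.1, ?_⟩
    rintro _ ⟨c, hc, rfl⟩
    exact (hc j).1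
  have hsup : sSup ((fun c : Cube p => (c j : ℝ)) '' box b) = b.2 j := by
    refine csSup_eq_of_forall_le_of_forall_lt_exists_gt ⟨_, hpt _ le_rfl (hb j).2.1⟩ ?_ ?_
    · rintro _ ⟨c, hc, rfl⟩
      rcases (hc j).2 with h | h
      · exact h.le
      · rw [h]; exact (c j).2.2
    · intro w hw
      have := (hb j).2.1
      obtain ⟨t, ht1, ht2⟩ := exists_between (max_lt hw this)
      exact ⟨t, hpt t ((le_max_right _ _).trans ht1.le) ht2, (le_max_left _ _).trans_lt ht1⟩
  rw [threshold, ← hj, hinf, hsup]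

lemma Bounds.Valid.child_box {b : Bounds p} (hb : b.Valid) (u : Split p) (e : Bool) :
    child (box b) u e = box (splitBounds b u e) := by
  have h1 := hb.lt_threshold u u.1
  have h2 := (hb u.1).2.2
  ext c
  simp only [child, mem_ofPred_eq, hb.threshold_box u]
  simp only [box, mem_ofPred_eq, splitBounds]
  cases e
  · simp only [Bool.false_eq_true, if_false, false_and, true_and]
    constructor
    · rintro ⟨hc, ht⟩ k
      refine ⟨(hc k).1, ?_⟩
      split_ifs with hk
      · subst hk; exact Or.inl ht
      · exact (hc k).2
    · intro hc
      have ht : (c u.1 : ℝ) < b.1 u.1 + u.2 * (b.2 u.1 - b.1 u.1) := by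
        rcases (hc u.1).2 with h | h
        · simpa using h
        · simp only [if_true] at h; linarith
      refine ⟨fun k => ⟨(hc k).1, ?_⟩, ht⟩
      have := (hc k).2
      split_ifs at this with hk
      · subst hk; exact Or.inl (ht.trans h1.2)
      · exact this
  · simp only [if_true, Bool.true_eq_false, false_and, true_and, if_false]
    constructor
    · rintro ⟨hc, ht⟩ k
      refine ⟨?_, (hc k).2⟩
      split_ifs with hk
      · subst hk; exact ht
      · exact (hc k).1
    · intro hc
      have ht : b.1 u.1 + u.2 * (b.2 u.1 - b.1 u.1) ≤ c u.1 := by simpa using (hc u.1).1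
      refine ⟨fun k => ⟨?_, (hc k).2⟩, ht⟩
      have := (hc k).1
      split_ifs at this with hk
      · subst hk; exact h1.1.le.trans ht
      · exact this

lemma box_univ : box ((0, 1) : Bounds p) = univ := by
  ext c
  simp [box, (c _).2.1]

lemma ind_box (b : Bounds p) (c : Cube p) [Decidable (c ∈ box b)] :
    ind (box b) c = if c ∈ box b then 1 else 0 := by
  simp only [ind, indicator, Pi.one_apply]

lemma ind_nonneg (A : Set (Cube p)) (c : Cube p) : 0 ≤ ind A c :=
  indicator_nonneg (fun _ _ => zero_le_one) _

lemma ind_le_one (A : Set (Cube p)) (c : Cube p) : ind A c ≤ 1 :=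
  indicator_le_self' (fun _ _ => zero_le_one) _

lemma abs_ind_le_one (A : Set (Cube p)) (c : Cube p) : |ind A c| ≤ 1 := by
  rw [abs_of_nonneg (ind_nonneg A c)]; exact ind_le_one A c

/-- The corner of a box which has the upper coordinates of the box for the indices in `S`. -/
def corner (b : Bounds p) (S : Fin p → Bool) : Cube p := fun k =>
  projIcc 0 1 zero_le_one (if S k = true ∧ b.2 k < 1 then b.2 k else b.1 k)

/-- The mass at a corner of the measure of the indicator function of a box. -/
def cornerMass (b : Bounds p) (S : Fin p → Bool) : ℝ :=
  ∏ k, if S k = true then (if b.2 k < 1 then -1 else 0) else 1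

lemma abs_cornerMass_le_one (b : Bounds p) (S : Fin p → Bool) : |cornerMass b S| ≤ 1 := by
  rw [cornerMass, Finset.abs_prod]
  refine Finset.prod_le_one (fun _ _ => abs_nonneg _) fun k _ => ?_
  split_ifs <;> simp

lemma Bounds.Valid.corner_notMem {b : Bounds p} (hb : b.Valid) (S : Fin p → Bool) :
    corner b S ∉ upperBoundary p := by
  rintro ⟨k, hk⟩
  have h := congrArg Subtype.val hk
  have hk := hb k
  simp only [corner] at h
  rw [coe_projIcc, Icc.coe_one] at h
  split_ifs at h with h1
  · rw [min_eq_right h1.2.le, max_eq_right (by linarith)] at h; linarith [h1.2]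
  · rw [min_eq_right (by linarith), max_eq_right (by linarith)] at h; linarith

lemma step_eq_prod (q c : Cube p) : step q c = ∏ k, if q k ≤ c k then (1 : ℝ) else 0 := by
  classical
  rw [step, Finset.prod_ite_zero]
  simp [Pi.le_def]

lemma Bounds.Valid.ind_box_eq_sum {b : Bounds p} (hb : b.Valid) (c : Cube p) :
    ind (box b) c = ∑ S, cornerMass b S * step (corner b S) c := by
  classical
  have h1 : ind (box b) c = ∏ k, ∑ e : Bool,
      (if e = true then (if b.2 k < 1 then (-1 : ℝ) else 0) else 1) *
      (if projIcc 0 1 zero_le_one (if e = true ∧ b.2 k < 1 then b.2 k else b.1 k) ≤ c k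
        then 1 else 0) := by
    rw [ind_box, show (if c ∈ box b then (1 : ℝ) else 0) =
      ∏ k, if (b.1 k ≤ c k ∧ ((c k : ℝ) < b.2 k ∨ b.2 k = 1)) then (1 : ℝ) else 0 by
        rw [Finset.prod_ite_zero]; simp only [box, mem_ofPred_eq, Finset.mem_univ, true_imp_iff, Finset.prod_const_one]; congr]
    refine Finset.prod_congr rfl fun k _ => ?_
    have hk := hb k
    rw [Fintype.sum_bool]
    have e1 : ∀ t : ℝ, 0 ≤ t → t ≤ 1 → (projIcc 0 1 zero_le_one t ≤ c k ↔ t ≤ c k) := by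
      intro t h0 h1
      rw [projIcc_of_mem zero_le_one ⟨h0, h1⟩]
      exact Iff.rfl
    simp only [true_and, if_true, Bool.false_eq_true, if_false, false_and,
      e1 _ hk.1 (by linarith)]
    by_cases h2 : b.2 k < 1
    · simp only [h2, if_true, e1 _ (by linarith : 0 ≤ b.2 k) h2.le, h2.ne, or_false]
      by_cases h3 : b.2 k ≤ c k
      · have : b.1 k ≤ c k := by linarith
        simp [h3, this]
      · simp [h3, not_le.1 h3]
    · have : b.2 k = 1 := le_antisymm hk.2.2 (not_lt.1 h2)
      simp [this]
  rw [h1, Finset.prod_univ_sum]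
  simp only [Fintype.piFinset_univ]
  refine Finset.sum_congr rfl fun S _ => ?_
  rw [Finset.prod_mul_distrib, cornerMass, step_eq_prod]
  rfl

section Measurability

variable {Y : Type*} [MeasurableSpace Y]

lemma Measurable.splitBounds {b : Y → Bounds p} {u : Y → Split p} (hb : Measurable b)
    (hu : Measurable u) (e : Bool) : Measurable fun y => splitBounds (b y) (u y) e := by
  have hu2 : Measurable fun y => ((u y).2 : ℝ) := measurable_subtype_coe.comp hu.snd
  have hs : ∀ k, MeasurableSet {y | (u y).1 = k} := fun k => hu.fst (measurableSet_singleton k)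
  refine Measurable.prodMk (measurable_pi_lambda _ fun k => ?_) (measurable_pi_lambda _ fun k => ?_)
  · have h1 : Measurable fun y => (b y).1 k := (measurable_pi_apply k).comp hb.fst
    have h2 : Measurable fun y => (b y).2 k := (measurable_pi_apply k).comp hb.snd
    exact Measurable.ite ((MeasurableSet.const _).inter (hs k)) (h1.add (hu2.mul (h2.sub h1))) h1
  · have h1 : Measurable fun y => (b y).1 k := (measurable_pi_apply k).comp hb.fst
    have h2 : Measurable fun y => (b y).2 k := (measurable_pi_apply k).comp hb.snd
    exact Measurable.ite ((MeasurableSet.const _).inter (hs k)) (h1.add (hu2.mul (h2.sub h1))) h2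

lemma Measurable.ind_box {b : Y → Bounds p} (hb : Measurable b) (c : Cube p) :
    Measurable fun y => ind (box (b y)) c := by
  classical
  simp_rw [InfGB.ind_box]
  refine Measurable.ite ?_ measurable_const measurable_const
  have : {y | c ∈ box (b y)} =
      ⋂ k, ({y | (b y).1 k ≤ c k} ∩ ({y | (c k : ℝ) < (b y).2 k} ∪ {y | (b y).2 k = 1})) := by
    ext y; simp [box]
  rw [this]
  refine MeasurableSet.iInter fun k => ?_
  have h1 : Measurable fun y => (b y).1 k := (measurable_pi_apply k).comp hb.fst
  have h2 : Measurable fun y => (b y).2 k := (measurable_pi_apply k).comp hb.snd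
  exact (measurableSet_le h1 measurable_const).inter
    ((measurableSet_lt measurable_const h2).union (h2 (measurableSet_singleton 1)))

lemma Measurable.corner {b : Y → Bounds p} (hb : Measurable b) (S : Fin p → Bool) :
    Measurable fun y => corner (b y) S := by
  refine measurable_pi_lambda _ fun k => continuous_projIcc.measurable.comp ?_
  have h1 : Measurable fun y => (b y).1 k := (measurable_pi_apply k).comp hb.fst
  have h2 : Measurable fun y => (b y).2 k := (measurable_pi_apply k).comp hb.snd
  exact Measurable.ite ((MeasurableSet.const _).inter (measurableSet_lt h2 measurable_const)) h2 h1

lemma Measurable.cornerMass {b : Y → Bounds p} (hb : Measurable b) (S : Fin p → Bool) :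
    Measurable fun y => cornerMass (b y) S := by
  refine Finset.measurable_prod _ fun k _ => ?_
  have h2 : Measurable fun y => (b y).2 k := (measurable_pi_apply k).comp hb.snd
  exact Measurable.ite (MeasurableSet.const _)
    (Measurable.ite (measurableSet_lt h2 measurable_const) measurable_const measurable_const)
    measurable_const

end Measurability

/-! ### The regions of a tree -/

/-- The regions of the tree with given splits at the nodes. -/
def splitRegion (s : Node d → Split p) : (l : ℕ) → l ≤ d → (Fin l → Bool) → Set (Cube p)
  | 0, _, _ => univ
  | l + 1, h, w => child (splitRegion s l (Nat.le_of_succ_le h) (Fin.init w))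
      (s ⟨⟨l, h⟩, Fin.init w⟩) (w (Fin.last l))

/-- The bounds of the regions of the tree with given splits at the nodes. -/
def regionBounds (s : Node d → Split p) : (l : ℕ) → l ≤ d → (Fin l → Bool) → Bounds p
  | 0, _, _ => (0, 1)
  | l + 1, h, w => splitBounds (regionBounds s l (Nat.le_of_succ_le h) (Fin.init w))
      (s ⟨⟨l, h⟩, Fin.init w⟩) (w (Fin.last l))

lemma regionBounds_valid (s : Node d → Split p) : ∀ (l : ℕ) (h : l ≤ d) (w : Fin l → Bool),
    (regionBounds s l h w).Valid
  | 0, _, _ => fun k => by simp [regionBounds]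
  | l + 1, h, w => (regionBounds_valid s l (Nat.le_of_succ_le h) (Fin.init w)).split _ _

lemma splitRegion_eq_box (s : Node d → Split p) : ∀ (l : ℕ) (h : l ≤ d) (w : Fin l → Bool),
    splitRegion s l h w = box (regionBounds s l h w)
  | 0, _, _ => by rw [splitRegion, regionBounds, box_univ]
  | l + 1, h, w => by
    rw [splitRegion, regionBounds, splitRegion_eq_box s l (Nat.le_of_succ_le h) (Fin.init w),
      (regionBounds_valid s l (Nat.le_of_succ_le h) (Fin.init w)).child_box]

lemma measurable_regionBounds : ∀ (l : ℕ) (h : l ≤ d) (w : Fin l → Bool),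
    Measurable fun s : Node d → Split p => regionBounds s l h w
  | 0, _, _ => measurable_const
  | l + 1, h, w => Measurable.splitBounds
      (measurable_regionBounds l (Nat.le_of_succ_le h) (Fin.init w)) (measurable_pi_apply _) _

end InfGB

end

noncomputable section

namespace InfGB

/-! ### Gradient trees as combinations of step functions -/

variable {p n d K : ℕ}

/-- The splits at the nodes, when the candidate with the number `κ v` is selected at the node `v`. -/
def candSplit (s : Fin K → Node d → Split p) (κ : Node d → Fin K) (v : Node d) : Split p :=
  s (κ v) v

/-- The number of the candidate which is selected at the node `v` with the region `A`. -/
def selectIndex [NeZero K] (β : ℝ) (x : Fin n → Cube p) (r : Fin n → ℝ) (ζ : Aux p d K) (v : Node d)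
    (A : Set (Cube p)) : Fin K :=
  select (softmax β fun k => score x r (ζ.1 k v) A) (ζ.2 v : ℝ)

/-- The candidates that are selected are those with the numbers `κ v`. -/
def Selects [NeZero K] (β : ℝ) (x : Fin n → Cube p) (r : Fin n → ℝ) (ζ : Aux p d K)
    (κ : Node d → Fin K) : Prop :=
  ∀ v : Node d, selectIndex β x r ζ v
    (splitRegion (candSplit ζ.1 κ) v.1 v.1.2.le v.2) = κ v

lemma exists_selects_iff [NeZero K] (β : ℝ) (x : Fin n → Cube p) (r : Fin n → ℝ) (ζ : Aux p d K) :
    ∃ κ₀ : Node d → Fin K, (∀ κ, Selects β x r ζ κ ↔ κ = κ₀) ∧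
      ∀ l h w, region β x r ζ l h w = splitRegion (candSplit ζ.1 κ₀) l h w := by
  let κ₀ : Node d → Fin K := fun v => selectIndex β x r ζ v (region β x r ζ v.1 v.1.2.le v.2)
  have h1 : ∀ l h w, region β x r ζ l h w = splitRegion (candSplit ζ.1 κ₀) l h w := by
    intro l
    induction l with
    | zero => intro h w; rfl
    | succ l ih =>
      intro h w
      rw [splitRegion, ← ih]
      rfl
  refine ⟨κ₀, fun κ => ⟨fun hκ => ?_, ?_⟩, h1⟩
  · have h2 : ∀ l h w, region β x r ζ l h w = splitRegion (candSplit ζ.1 κ) l h w := by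
      intro l
      induction l with
      | zero => intro h w; rfl
      | succ l ih =>
        intro h w
        rw [splitRegion, ← ih, candSplit, ← hκ, ← ih]
        rfl
    funext v
    rw [← hκ v, ← h2]
  · rintro rfl v
    rw [← h1]

/-- The indices of the step functions which make up a gradient tree. -/
abbrev AtomIndex (p d K : ℕ) := (Node d → Fin K) × (Fin d → Bool) × (Fin p → Bool)

/-- The leaves for given numbers of the selected candidates. -/
def candLeaf (s : Fin K → Node d → Split p) (κ : Node d → Fin K) (w : Fin d → Bool) : Set (Cube p) :=
  splitRegion (candSplit s κ) d le_rfl w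

/-- The bounds of the leaves for given numbers of the selected candidates. -/
def candBounds (s : Fin K → Node d → Split p) (κ : Node d → Fin K) (w : Fin d → Bool) : Bounds p :=
  regionBounds (candSplit s κ) d le_rfl w

/-- The positions of the atoms of gradient trees. -/
def atomPos (a : AtomIndex p d K) (ζ : Aux p d K) : Cube p :=
  corner (candBounds ζ.1 a.1 a.2.1) a.2.2

lemma atomPos_notMem (a : AtomIndex p d K) (ζ : Aux p d K) : atomPos a ζ ∉ upperBoundary p :=
  (regionBounds_valid _ _ _ _).corner_notMem _

namespace BoostingData

variable [NeZero K] (B : BoostingData p n d K)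

open Classical in
/-- The masses of the atoms of gradient trees. -/
def atomMass (a : AtomIndex p d K) (z : Fin n → ℝ) (ζ : Aux p d K) : ℝ :=
  if Selects B.β B.x (B.residual z) ζ a.1 then
    B.leafValue z (candLeaf ζ.1 a.1 a.2.1) * cornerMass (candBounds ζ.1 a.1 a.2.1) a.2.2 else 0

lemma gradTree_eq_sum_step (z : Fin n → ℝ) (ζ : Aux p d K) (c : Cube p) :
    B.gradTree z ζ c = ∑ a, B.atomMass a z ζ * step (atomPos a ζ) c := by
  classical
  obtain ⟨κ₀, h1, h2⟩ := exists_selects_iff B.β B.x (B.residual z) ζ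
  rw [Fintype.sum_prod_type, Finset.sum_eq_single κ₀]
  · rw [Fintype.sum_prod_type, gradTree]
    refine Finset.sum_congr rfl fun w _ => ?_
    simp only [atomMass, (h1 κ₀).2 rfl, if_true, leaf, h2]
    have := (regionBounds_valid (candSplit ζ.1 κ₀) d le_rfl w).ind_box_eq_sum c
    rw [← splitRegion_eq_box] at this
    rw [this, Finset.mul_sum]
    refine Finset.sum_congr rfl fun S _ => ?_
    rw [← mul_assoc]
    rfl
  · intro κ _ hκ
    refine Finset.sum_eq_zero fun a _ => ?_
    have : ¬ Selects B.β B.x (B.residual z) ζ κ := fun h => hκ ((h1 κ).1 h)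
    simp [atomMass, this]
  · simp

end BoostingData

section Measurability

variable {Y : Type*} [MeasurableSpace Y] {x : Fin n → Cube p} {r : Y → Fin n → ℝ}
  {A : Y → Set (Cube p)}

lemma measurable_mean (hr : Measurable r) (hA : ∀ i, Measurable fun y => ind (A y) (x i)) :
    Measurable fun y => mean x (r y) (A y) := by
  have (i : Fin n) := (measurable_pi_apply i).comp hr
  exact (Finset.measurable_sum _ fun i _ => (this i).mul (hA i)).div
    (Finset.measurable_sum _ fun i _ => hA i)

lemma measurable_mse (hr : Measurable r) (hA : ∀ i, Measurable fun y => ind (A y) (x i)) :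
    Measurable fun y => mse x (r y) (A y) := by
  have (i : Fin n) := (measurable_pi_apply i).comp hr
  exact (Finset.measurable_sum _ fun i _ =>
    (((this i).sub (measurable_mean hr hA)).pow_const 2).mul (hA i)).div_const _

lemma measurable_score (hr : Measurable r) {b : Y → Bounds p} (hb : Measurable b)
    (hb' : ∀ y, (b y).Valid) {u : Y → Split p} (hu : Measurable u) :
    Measurable fun y => score x (r y) (u y) (box (b y)) := by
  refine ((measurable_mse hr fun i => Measurable.ind_box hb _).sub
    (measurable_mse hr fun i => ?_)).sub (measurable_mse hr fun i => ?_)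
  · simp_rw [(hb' _).child_box]
    exact Measurable.ind_box (Measurable.splitBounds hb hu _) _
  · simp_rw [(hb' _).child_box]
    exact Measurable.ind_box (Measurable.splitBounds hb hu _) _

lemma measurable_softmax (β : ℝ) (k : Fin K) : Measurable fun z : Fin K → ℝ => softmax β z k := by
  have (l : Fin K) : Measurable fun z : Fin K → ℝ => Real.exp (β * z l) :=
    by fun_prop
  exact (this k).div (Finset.measurable_sum _ fun l _ => this l)

open Classical in
/-- The index with a given property, `0` if there is none. -/
def findIndex [NeZero K] (P : Fin K → Prop) : Fin K := if h : ∃ k, P k then h.choose else 0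

lemma select_eq_findIndex [NeZero K] (q : Fin K → ℝ) (γ : ℝ) : select q γ =
    findIndex fun k => ∑ l ∈ Finset.Iio k, q l ≤ γ ∧ γ < ∑ l ∈ Finset.Iic k, q l := by
  unfold select findIndex
  split_ifs <;> rfl

lemma measurable_select [NeZero K] {q : Y → Fin K → ℝ} {γ : Y → ℝ} (hq : Measurable q)
    (hγ : Measurable γ) : Measurable fun y => select (q y) (γ y) := by
  simp_rw [select_eq_findIndex]
  have h1 : Measurable (findIndex : (Fin K → Prop) → Fin K) := measurable_of_finite _
  refine h1.comp (measurable_pi_lambda _ fun k => ?_)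
  have h2 (s : Finset (Fin K)) : Measurable fun y => ∑ l ∈ s, q y l :=
    Finset.measurable_sum _ fun l _ => (measurable_pi_apply l).comp hq
  exact Measurable.and (measurableSet_setOfPred.1 (measurableSet_le (h2 _) hγ))
    (measurableSet_setOfPred.1 (measurableSet_lt hγ (h2 _)))

end Measurability

lemma measurable_candSplit (κ : Node d → Fin K) :
    Measurable fun s : Fin K → Node d → Split p => candSplit s κ :=
  measurable_pi_lambda _ fun v => (measurable_pi_apply v).comp (measurable_pi_apply (κ v))

lemma measurable_candBounds (κ : Node d → Fin K) (w : Fin d → Bool) :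
    Measurable fun s : Fin K → Node d → Split p => candBounds s κ w :=
  (measurable_regionBounds d le_rfl w).comp (measurable_candSplit κ)

lemma measurable_atomPos (a : AtomIndex p d K) : Measurable (atomPos a) :=
  Measurable.corner ((measurable_candBounds _ _).comp measurable_fst) _

lemma measurableSet_selects [NeZero K] (β : ℝ) (x : Fin n → Cube p) (κ : Node d → Fin K) :
    MeasurableSet {y : (Fin n → ℝ) × Aux p d K | Selects β x y.1 y.2 κ} := by
  simp only [Selects, ofPred_forall]
  refine MeasurableSet.iInter fun v => ?_
  refine measurableSet_eq_fun ?_ measurable_const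
  refine measurable_select ?_ ?_
  · have hs : Measurable fun (y : (Fin n → ℝ) × Aux p d K) (k : Fin K) =>
        score x y.1 (y.2.1 k v) (splitRegion (candSplit y.2.1 κ) v.1 v.1.2.le v.2) := ?_
    · exact measurable_pi_lambda _ fun k => (measurable_softmax β k).comp hs
    refine measurable_pi_lambda _ fun k => ?_
    simp_rw [splitRegion_eq_box]
    exact measurable_score measurable_fst
      ((measurable_regionBounds _ _ _).comp
        ((measurable_candSplit κ).comp (measurable_fst.comp measurable_snd)))
      (fun y => regionBounds_valid _ _ _ _)
      ((measurable_pi_apply v).comp ((measurable_pi_apply k).comp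
        (measurable_fst.comp measurable_snd)))
  · exact measurable_subtype_coe.comp
      ((measurable_pi_apply v).comp (measurable_snd.comp measurable_snd))

namespace BoostingData

variable (B : BoostingData p n d K)

lemma measurable_residual : Measurable B.residual :=
  measurable_pi_lambda _ fun i => ((measurable_deriv _).comp (measurable_pi_apply i)).neg

lemma measurable_leafValue {Y : Type*} [MeasurableSpace Y] {z : Y → Fin n → ℝ} (hz : Measurable z)
    {A : Y → Set (Cube p)} (hA : ∀ i, Measurable fun y => ind (A y) (B.x i)) :
    Measurable fun y => B.leafValue (z y) (A y) := by
  have h (i : Fin n) := (measurable_pi_apply i).comp hz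
  exact ((Finset.measurable_sum _ fun i _ => ((measurable_deriv _).comp (h i)).mul (hA i)).div
    (Finset.measurable_sum _ fun i _ => ((measurable_deriv _).comp (h i)).mul (hA i))).neg

lemma measurable_atomMass [NeZero K] (a : AtomIndex p d K) :
    Measurable fun y : (Fin n → ℝ) × Aux p d K => B.atomMass a y.1 y.2 := by
  have hb : Measurable fun y : (Fin n → ℝ) × Aux p d K => candBounds y.2.1 a.1 a.2.1 :=
    (measurable_candBounds _ _).comp (measurable_fst.comp measurable_snd)
  refine Measurable.ite ?_ ((B.measurable_leafValue measurable_fst fun i => ?_).mul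
    (Measurable.cornerMass hb _)) measurable_const
  · exact ((B.measurable_residual.comp measurable_fst).prodMk measurable_snd)
      (measurableSet_selects B.β B.x a.1)
  · simp_rw [candLeaf, splitRegion_eq_box]
    exact Measurable.ind_box hb _

end BoostingData

end InfGB

end

noncomputable section

namespace InfGB

/-! ### Regular mass fields -/

/-- Random masses `m a z ζ`, depending on a parameter `z`, which are locally bounded and locally
Lipschitz in mean as functions of `z`. -/
structure RegularMass {ι S : Type*} {n : ℕ} [MeasurableSpace S] (σ : Measure S)
    (m : ι → (Fin n → ℝ) → S → ℝ) : Prop where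
  measurable : ∀ a, Measurable fun y : (Fin n → ℝ) × S => m a y.1 y.2
  bounded : ∀ R, ∃ C, 0 ≤ C ∧ ∀ a z s, ‖z‖ ≤ R → |m a z s| ≤ C
  lipschitz : ∀ R, ∃ C, 0 ≤ C ∧ ∀ a z z', ‖z‖ ≤ R → ‖z'‖ ≤ R →
    ∫ s, |m a z s - m a z' s| ∂σ ≤ C * ‖z - z'‖

variable {p n d K : ℕ}

section Estimates

variable {x : Fin n → Cube p} {r r' : Fin n → ℝ} {C δ : ℝ}

lemma abs_mean_sub_le (h : ∀ i, |r i - r' i| ≤ δ) (hδ : 0 ≤ δ) (A : Set (Cube p)) :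
    |mean x r A - mean x r' A| ≤ δ := by
  have hN : 0 ≤ ∑ i, ind A (x i) := Finset.sum_nonneg fun i _ => ind_nonneg A _
  rw [mean, mean, ← sub_div, abs_div, abs_of_nonneg hN]
  refine div_le_of_le_mul₀ hN hδ ?_
  rw [← Finset.sum_sub_distrib, Finset.mul_sum]
  refine (Finset.abs_sum_le_sum_abs _ _).trans (Finset.sum_le_sum fun i _ => ?_)
  rw [← sub_mul, abs_mul, abs_of_nonneg (ind_nonneg A _)]
  exact mul_le_mul_of_nonneg_right (h i) (ind_nonneg A _)

lemma abs_mean_le (h : ∀ i, |r i| ≤ C) (hC : 0 ≤ C) (A : Set (Cube p)) : |mean x r A| ≤ C := by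
  have := abs_mean_sub_le (x := x) (r := r) (r' := 0) (by simpa using h) hC A
  simpa [mean] using this

lemma abs_mse_sub_le (h : ∀ i, |r i - r' i| ≤ δ) (hr : ∀ i, |r i| ≤ C) (hr' : ∀ i, |r' i| ≤ C)
    (hδ : 0 ≤ δ) (hC : 0 ≤ C) (A : Set (Cube p)) :
    |mse x r A - mse x r' A| ≤ 8 * C * δ := by
  have hn : (0 : ℝ) ≤ n := n.cast_nonneg
  rw [mse, mse, ← sub_div, abs_div, abs_of_nonneg hn]
  refine div_le_of_le_mul₀ hn (by positivity) ?_
  rw [← Finset.sum_sub_distrib]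
  have : (8 * C * δ) * n = ∑ _i : Fin n, 8 * C * δ := by simp; ring
  rw [this]
  refine (Finset.abs_sum_le_sum_abs _ _).trans (Finset.sum_le_sum fun i _ => ?_)
  rw [← sub_mul, abs_mul]
  refine (mul_le_of_le_one_right (abs_nonneg _) (abs_ind_le_one _ _)).trans ?_
  have e : (r i - mean x r A) ^ 2 - (r' i - mean x r' A) ^ 2 =
    ((r i + r' i) - (mean x r A + mean x r' A)) * ((r i - r' i) - (mean x r A - mean x r' A)) := by
    ring
  have h1 := abs_mean_sub_le (x := x) h hδ A
  have h2 := abs_mean_le (x := x) hr hC A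
  have h3 := abs_mean_le (x := x) hr' hC A
  rw [e, abs_mul, show 8 * C * δ = (4 * C) * (2 * δ) by ring]
  refine mul_le_mul ?_ ?_ (abs_nonneg _) (by positivity)
  · have := abs_le.1 (hr i); have := abs_le.1 (hr' i)
    rw [abs_le] at h2 h3 ⊢
    constructor <;> linarith
  · have := abs_le.1 (h i)
    rw [abs_le] at h1 ⊢
    constructor <;> linarith

lemma abs_score_sub_le (h : ∀ i, |r i - r' i| ≤ δ) (hr : ∀ i, |r i| ≤ C) (hr' : ∀ i, |r' i| ≤ C)
    (hδ : 0 ≤ δ) (hC : 0 ≤ C) (u : Split p) (A : Set (Cube p)) :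
    |score x r u A - score x r' u A| ≤ 24 * C * δ := by
  have h1 := abs_le.1 (abs_mse_sub_le (x := x) h hr hr' hδ hC A)
  have h2 := abs_le.1 (abs_mse_sub_le (x := x) h hr hr' hδ hC (child A u false))
  have h3 := abs_le.1 (abs_mse_sub_le (x := x) h hr hr' hδ hC (child A u true))
  rw [score, score, abs_le]
  constructor <;> linarith

lemma softmax_nonneg (β : ℝ) (z : Fin K → ℝ) (k : Fin K) : 0 ≤ softmax β z k :=
  div_nonneg (Real.exp_nonneg _) (Finset.sum_nonneg fun _ _ => Real.exp_nonneg _)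

lemma softmax_le_one (β : ℝ) (z : Fin K → ℝ) (k : Fin K) : softmax β z k ≤ 1 :=
  div_le_one_of_le₀ (Finset.single_le_sum (f := fun l => Real.exp (β * z l))
    (fun _ _ => Real.exp_nonneg _) (Finset.mem_univ k))
    (Finset.sum_nonneg fun _ _ => Real.exp_nonneg _)

lemma softmax_le_exp_mul {β : ℝ} (hβ : 0 ≤ β) {z z' : Fin K → ℝ} (h : ∀ k, |z k - z' k| ≤ δ)
    (k : Fin K) : softmax β z k ≤ Real.exp (2 * β * δ) * softmax β z' k := by
  have hexp : ∀ {u u' : ℝ}, |u - u'| ≤ δ → Real.exp (β * u) ≤ Real.exp (β * δ) * Real.exp (β * u') :=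
    fun {u u'} huu => by
      rw [← Real.exp_add]
      exact Real.exp_le_exp.2 (by nlinarith [(abs_le.1 huu).2])
  have hpos : ∀ z : Fin K → ℝ, 0 < ∑ l, Real.exp (β * z l) := fun z =>
    Finset.sum_pos (fun _ _ => Real.exp_pos _) ⟨k, Finset.mem_univ k⟩
  rw [softmax, softmax, ← mul_div_assoc, div_le_div_iff₀ (hpos z) (hpos z')]
  have h1 := hexp (h k)
  have h2 : ∑ l, Real.exp (β * z' l) ≤ Real.exp (β * δ) * ∑ l, Real.exp (β * z l) := by
    rw [Finset.mul_sum]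
    exact Finset.sum_le_sum fun l _ => hexp (by rw [abs_sub_comm]; exact h l)
  calc Real.exp (β * z k) * ∑ l, Real.exp (β * z' l)
      ≤ (Real.exp (β * δ) * Real.exp (β * z' k)) * (Real.exp (β * δ) * ∑ l, Real.exp (β * z l)) :=
        mul_le_mul h1 h2 (hpos z').le (by positivity)
    _ = Real.exp (2 * β * δ) * Real.exp (β * z' k) * ∑ l, Real.exp (β * z l) := by
        rw [show 2 * β * δ = β * δ + β * δ by ring, Real.exp_add]; ring

lemma abs_softmax_sub_le {β : ℝ} (hβ : 0 ≤ β) {z z' : Fin K → ℝ} (h : ∀ k, |z k - z' k| ≤ δ)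
    (k : Fin K) : |softmax β z k - softmax β z' k| ≤ 4 * β * δ := by
  have hδ : 0 ≤ δ := (abs_nonneg _).trans (h k)
  have ht : 0 ≤ 2 * β * δ := by positivity
  have a1 := softmax_le_exp_mul hβ h k
  have a2 := softmax_le_exp_mul hβ (fun k => by rw [abs_sub_comm]; exact h k) k (z := z') (z' := z)
  have b0 := softmax_nonneg β z k
  have b1 := softmax_nonneg β z' k
  have c0 := softmax_le_one β z k
  have c1 := softmax_le_one β z' k
  rcases le_total (2 * β * δ) 1 with h1 | h1
  · have h2 := (abs_le.1 (Real.abs_exp_sub_one_le (by rwa [abs_of_nonneg ht]))).2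
    rw [abs_of_nonneg ht] at h2
    rw [abs_le]
    constructor <;> nlinarith
  · rw [abs_le]
    constructor <;> linarith

lemma volume_unitInterval_between_le (a b : ℝ) :
    volume {g : unitInterval | ¬ (a ≤ (g : ℝ) ↔ b ≤ (g : ℝ))} ≤ ENNReal.ofReal |a - b| := by
  rw [unitInterval.volume_apply]
  refine (measure_mono (t := uIcc a b) ?_).trans (by rw [Real.volume_interval, abs_sub_comm])
  rintro _ ⟨g, hg, rfl⟩
  rw [mem_uIcc]
  simp only [mem_ofPred_eq] at hg
  by_contra hcon
  rw [not_or, not_and_or, not_and_or] at hcon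
  apply hg
  constructor <;> intro h
  · by_contra h'
    rcases hcon.1 with h1 | h1
    · exact h1 h
    · exact h1 (not_le.1 h').le
  · by_contra h'
    rcases hcon.2 with h1 | h1
    · exact h1 h
    · exact h1 (not_le.1 h').le

lemma volume_select_ne_le [NeZero K] {q q' : Fin K → ℝ} {ε : ℝ} (h : ∀ k, |q k - q' k| ≤ ε) :
    volume {g : unitInterval | select q (g : ℝ) ≠ select q' (g : ℝ)} ≤
      ENNReal.ofReal (2 * K * (K * ε)) := by
  have hε : 0 ≤ ε := (abs_nonneg _).trans (h 0)
  have hs : ∀ s : Finset (Fin K), |∑ l ∈ s, q l - ∑ l ∈ s, q' l| ≤ K * ε := by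
    intro s
    rw [← Finset.sum_sub_distrib]
    refine (Finset.abs_sum_le_sum_abs _ _).trans ((Finset.sum_le_sum fun l _ => h l).trans ?_)
    rw [Finset.sum_const, nsmul_eq_mul]
    refine mul_le_mul_of_nonneg_right ?_ hε
    exact_mod_cast (Finset.card_le_univ s).trans_eq (Fintype.card_fin K)
  let E (s : Finset (Fin K)) : Set unitInterval :=
    {g | ¬ (∑ l ∈ s, q l ≤ (g : ℝ) ↔ ∑ l ∈ s, q' l ≤ (g : ℝ))}
  have hE : ∀ s, volume (E s) ≤ ENNReal.ofReal (K * ε) := fun s =>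
    (volume_unitInterval_between_le _ _).trans (ENNReal.ofReal_le_ofReal (hs s))
  have hsub : {g : unitInterval | select q (g : ℝ) ≠ select q' (g : ℝ)} ⊆
      ⋃ k : Fin K, (E (Finset.Iio k) ∪ E (Finset.Iic k)) := by
    intro g hg
    by_contra hcon
    simp only [mem_iUnion, not_exists, mem_union, not_or, E, mem_ofPred_eq, not_not] at hcon
    apply hg
    rw [select_eq_findIndex, select_eq_findIndex]
    congr 1
    funext k
    rw [(hcon k).1, ← not_le, ← not_le, (hcon k).2]
  refine (measure_mono hsub).trans ((measure_iUnion_fintype_le _ _).trans ?_)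
  refine (Finset.sum_le_sum (g := fun _ => ENNReal.ofReal (2 * (K * ε))) fun k _ => ?_).trans_eq ?_
  · refine (measure_union_le _ _).trans ?_
    rw [two_mul, ENNReal.ofReal_add (by positivity) (by positivity)]
    exact add_le_add (hE _) (hE _)
  · rw [Finset.sum_const, Finset.card_univ, Fintype.card_fin, nsmul_eq_mul,
      show (2 : ℝ) * K * (K * ε) = K * (2 * (K * ε)) by ring, ENNReal.ofReal_mul K.cast_nonneg,
      ENNReal.ofReal_natCast]

end Estimates

lemma isProbabilityMeasure_splitLaw (hp : 1 ≤ p) : IsProbabilityMeasure (splitLaw p) := by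
  have : Nonempty (Fin p) := ⟨⟨0, hp⟩⟩
  have h1 : IsProbabilityMeasure (uniformOn (univ : Set (Fin p))) :=
    isProbabilityMeasure_uniformOn finite_univ univ_nonempty
  have h2 : IsProbabilityMeasure ((volume : Measure ℝ).comap (Subtype.val : Ioo (0 : ℝ) 1 → ℝ)) := by
    constructor
    rw [Measure.comap_apply₀ _ _ Subtype.val_injective]
    · rw [image_univ, Subtype.range_coe, Real.volume_Ioo]; simp
    · exact fun s hs => (measurableSet_Ioo.subtype_image hs).nullMeasurableSet
    · exact MeasurableSet.univ.nullMeasurableSet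
  unfold splitLaw
  infer_instance

lemma isProbabilityMeasure_auxLaw (hp : 1 ≤ p) : IsProbabilityMeasure (auxLaw p d K) := by
  have := isProbabilityMeasure_splitLaw hp
  unfold auxLaw
  infer_instance

lemma auxLaw_le_of_fiber (hp : 1 ≤ p) {E : Set (Aux p d K)} (hE : MeasurableSet E) {c : ℝ≥0∞}
    (h : ∀ s, (Measure.pi fun _ : Node d => (volume : Measure unitInterval)) (Prod.mk s ⁻¹' E) ≤ c) :
    auxLaw p d K E ≤ c := by
  have := isProbabilityMeasure_splitLaw hp
  rw [auxLaw, Measure.prod_apply hE]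
  exact (lintegral_mono h).trans (by simp)

lemma auxLaw_selects_ne_le [NeZero K] (hp : 1 ≤ p) {β : ℝ} (hβ : 0 ≤ β) (x : Fin n → Cube p)
    {r r' : Fin n → ℝ} {C δ : ℝ} (h : ∀ i, |r i - r' i| ≤ δ) (hr : ∀ i, |r i| ≤ C)
    (hr' : ∀ i, |r' i| ≤ C) (hδ : 0 ≤ δ) (hC : 0 ≤ C) (κ : Node d → Fin K) :
    auxLaw p d K {ζ | ¬ (Selects β x r ζ κ ↔ Selects β x r' ζ κ)} ≤
      ENNReal.ofReal (Fintype.card (Node d) * (2 * K * (K * (4 * β * (24 * C * δ))))) := by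
  have hm (r : Fin n → ℝ) : MeasurableSet {ζ : Aux p d K | Selects β x r ζ κ} :=
    (measurable_const.prodMk measurable_id) (measurableSet_selects β x κ)
  refine auxLaw_le_of_fiber hp ?_ fun s => ?_
  · have : {ζ : Aux p d K | ¬ (Selects β x r ζ κ ↔ Selects β x r' ζ κ)} =
        symmDiff {ζ | Selects β x r ζ κ} {ζ | Selects β x r' ζ κ} := by
      ext ζ
      simp only [mem_ofPred_eq, mem_symmDiff]
      tauto
    rw [this]
    exact (hm r).symmDiff (hm r')
  · let A (v : Node d) := splitRegion (candSplit s κ) v.1 v.1.2.le v.2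
    let q (r : Fin n → ℝ) (v : Node d) := softmax β fun k => score x r (s k v) (A v)
    let E (v : Node d) : Set unitInterval :=
      {g | select (q r v) (g : ℝ) ≠ select (q r' v) (g : ℝ)}
    have hE : ∀ v, volume (E v) ≤ ENNReal.ofReal (2 * K * (K * (4 * β * (24 * C * δ)))) := fun v =>
      volume_select_ne_le fun k => abs_softmax_sub_le hβ
        (fun k => abs_score_sub_le h hr hr' hδ hC (s k v) (A v)) k
    have hEm : ∀ v, MeasurableSet (E v) := fun v =>
      (measurableSet_eq_fun (measurable_select measurable_const measurable_subtype_coe)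
        (measurable_select measurable_const measurable_subtype_coe)).compl
    have hsub : Prod.mk s ⁻¹' {ζ : Aux p d K | ¬ (Selects β x r ζ κ ↔ Selects β x r' ζ κ)} ⊆
        ⋃ v, Function.eval v ⁻¹' E v := by
      intro γ hγ
      by_contra hcon
      simp only [mem_iUnion, not_exists, mem_preimage, E, mem_ofPred_eq, ne_eq, not_not,
        Function.eval] at hcon
      exact hγ (forall_congr' fun v => by
        change select (q r v) _ = _ ↔ select (q r' v) _ = _
        rw [hcon v])
    refine (measure_mono hsub).trans ((measure_iUnion_fintype_le _ _).trans ?_)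
    refine (Finset.sum_le_sum (g := fun _ =>
      ENNReal.ofReal (2 * K * (K * (4 * β * (24 * C * δ))))) fun v _ => ?_).trans_eq ?_
    · rw [(measurePreserving_eval (fun _ : Node d => (volume : Measure unitInterval))
        v).measure_preimage (hEm v).nullMeasurableSet]
      exact hE v
    · rw [Finset.sum_const, Finset.card_univ, nsmul_eq_mul, ENNReal.ofReal_mul (Nat.cast_nonneg _),
        ENNReal.ofReal_natCast]

namespace BoostingData

variable (B : BoostingData p n d K)

/-- Bounds for the derivatives of the loss function on `[-R, R]`. -/
structure LossBounds (R C : ℝ) : Prop where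
  nonneg : 0 ≤ C
  deriv_le : ∀ i s, |s| ≤ R → |deriv (B.L (B.y i)) s| ≤ C
  le_second : ∀ i s, |s| ≤ R → 1 ≤ C * deriv (deriv (B.L (B.y i))) s
  deriv_lip : ∀ i s t, |s| ≤ R → |t| ≤ R →
    |deriv (B.L (B.y i)) s - deriv (B.L (B.y i)) t| ≤ C * |s - t|
  second_lip : ∀ i s t, |s| ≤ R → |t| ≤ R →
    |deriv (deriv (B.L (B.y i))) s - deriv (deriv (B.L (B.y i))) t| ≤ C * |s - t|

lemma exists_lossBounds (hL : LossAssumption B.L) (R : ℝ) : ∃ C, B.LossBounds R C := by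
  have hK : IsCompact (Icc (-R) R) := isCompact_Icc
  have hmem : ∀ {s : ℝ}, |s| ≤ R → s ∈ Icc (-R) R := fun h => abs_le.1 h
  have hc1 : ∀ i, Continuous (deriv (B.L (B.y i))) := fun i =>
    (hL.differentiable_deriv _).continuous
  have hc2 : ∀ i, Continuous (deriv (deriv (B.L (B.y i)))) := fun i =>
    (hL.second_deriv_lipschitz _).continuous
  have key : ∀ i, ∃ C, 0 ≤ C ∧ (∀ s, |s| ≤ R → |deriv (B.L (B.y i)) s| ≤ C) ∧
      (∀ s, |s| ≤ R → 1 ≤ C * deriv (deriv (B.L (B.y i))) s) ∧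
      (∀ s t, |s| ≤ R → |t| ≤ R →
        |deriv (B.L (B.y i)) s - deriv (B.L (B.y i)) t| ≤ C * |s - t|) ∧
      (∀ s t, |s| ≤ R → |t| ≤ R →
        |deriv (deriv (B.L (B.y i))) s - deriv (deriv (B.L (B.y i))) t| ≤ C * |s - t|) := by
    intro i
    obtain ⟨C1, h1⟩ := hK.exists_bound_of_continuousOn (hc1 i).continuousOn
    obtain ⟨C2, h2⟩ := hK.exists_bound_of_continuousOn (hc2 i).continuousOn
    obtain ⟨C3, h3⟩ := hK.exists_bound_of_continuousOn
      ((hc2 i).inv₀ fun z => (hL.second_deriv_pos _ z).ne').continuousOn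
    obtain ⟨C4, h4⟩ := ((hL.second_deriv_lipschitz (B.y i)).locallyLipschitzOn
      (s := Icc (-R) R)).exists_lipschitzOnWith_of_compact hK
    refine ⟨|C1| + |C2| + |C3| + C4, by positivity, ?_, ?_, ?_, ?_⟩
    · intro s hs
      have := h1 s (hmem hs)
      rw [Real.norm_eq_abs] at this
      have := le_abs_self C1
      have := abs_nonneg C2; have := abs_nonneg C3; have := C4.2
      linarith [NNReal.coe_nonneg C4]
    · intro s hs
      have hpos := hL.second_deriv_pos (B.y i) s
      have := h3 s (hmem hs)
      rw [Real.norm_eq_abs, Pi.inv_apply, abs_of_pos (inv_pos.2 hpos)] at this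
      have h5 : (deriv (deriv (B.L (B.y i))) s)⁻¹ ≤ |C1| + |C2| + |C3| + C4 := by
        have := le_abs_self C3
        have := abs_nonneg C2; have := abs_nonneg C1
        linarith [NNReal.coe_nonneg C4]
      have := mul_le_mul_of_nonneg_right h5 hpos.le
      rwa [inv_mul_cancel₀ hpos.ne'] at this
    · intro s t hs ht
      have := (convex_Icc (-R) R).norm_image_sub_le_of_norm_deriv_le
        (fun x _ => hL.differentiable_deriv (B.y i) x) (fun x hx => h2 x hx) (hmem ht) (hmem hs)
      rw [Real.norm_eq_abs, Real.norm_eq_abs] at this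
      refine this.trans (mul_le_mul_of_nonneg_right ?_ (abs_nonneg _))
      have := le_abs_self C2
      have := abs_nonneg C1; have := abs_nonneg C3
      linarith [NNReal.coe_nonneg C4]
    · intro s t hs ht
      have := h4.dist_le_mul s (hmem hs) t (hmem ht)
      rw [Real.dist_eq, Real.dist_eq] at this
      refine this.trans (mul_le_mul_of_nonneg_right ?_ (abs_nonneg _))
      have := abs_nonneg C1; have := abs_nonneg C2; have := abs_nonneg C3
      linarith
  choose C hC0 hC1 hC2 hC3 hC4 using key
  have hle : ∀ i, C i ≤ ∑ i, C i := fun i =>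
    Finset.single_le_sum (fun i _ => hC0 i) (Finset.mem_univ i)
  refine ⟨∑ i, C i, ⟨Finset.sum_nonneg fun i _ => hC0 i, ?_, ?_, ?_, ?_⟩⟩
  · exact fun i s hs => (hC1 i s hs).trans (hle i)
  · exact fun i s hs => (hC2 i s hs).trans
      (mul_le_mul_of_nonneg_right (hle i) (hL.second_deriv_pos _ _).le)
  · exact fun i s t hs ht => (hC3 i s t hs ht).trans
      (mul_le_mul_of_nonneg_right (hle i) (abs_nonneg _))
  · exact fun i s t hs ht => (hC4 i s t hs ht).trans
      (mul_le_mul_of_nonneg_right (hle i) (abs_nonneg _))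

variable {B} {R C : ℝ}

lemma LossBounds.residual_le (h : B.LossBounds R C) {z : Fin n → ℝ} (hz : ‖z‖ ≤ R) (i : Fin n) :
    |B.residual z i| ≤ C := by
  rw [residual, abs_neg]
  exact h.deriv_le i _ ((norm_le_pi_norm z i).trans hz)

lemma LossBounds.residual_sub_le (h : B.LossBounds R C) {z z' : Fin n → ℝ} (hz : ‖z‖ ≤ R)
    (hz' : ‖z'‖ ≤ R) (i : Fin n) : |B.residual z i - B.residual z' i| ≤ C * ‖z - z'‖ := by
  rw [residual, residual, neg_sub_neg, abs_sub_comm]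
  refine (h.deriv_lip i _ _ ((norm_le_pi_norm z i).trans hz)
    ((norm_le_pi_norm z' i).trans hz')).trans (mul_le_mul_of_nonneg_left ?_ h.nonneg)
  exact norm_le_pi_norm (z - z') i

lemma LossBounds.le_mul_sum (h : B.LossBounds R C) {z : Fin n → ℝ} (hz : ‖z‖ ≤ R)
    (A : Set (Cube p)) : ∑ i, ind A (B.x i) ≤
      C * ∑ i, deriv (deriv (B.L (B.y i))) (z i) * ind A (B.x i) := by
  rw [Finset.mul_sum]
  refine Finset.sum_le_sum fun i _ => ?_
  rw [← mul_assoc]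
  exact le_mul_of_one_le_left (ind_nonneg _ _)
    (h.le_second i _ ((norm_le_pi_norm z i).trans hz))

lemma abs_sum_mul_ind_le {f : Fin n → ℝ} {C : ℝ} (h : ∀ i, |f i| ≤ C) (A : Set (Cube p))
    (x : Fin n → Cube p) : |∑ i, f i * ind A (x i)| ≤ C * ∑ i, ind A (x i) := by
  rw [Finset.mul_sum]
  refine (Finset.abs_sum_le_sum_abs _ _).trans (Finset.sum_le_sum fun i _ => ?_)
  rw [abs_mul, abs_of_nonneg (ind_nonneg A _)]
  exact mul_le_mul_of_nonneg_right (h i) (ind_nonneg _ _)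

lemma leafValue_eq_zero {A : Set (Cube p)} (hA : ∑ i, ind A (B.x i) = 0) (z : Fin n → ℝ) :
    B.leafValue z A = 0 := by
  rw [Finset.sum_eq_zero_iff_of_nonneg fun i _ => ind_nonneg _ _] at hA
  rw [leafValue, Finset.sum_eq_zero fun i hi => by rw [hA i hi, mul_zero]]
  simp

lemma LossBounds.leafValue_le (h : B.LossBounds R C) {z : Fin n → ℝ} (hz : ‖z‖ ≤ R)
    (A : Set (Cube p)) : |B.leafValue z A| ≤ C * C := by
  have hN : 0 ≤ ∑ i, ind A (B.x i) := Finset.sum_nonneg fun i _ => ind_nonneg A _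
  rcases hN.eq_or_lt with h0 | h0
  · rw [leafValue_eq_zero h0.symm, abs_zero]; exact mul_nonneg h.nonneg h.nonneg
  · have hD := h.le_mul_sum hz A
    have hS := abs_sum_mul_ind_le (fun i => h.deriv_le i _ ((norm_le_pi_norm z i).trans hz)) A B.x
    have hDpos : 0 < ∑ i, deriv (deriv (B.L (B.y i))) (z i) * ind A (B.x i) := by
      by_contra hcon
      nlinarith [h.nonneg, not_lt.1 hcon]
    rw [leafValue, abs_neg, abs_div, abs_of_pos hDpos, div_le_iff₀ hDpos]
    nlinarith [h.nonneg]

lemma LossBounds.leafValue_sub_le (h : B.LossBounds R C) {z z' : Fin n → ℝ} (hz : ‖z‖ ≤ R)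
    (hz' : ‖z'‖ ≤ R) (A : Set (Cube p)) :
    |B.leafValue z A - B.leafValue z' A| ≤ (C * C + C * C * (C * C)) * ‖z - z'‖ := by
  have hC := h.nonneg
  have hN : 0 ≤ ∑ i, ind A (B.x i) := Finset.sum_nonneg fun i _ => ind_nonneg A _
  rcases hN.eq_or_lt with h0 | h0
  · rw [leafValue_eq_zero h0.symm, leafValue_eq_zero h0.symm, sub_zero, abs_zero]; positivity
  have hD := h.le_mul_sum hz A
  have hD' := h.le_mul_sum hz' A
  have hlv := h.leafValue_le hz' A
  have hS : |∑ i, deriv (B.L (B.y i)) (z i) * ind A (B.x i) -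
      ∑ i, deriv (B.L (B.y i)) (z' i) * ind A (B.x i)| ≤
      C * ‖z - z'‖ * ∑ i, ind A (B.x i) := by
    rw [← Finset.sum_sub_distrib]
    simp_rw [← sub_mul]
    refine abs_sum_mul_ind_le (fun i => ?_) A B.x
    have := h.residual_sub_le hz hz' i
    rwa [residual, residual, neg_sub_neg, abs_sub_comm] at this
  have hDD : |∑ i, deriv (deriv (B.L (B.y i))) (z i) * ind A (B.x i) -
      ∑ i, deriv (deriv (B.L (B.y i))) (z' i) * ind A (B.x i)| ≤
      C * ‖z - z'‖ * ∑ i, ind A (B.x i) := by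
    rw [← Finset.sum_sub_distrib]
    simp_rw [← sub_mul]
    refine abs_sum_mul_ind_le (fun i => ?_) A B.x
    exact (h.second_lip i _ _ ((norm_le_pi_norm z i).trans hz)
      ((norm_le_pi_norm z' i).trans hz')).trans
        (mul_le_mul_of_nonneg_left (norm_le_pi_norm (z - z') i) hC)
  rw [leafValue] at hlv ⊢
  rw [leafValue]
  set N := ∑ i, ind A (B.x i)
  set S := ∑ i, deriv (B.L (B.y i)) (z i) * ind A (B.x i)
  set S' := ∑ i, deriv (B.L (B.y i)) (z' i) * ind A (B.x i)
  set D := ∑ i, deriv (deriv (B.L (B.y i))) (z i) * ind A (B.x i)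
  set D' := ∑ i, deriv (deriv (B.L (B.y i))) (z' i) * ind A (B.x i)
  set δ := ‖z - z'‖
  have hδ : 0 ≤ δ := norm_nonneg _
  have hDpos : 0 < D := by
    by_contra hcon
    nlinarith [not_lt.1 hcon]
  have hDpos' : 0 < D' := by
    by_contra hcon
    nlinarith [not_lt.1 hcon]
  have e : -(S / D) - -(S' / D') = (-(S - S') + S' / D' * (D - D')) / D := by
    field_simp; ring
  rw [e, abs_div, abs_of_pos hDpos, div_le_iff₀ hDpos]
  rw [abs_neg] at hlv
  have b1 : |-(S - S') + S' / D' * (D - D')| ≤ C * δ * N + (C * C) * (C * δ * N) := by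
    refine (abs_add_le _ _).trans (add_le_add (by rwa [abs_neg]) ?_)
    rw [abs_mul]
    exact mul_le_mul hlv hDD (abs_nonneg _) (by positivity)
  refine b1.trans ?_
  have b2 : C * δ * N + (C * C) * (C * δ * N) = (C * δ + C * C * (C * δ)) * N := by ring
  rw [b2]
  refine (mul_le_mul_of_nonneg_left hD (by positivity)).trans_eq ?_
  ring

variable [NeZero K]

variable (B) in
lemma regularMass_atomMass (hp : 1 ≤ p) (hβ : 0 ≤ B.β) (hL : LossAssumption B.L) :
    RegularMass (auxLaw p d K) B.atomMass := by
  have := isProbabilityMeasure_auxLaw (d := d) (K := K) hp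
  have hbd : ∀ {R C}, B.LossBounds R C → ∀ a z s, ‖z‖ ≤ R → |B.atomMass a z s| ≤ C * C := by
    intro R C h a z s hz
    rw [atomMass]
    split_ifs
    · rw [abs_mul]
      exact (mul_le_of_le_one_right (abs_nonneg _) (abs_cornerMass_le_one _ _)).trans
        (h.leafValue_le hz _)
    · simpa using mul_nonneg h.nonneg h.nonneg
  refine ⟨B.measurable_atomMass, fun R => ?_, fun R => ?_⟩
  · obtain ⟨C, h⟩ := B.exists_lossBounds hL R
    exact ⟨C * C, mul_nonneg h.nonneg h.nonneg, hbd h⟩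
  · obtain ⟨C, h⟩ := B.exists_lossBounds hL R
    have hC := h.nonneg
    set C₁ := C * C + C * C * (C * C)
    set C₂ : ℝ := Fintype.card (Node d) * (2 * K * (K * (4 * B.β * (24 * C * C))))
    have hC₂ : 0 ≤ C₂ := by positivity
    refine ⟨C₁ + 2 * (C * C) * C₂, by positivity, fun a z z' hz hz' => ?_⟩
    set E : Set (Aux p d K) := {ζ | ¬ (Selects B.β B.x (B.residual z) ζ a.1 ↔
      Selects B.β B.x (B.residual z') ζ a.1)} with hE
    have hEle : (auxLaw p d K).real E ≤ C₂ * ‖z - z'‖ := by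
      refine ENNReal.toReal_le_of_le_ofReal (by positivity) ?_
      refine (auxLaw_selects_ne_le hp hβ B.x (fun i => h.residual_sub_le hz hz' i)
        (fun i => h.residual_le hz i) (fun i => h.residual_le hz' i) (by positivity) hC a.1).trans
        (ENNReal.ofReal_le_ofReal (le_of_eq ?_))
      simp only [C₂]; ring
    have hEm : MeasurableSet E := by
      have hm (r : Fin n → ℝ) : MeasurableSet {ζ : Aux p d K | Selects B.β B.x r ζ a.1} :=
        (measurable_const.prodMk measurable_id) (measurableSet_selects B.β B.x a.1)
      have : E = symmDiff {ζ | Selects B.β B.x (B.residual z) ζ a.1}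
          {ζ | Selects B.β B.x (B.residual z') ζ a.1} := by
        ext ζ
        simp only [hE, mem_ofPred_eq, mem_symmDiff]
        tauto
      rw [this]
      exact (hm _).symmDiff (hm _)
    have hpt : ∀ s, |B.atomMass a z s - B.atomMass a z' s| ≤
        C₁ * ‖z - z'‖ + E.indicator (fun _ => 2 * (C * C)) s := by
      intro s
      by_cases hs : s ∈ E
      · rw [indicator_of_mem hs]
        refine (abs_sub _ _).trans ?_
        have := hbd h a z s hz
        have := hbd h a z' s hz'
        have : 0 ≤ C₁ * ‖z - z'‖ := by positivity
        linarith
      · rw [indicator_of_notMem hs, add_zero]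
        rw [hE, mem_ofPred_eq, not_not] at hs
        rw [atomMass, atomMass]
        by_cases h1 : Selects B.β B.x (B.residual z) s a.1
        · rw [if_pos h1, if_pos (hs.1 h1), ← sub_mul, abs_mul]
          exact (mul_le_of_le_one_right (abs_nonneg _) (abs_cornerMass_le_one _ _)).trans
            (h.leafValue_sub_le hz hz' _)
        · rw [if_neg h1, if_neg (fun h' => h1 (hs.2 h')), sub_zero, abs_zero]; positivity
    have hi : Integrable (fun s => C₁ * ‖z - z'‖ + E.indicator (fun _ => 2 * (C * C)) s)
        (auxLaw p d K) :=
      (integrable_const _).add ((integrable_const _).indicator hEm)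
    refine (integral_mono_of_nonneg (ae_of_all _ fun _ => abs_nonneg _) hi
      (ae_of_all _ hpt)).trans ?_
    rw [integral_add (integrable_const _) ((integrable_const _).indicator hEm),
      integral_const, integral_indicator_const _ hEm, probReal_univ, smul_eq_mul, smul_eq_mul,
      one_mul, add_mul]
    have : 0 ≤ C * C := by positivity
    nlinarith

end BoostingData

section PosMass

variable {ι S : Type*} [MeasurableSpace S] {σ : Measure S} [IsProbabilityMeasure σ]
  {m : ι → (Fin n → ℝ) → S → ℝ}

lemma RegularMass.integrable (h : RegularMass σ m) (a : ι) (z : Fin n → ℝ) :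
    Integrable (m a z) σ := by
  obtain ⟨C, -, hC⟩ := h.bounded ‖z‖
  exact Integrable.of_bound
    ((h.measurable a).comp (measurable_const.prodMk measurable_id)).aestronglyMeasurable C
    (ae_of_all _ fun s => hC a z s le_rfl)

lemma RegularMass.neg (h : RegularMass σ m) : RegularMass σ fun a z s => -m a z s := by
  refine ⟨fun a => (h.measurable a).neg, fun R => ?_, fun R => ?_⟩
  · simpa using h.bounded R
  · have e : ∀ u v : ℝ, |-u - -v| = |u - v| := fun u v => by rw [neg_sub_neg, abs_sub_comm]
    simpa only [e] using h.lipschitz R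

/-- The positive parts of regular masses are regular. -/
lemma RegularMass.posMass [Fintype ι] {α : Type*} [DecidableEq α] [MeasurableSpace α] [MeasurableEq α]
    (h : RegularMass σ m) {q : ι → S → α} (hq : ∀ a, Measurable (q a)) :
    RegularMass σ fun a z s => posMass (fun b => m b z s) (fun b => q b s) a := by
  have hqs (a b : ι) : MeasurableSet {y : (Fin n → ℝ) × S | q b y.2 = q a y.2} :=
    measurableSet_eq_fun ((hq b).comp measurable_snd) ((hq a).comp measurable_snd)
  refine ⟨fun a => ?_, fun R => ?_, fun R => ?_⟩
  · refine Measurable.div (Measurable.max ?_ measurable_const) ?_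
    · exact Finset.measurable_sum _ fun b _ => Measurable.ite (hqs a b) (h.measurable b)
        measurable_const
    · exact Finset.measurable_sum _ fun b _ => Measurable.ite (hqs a b) measurable_const
        measurable_const
  · obtain ⟨C, hC, h⟩ := h.bounded R
    refine ⟨Fintype.card ι * C, by positivity, fun a z s hz => ?_⟩
    rw [abs_of_nonneg (posMass_nonneg _ _ _)]
    refine (posMass_le _ _ _).trans ((Finset.sum_le_sum fun b _ => h b z s hz).trans_eq ?_)
    simp
  · obtain ⟨C, hC, hl⟩ := h.lipschitz R
    refine ⟨Fintype.card ι * C, by positivity, fun a z z' hz hz' => ?_⟩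
    have hi (b : ι) : Integrable (fun s => |m b z s - m b z' s|) σ :=
      ((h.integrable b z).sub (h.integrable b z')).abs
    refine (integral_mono_of_nonneg (ae_of_all _ fun _ => abs_nonneg _)
      (integrable_finsetSum _ fun b _ => hi b)
      (ae_of_all _ fun s => abs_posMass_sub_le _ _ _ _)).trans ?_
    rw [integral_finsetSum _ fun b _ => hi b]
    refine (Finset.sum_le_sum fun b _ => hl b z z' hz hz').trans_eq ?_
    simp [mul_assoc]

end PosMass

end InfGB

end

noncomputable section

namespace InfGB

/-! ### Global solutions of autonomous differential equations -/

section ODE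

variable {E : Type*} [NormedAddCommGroup E]

/-- A cutoff function: `1` on the ball of radius `R`, `0` outside the ball of radius `R + 1`. -/
def cutoff (R : ℝ) (z : E) : ℝ := max 0 (min 1 (R + 1 - ‖z‖))

lemma cutoff_nonneg (R : ℝ) (z : E) : 0 ≤ cutoff R z := le_max_left _ _

lemma cutoff_le_one (R : ℝ) (z : E) : cutoff R z ≤ 1 := max_le zero_le_one (min_le_left _ _)

lemma cutoff_eq_one {R : ℝ} {z : E} (h : ‖z‖ ≤ R) : cutoff R z = 1 := by
  rw [cutoff, min_eq_left (by linarith), max_eq_right zero_le_one]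

lemma cutoff_eq_zero {R : ℝ} {z : E} (h : R + 1 ≤ ‖z‖) : cutoff R z = 0 := by
  rw [cutoff, max_eq_left ((min_le_right _ _).trans (by linarith))]

lemma abs_cutoff_sub_le (R : ℝ) (z z' : E) : |cutoff R z - cutoff R z'| ≤ ‖z - z'‖ := by
  unfold cutoff
  rw [max_comm, max_comm 0]
  refine (abs_max_sub_max_le_abs _ _ _).trans ?_
  rw [min_comm, min_comm 1]
  refine (abs_min_sub_min_le_max _ _ _ _).trans ?_
  rw [sub_self, abs_zero, max_eq_left (abs_nonneg _), sub_sub_sub_cancel_left, abs_sub_comm]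
  exact abs_norm_sub_norm_le z z'

variable [NormedSpace ℝ E] {v : E → E}

/-- Two solutions of an equation with a locally Lipschitz right hand side coincide. -/
lemma eq_of_isSolution (hv : ∀ R, ∃ K, LipschitzOnWith K v (Metric.closedBall 0 R)) {f g : ℝ → E}
    {T : ℝ} (hf : ∀ t ∈ Icc 0 T, HasDerivWithinAt f (v (f t)) (Icc 0 T) t)
    (hg : ∀ t ∈ Icc 0 T, HasDerivWithinAt g (v (g t)) (Icc 0 T) t) (h0 : f 0 = g 0) :
    EqOn f g (Icc 0 T) := by
  have hfc : ContinuousOn f (Icc 0 T) := fun t ht => (hf t ht).continuousWithinAt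
  have hgc : ContinuousOn g (Icc 0 T) := fun t ht => (hg t ht).continuousWithinAt
  obtain ⟨C1, h1⟩ := isCompact_Icc.exists_bound_of_continuousOn hfc
  obtain ⟨C2, h2⟩ := isCompact_Icc.exists_bound_of_continuousOn hgc
  obtain ⟨K, hK⟩ := hv (max C1 C2)
  refine ODE_solution_unique_of_mem_Icc_right (v := fun _ => v)
    (s := fun _ => Metric.closedBall 0 (max C1 C2)) (K := K) (fun _ _ => hK) hfc ?_ ?_ hgc ?_ ?_ h0
  · exact fun t ht => (hf t (Ico_subset_Icc_self ht)).mono_of_mem_nhdsWithin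
      (Icc_mem_nhdsGE_of_mem ht)
  · exact fun t ht => mem_closedBall_zero_iff.2
      ((h1 t (Ico_subset_Icc_self ht)).trans (le_max_left _ _))
  · exact fun t ht => (hg t (Ico_subset_Icc_self ht)).mono_of_mem_nhdsWithin
      (Icc_mem_nhdsGE_of_mem ht)
  · exact fun t ht => mem_closedBall_zero_iff.2
      ((h2 t (Ico_subset_Icc_self ht)).trans (le_max_right _ _))

variable [CompleteSpace E]

/-- Existence on a compact interval, when `V` is a Lyapunov function on whose sublevels the right
hand side is bounded. -/
lemma exists_solution_Icc (hv : ∀ R, ∃ K, LipschitzOnWith K v (Metric.closedBall 0 R))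
    {V : E → ℝ} {V' : E → E →L[ℝ] ℝ} (hV : ∀ z, HasFDerivAt V (V' z) z)
    (hle : ∀ z, V' z (v z) ≤ 0) (hb : ∀ C, ∃ M, ∀ z, V z ≤ C → ‖v z‖ ≤ M) (z₀ : E) (N : ℝ)
    (hN : 0 ≤ N) :
    ∃ f : ℝ → E, f 0 = z₀ ∧ ∀ t ∈ Icc 0 N, HasDerivWithinAt f (v (f t)) (Icc 0 N) t := by
  obtain ⟨M, hM⟩ := hb (V z₀)
  have hM0 : 0 ≤ M := (norm_nonneg _).trans (hM z₀ le_rfl)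
  set R := ‖z₀‖ + M * N with hR
  have hR0 : 0 ≤ R := by positivity
  set w : E → E := fun z => cutoff R z • v z with hw
  obtain ⟨K₁, hK₁⟩ := hv (R + 1)
  obtain ⟨B, hB0, hB⟩ : ∃ B : ℝ≥0, 0 ≤ B ∧ ∀ z, ‖z‖ ≤ R + 1 → ‖v z‖ ≤ B := by
    refine ⟨‖v 0‖₊ + K₁ * (R + 1).toNNReal, zero_le, fun z hz => ?_⟩
    have := hK₁.dist_le_mul z (mem_closedBall_zero_iff.2 hz) 0
      (mem_closedBall_zero_iff.2 (by rw [norm_zero]; linarith))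
    rw [dist_eq_norm, dist_zero_right] at this
    have h2 : ‖v z‖ ≤ ‖v 0‖ + ‖v z - v 0‖ := by
      rw [add_comm]; exact norm_le_norm_sub_add (v z) (v 0)
    have h3 : K₁ * ‖z‖ ≤ K₁ * (R + 1) := mul_le_mul_of_nonneg_left hz K₁.2
    push_cast
    rw [Real.coe_toNNReal _ (by linarith)]
    linarith
  have hwB : ∀ z, ‖w z‖ ≤ B := by
    intro z
    rw [hw, norm_smul, Real.norm_eq_abs, abs_of_nonneg (cutoff_nonneg R z)]
    rcases le_total ‖z‖ (R + 1) with h | h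
    · exact (mul_le_of_le_one_left (norm_nonneg _) (cutoff_le_one R z)).trans (hB z h)
    · rw [cutoff_eq_zero h, zero_mul]; exact B.2
  have hwL : LipschitzWith (B + K₁) w := by
    refine LipschitzWith.of_dist_le_mul fun z z' => ?_
    wlog h : ‖z‖ ≤ R + 1 generalizing z z'
    · rcases le_total ‖z'‖ (R + 1) with h' | h'
      · rw [dist_comm, dist_comm z]; exact this z' z h'
      · simp only [hw, cutoff_eq_zero (not_le.1 h).le, cutoff_eq_zero h', zero_smul, dist_self]
        positivity
    · rw [dist_eq_norm, dist_eq_norm]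
      have e : w z - w z' = (cutoff R z - cutoff R z') • v z + cutoff R z' • (v z - v z') := by
        simp only [hw]; module
      have h1 : ‖(cutoff R z - cutoff R z') • v z‖ ≤ B * ‖z - z'‖ := by
        rw [norm_smul, mul_comm]
        exact mul_le_mul (hB z h) (abs_cutoff_sub_le R z z') (abs_nonneg _) B.2
      have h2 : ‖cutoff R z' • (v z - v z')‖ ≤ K₁ * ‖z - z'‖ := by
        rw [norm_smul, Real.norm_eq_abs, abs_of_nonneg (cutoff_nonneg R z')]
        rcases le_total ‖z'‖ (R + 1) with h' | h'
        · refine (mul_le_of_le_one_left (norm_nonneg _) (cutoff_le_one R z')).trans ?_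
          have := hK₁.dist_le_mul z (mem_closedBall_zero_iff.2 h) z' (mem_closedBall_zero_iff.2 h')
          rwa [dist_eq_norm, dist_eq_norm] at this
        · rw [cutoff_eq_zero h', zero_mul]; positivity
      rw [e]
      refine (norm_add_le _ _).trans ?_
      push_cast
      linarith
  have hPL : IsPicardLindelof (fun _ : ℝ => w) (⟨0, left_mem_Icc.2 hN⟩ : Icc (0 : ℝ) N) z₀
      (B * N.toNNReal) 0 B (B + K₁) :=
    { lipschitzOnWith := fun _ _ => hwL.lipschitzOnWith
      continuousOn := fun _ _ => continuousOn_const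
      norm_le := fun _ _ z _ => hwB z
      mul_max_le := by
        simp [Real.coe_toNNReal _ hN, hN] }
  obtain ⟨f, hf0, hf⟩ := hPL.exists_eq_forall_mem_Icc_hasDerivWithinAt₀
  have hf0 : f 0 = z₀ := hf0
  have hVf : ∀ t ∈ Icc 0 N, V (f t) ≤ V z₀ := by
    intro t ht
    rw [← hf0]
    have hder : ∀ s ∈ Icc 0 N, HasDerivWithinAt (V ∘ f) (V' (f s) (w (f s))) (Icc 0 N) s :=
      fun s hs => (hV (f s)).comp_hasDerivWithinAt s (hf s hs)
    have hanti : AntitoneOn (V ∘ f) (Icc 0 N) := by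
      refine antitoneOn_of_hasDerivWithinAt_nonpos (convex_Icc 0 N)
        (fun s hs => (hder s hs).continuousWithinAt)
        (fun s hs => (hder s (interior_subset hs)).mono interior_subset) ?_
      intro s _
      rw [hw, map_smul, smul_eq_mul]
      exact mul_nonpos_of_nonneg_of_nonpos (cutoff_nonneg _ _) (hle _)
    exact hanti (left_mem_Icc.2 hN) ht ht.1
  have hfR : ∀ t ∈ Icc 0 N, ‖f t‖ ≤ R := by
    intro t ht
    have := norm_image_sub_le_of_norm_deriv_le_segment' hf (C := M) (fun s hs => ?_) t ht
    · rw [hf0, sub_zero] at this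
      have h2 : ‖f t‖ ≤ ‖f t - z₀‖ + ‖z₀‖ := norm_le_norm_sub_add (f t) z₀
      have h3 : M * t ≤ M * N := mul_le_mul_of_nonneg_left ht.2 hM0
      linarith
    · rw [hw, norm_smul, Real.norm_eq_abs, abs_of_nonneg (cutoff_nonneg _ _)]
      exact (mul_le_of_le_one_left (norm_nonneg _) (cutoff_le_one _ _)).trans
        (hM _ (hVf s (Ico_subset_Icc_self hs)))
  refine ⟨f, hf0, fun t ht => ?_⟩
  have := hf t ht
  simp only [hw] at this
  rwa [cutoff_eq_one (hfR t ht), one_smul] at this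

/-- Global existence, when `V` is a Lyapunov function on whose sublevels the right hand side is
bounded. -/
lemma exists_solution_Ici (hv : ∀ R, ∃ K, LipschitzOnWith K v (Metric.closedBall 0 R))
    {V : E → ℝ} {V' : E → E →L[ℝ] ℝ} (hV : ∀ z, HasFDerivAt V (V' z) z)
    (hle : ∀ z, V' z (v z) ≤ 0) (hb : ∀ C, ∃ M, ∀ z, V z ≤ C → ‖v z‖ ≤ M) (z₀ : E) :
    ∃ f : ℝ → E, f 0 = z₀ ∧ ∀ t ≥ 0, HasDerivWithinAt f (v (f t)) (Ici 0) t := by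
  choose f hf0 hf using fun N : ℕ => exists_solution_Icc hv hV hle hb z₀ N N.cast_nonneg
  have hagree : ∀ N M : ℕ, N ≤ M → EqOn (f N) (f M) (Icc 0 N) := by
    intro N M hNM
    have hNM' : (N : ℝ) ≤ M := by exact_mod_cast hNM
    exact eq_of_isSolution hv (hf N)
      (fun t ht => (hf M t ⟨ht.1, ht.2.trans hNM'⟩).mono (Icc_subset_Icc_right hNM'))
      ((hf0 N).trans (hf0 M).symm)
  have hlt : ∀ t : ℝ, t < (⌊t⌋₊ + 1 : ℕ) := fun t => by
    push_cast; exact Nat.lt_floor_add_one t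
  have heq : ∀ N : ℕ, ∀ s ∈ Icc (0 : ℝ) N, f (⌊s⌋₊ + 1) s = f N s := by
    intro N s hs
    rcases le_total N (⌊s⌋₊ + 1) with h | h
    · exact (hagree N _ h hs).symm
    · exact hagree _ _ h ⟨hs.1, (hlt s).le⟩
  refine ⟨fun t => f (⌊t⌋₊ + 1) t, ?_, fun t ht => ?_⟩
  · exact hf0 _
  · set N := ⌊t⌋₊ + 1
    have h1 := hf N t ⟨ht, (hlt t).le⟩
    have h2 : HasDerivWithinAt (f N) (v (f N t)) (Ici 0) t := by
      refine h1.mono_of_mem_nhdsWithin ?_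
      rw [← Ici_inter_Iic]
      exact inter_mem self_mem_nhdsWithin (mem_nhdsWithin_of_mem_nhds (Iic_mem_nhds (hlt t)))
    refine h2.congr_of_eventuallyEq ?_ rfl
    have : Iic (N : ℝ) ∈ 𝓝[Ici 0] t := mem_nhdsWithin_of_mem_nhds (Iic_mem_nhds (hlt t))
    filter_upwards [self_mem_nhdsWithin, this] with s hs hs'
    exact heq N s ⟨hs, hs'⟩

end ODE

end InfGB

end

noncomputable section

namespace InfGB

/-! ### The total variation norm and the embedding in `L²` -/

variable {p n : ℕ}

lemma tvNorm_nonneg (T : Cube p → ℝ) : 0 ≤ tvNorm T := ENNReal.toReal_nonneg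

lemma tvNorm_add_le {S T : Cube p → ℝ} (hS : S ∈ treeSpace p) (hT : T ∈ treeSpace p) :
    tvNorm (fun c => S c + T c) ≤ tvNorm S + tvNorm T := by
  obtain ⟨P, Q, hP, hQ, hP0, hQ0, hn, hS⟩ := mem_treeSpace_iff.1 hS
  obtain ⟨P', Q', hP', hQ', hP0', hQ0', hn', hT⟩ := mem_treeSpace_iff.1 hT
  refine (tvNorm_le (P := P + P') (Q := Q + Q') (by simp [hP0, hP0']) (by simp [hQ0, hQ0'])
    fun c => ?_).trans_eq ?_
  · rw [hS, hT, measureReal_add_apply, measureReal_add_apply]; ring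
  · rw [← hn, ← hn', measureReal_add_apply, measureReal_add_apply]; ring

lemma tvNorm_const_mul_le {S : Cube p → ℝ} (hS : S ∈ treeSpace p) (r : ℝ) :
    tvNorm (fun c => r * S c) ≤ |r| * tvNorm S := by
  obtain ⟨P, Q, hP, hQ, hP0, hQ0, hn, hS⟩ := mem_treeSpace_iff.1 hS
  rcases le_total 0 r with hr | hr
  · refine (tvNorm_le (P := r.toNNReal • P) (Q := r.toNNReal • Q) (by simp [hP0])
      (by simp [hQ0]) fun c => ?_).trans_eq ?_
    · rw [hS, measureReal_nnreal_smul_apply, measureReal_nnreal_smul_apply,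
        Real.coe_toNNReal _ hr]; ring
    · rw [← hn, measureReal_nnreal_smul_apply, measureReal_nnreal_smul_apply,
        Real.coe_toNNReal _ hr, abs_of_nonneg hr]; ring
  · refine (tvNorm_le (P := (-r).toNNReal • Q) (Q := (-r).toNNReal • P) (by simp [hQ0])
      (by simp [hP0]) fun c => ?_).trans_eq ?_
    · rw [hS, measureReal_nnreal_smul_apply, measureReal_nnreal_smul_apply,
        Real.coe_toNNReal _ (neg_nonneg.2 hr)]; ring
    · rw [← hn, measureReal_nnreal_smul_apply, measureReal_nnreal_smul_apply,
        Real.coe_toNNReal _ (neg_nonneg.2 hr), abs_of_nonpos hr]; ring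

lemma tvNorm_sub_le {S T : Cube p → ℝ} (hS : S ∈ treeSpace p) (hT : T ∈ treeSpace p) :
    tvNorm (fun c => S c - T c) ≤ tvNorm S + tvNorm T := by
  have h1 := tvNorm_const_mul_le hT (-1)
  have h2 := tvNorm_add_le hS ((treeSubmodule p).smul_mem (-1) hT)
  simp only [Pi.smul_apply, smul_eq_mul, neg_mul, one_mul, ← sub_eq_add_neg] at h2
  simp only [neg_mul, one_mul, abs_neg, abs_one] at h1
  have e : (-1 : ℝ) • T = fun c => -T c := by ext c; simp
  rw [e] at h2
  exact h2.trans (add_le_add le_rfl h1)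

instance isProbabilityMeasure_nu : IsProbabilityMeasure (nu p) := by
  constructor
  rw [nu, Measure.smul_apply, Measure.finsetSum_apply, Finset.sum_congr rfl (g := fun _ => (1 : ℝ≥0∞)) fun s _ => ?_]
  rotate_left
  · refine @measure_univ _ _ _ (@Measure.pi.instIsProbabilityMeasure (Fin p) (fun _ => unitInterval) _ _ _
      fun j => ?_)
    generalize s j = o
    rcases o with _ | _ | _ <;> infer_instance
  simp only [Finset.sum_const, Finset.card_univ, Fintype.card_fun, Fintype.card_option,
    Fintype.card_bool, Fintype.card_fin, nsmul_eq_mul, mul_one, smul_eq_mul]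
  push_cast
  exact ENNReal.inv_mul_cancel (by simp) (by simp)

lemma isProbabilityMeasure_nuX (hn : 1 ≤ n) (x : Fin n → Cube p) :
    IsProbabilityMeasure (nuX x) := by
  constructor
  have h0 : (n : ℝ≥0∞) ≠ 0 := by simpa using (by omega : n ≠ 0)
  rw [nuX, Measure.add_apply, Measure.smul_apply, Measure.smul_apply, Measure.finsetSum_apply]
  simp only [measure_univ, smul_eq_mul, mul_one, Finset.sum_const, Finset.card_univ,
    Fintype.card_fin, nsmul_eq_mul]
  rw [ENNReal.mul_inv (Or.inl (by simp)) (Or.inl (by simp)), mul_assoc,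
    ENNReal.inv_mul_cancel h0 (by simp), mul_one, ENNReal.inv_two_add_inv_two]

lemma nuX_singleton_ne_zero (x : Fin n → Cube p) (i : Fin n) : nuX x {x i} ≠ 0 := by
  rw [nuX, Measure.add_apply, Measure.smul_apply, Measure.smul_apply, Measure.finsetSum_apply]
  simp only [smul_eq_mul, ne_eq, add_eq_zero, mul_eq_zero, not_and_or, not_or]
  right
  refine ⟨by simp [ENNReal.mul_eq_top], ?_⟩
  rw [Finset.sum_eq_zero_iff]
  intro h
  simpa using h i (Finset.mem_univ i)

lemma eq_of_ae_eq_nuX {x : Fin n → Cube p} {f g : Cube p → ℝ} (h : f =ᵐ[nuX x] g) (i : Fin n) :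
    f (x i) = g (x i) := by
  by_contra hne
  exact nuX_singleton_ne_zero x i (measure_mono_null (singleton_subset_iff.2 hne) h)

section L2

variable (x : Fin n → Cube p) [IsProbabilityMeasure (nuX x)]

lemma memLp_of_mem_treeSpace {T : Cube p → ℝ} (hT : T ∈ treeSpace p) : MemLp T 2 (nuX x) :=
  MemLp.of_bound (measurable_of_mem_treeSpace hT).aestronglyMeasurable (tvNorm T)
    (ae_of_all _ fun c => abs_le_tvNorm hT c)

/-- The embedding of the tree functions in `L²`. -/
def treeToL2 : treeSubmodule p →ₗ[ℝ] L2x x where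
  toFun T := (memLp_of_mem_treeSpace x T.2).toLp T
  map_add' _ _ := rfl
  map_smul' _ _ := rfl

variable {x}

lemma treeToL2_ae (T : treeSubmodule p) : treeToL2 x T =ᵐ[nuX x] (T : Cube p → ℝ) :=
  MemLp.coeFn_toLp (memLp_of_mem_treeSpace x T.2)

lemma treeToL2_apply (T : treeSubmodule p) (i : Fin n) : treeToL2 x T (x i) = T.1 (x i) :=
  eq_of_ae_eq_nuX (treeToL2_ae T) i

lemma norm_treeToL2_le {T : treeSubmodule p} {C : ℝ} (hC : 0 ≤ C) (h : ∀ c, |T.1 c| ≤ C) :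
    ‖treeToL2 x T‖ ≤ C := by
  have := Lp.norm_le_of_ae_bound (p := 2) (μ := nuX x) (f := treeToL2 x T) hC ?_
  · simpa [measureUnivNNReal] using this
  · filter_upwards [treeToL2_ae T] with c hc
    rw [hc]
    exact h c

lemma norm_treeToL2_le_tvNorm (T : treeSubmodule p) : ‖treeToL2 x T‖ ≤ tvNorm T.1 :=
  norm_treeToL2_le (tvNorm_nonneg _) (abs_le_tvNorm T.2)

variable (x) in
/-- The evaluation at a data point, as a continuous linear form on `L²`. -/
def evalL2 (i : Fin n) : L2x x →L[ℝ] ℝ :=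
  ((nuX x).real {x i})⁻¹ • innerSL ℝ
    (indicatorConstLp 2 (measurableSet_singleton (x i)) (measure_ne_top (nuX x) _) (1 : ℝ))

lemma evalL2_apply (i : Fin n) (F : L2x x) : evalL2 x i F = F (x i) := by
  have h : (nuX x).real {x i} ≠ 0 :=
    (ENNReal.toReal_pos (nuX_singleton_ne_zero x i) (measure_ne_top _ _)).ne'
  rw [evalL2, smul_apply, innerSL_apply_apply, L2.inner_indicatorConstLp_one,
    integral_singleton, smul_eq_mul, smul_eq_mul, inv_mul_cancel_left₀ h]

end L2

end InfGB

end

noncomputable section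

namespace InfGB

/-! ### Mean fields and their integrals along curves -/

variable {p n : ℕ} {ι S : Type*} [Fintype ι] [MeasurableSpace S]

/-- The mean of the tree functions with the masses `m a z s` at the positions `q a s`. -/
def meanField (σ : Measure S) (m : ι → (Fin n → ℝ) → S → ℝ) (q : ι → S → Cube p) (z : Fin n → ℝ)
    (c : Cube p) : ℝ :=
  ∑ a, ∫ s, m a z s * step (q a s) c ∂σ

/-- The integral of the mean field along a curve. -/
def flowIntegral (σ : Measure S) (m : ι → (Fin n → ℝ) → S → ℝ) (q : ι → S → Cube p)
    (z : ℝ → Fin n → ℝ) (t : ℝ) (c : Cube p) : ℝ :=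
  ∫ τ in (0 : ℝ)..t, meanField σ m q (z τ) c

variable {σ : Measure S} [IsProbabilityMeasure σ] {m : ι → (Fin n → ℝ) → S → ℝ}
  {q : ι → S → Cube p}

lemma mem_treeSpace_interval_mixture {g : ι → ℝ × S → ℝ} {a b C : ℝ}
    (hab : a ≤ b) (hg : ∀ i, Measurable (g i)) (hgC : ∀ i, ∀ τ ∈ Ioc a b, ∀ s, |g i (τ, s)| ≤ C)
    (hq : ∀ i, Measurable (q i)) (hq' : ∀ i s, q i s ∉ upperBoundary p) {T : Cube p → ℝ}
    (hT : ∀ c, T c = ∫ τ in a..b, ∑ i, ∫ s, g i (τ, s) * step (q i s) c ∂σ) :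
    T ∈ treeSpace p ∧ tvNorm T ≤ ∑ i, ∫ τ in a..b, ∫ s, |g i (τ, s)| ∂σ ∧
      ((∀ i y, 0 ≤ g i y) → T ∈ treeCone p) := by
  set ρ : Measure (ℝ × S) := (volume.restrict (Ioc a b)).prod σ with hρ
  have hae : ∀ i, ∀ᵐ y ∂ρ, ‖g i y‖ ≤ C := by
    intro i
    have h1 : ∀ᵐ y ∂ρ, y.1 ∈ Ioc a b :=
      Measure.quasiMeasurePreserving_fst.ae (ae_restrict_mem measurableSet_Ioc)
    filter_upwards [h1] with y hy using hgC i y.1 hy y.2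
  have hint : ∀ i, Integrable (g i) ρ := fun i =>
    Integrable.of_bound (hg i).aestronglyMeasurable C (hae i)
  have hint' : ∀ i c, Integrable (fun y : ℝ × S => g i y * step (q i y.2) c) ρ := fun i c =>
    integrable_mul_step (hint i) ((hq i).comp measurable_snd) c
  have hT' : ∀ c, T c = ∑ i, ∫ y, g i y * step (q i y.2) c ∂ρ := by
    intro c
    rw [hT, intervalIntegral.integral_of_le hab,
      integral_finsetSum _ fun i _ => (hint' i c).integral_prod_left]
    refine Finset.sum_congr rfl fun i _ => ?_
    rw [hρ, integral_prod _ (hint' i c)]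
  have h1 := mem_treeSpace_mixture (ρ := ρ) (q := fun i (y : ℝ × S) => q i y.2) hint
    (fun i => (hq i).comp measurable_snd) (fun i y => hq' i y.2) hT'
  refine ⟨h1.1, h1.2.trans_eq (Finset.sum_congr rfl fun i _ => ?_), fun h0 => ?_⟩
  · rw [intervalIntegral.integral_of_le hab, hρ, integral_prod _ (hint i).abs]
  · exact mem_treeCone_mixture (ρ := ρ) (q := fun i (y : ℝ × S) => q i y.2) hint
      (fun i => (hq i).comp measurable_snd) (fun i y => hq' i y.2) h0 hT'

variable (hm : RegularMass σ m) (hq : ∀ a, Measurable (q a))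
  (hq' : ∀ a s, q a s ∉ upperBoundary p)

include hm hq

omit [Fintype ι] in
lemma integrable_mass_mul_step (a : ι) (z : Fin n → ℝ) (c : Cube p) :
    Integrable (fun s => m a z s * step (q a s) c) σ :=
  integrable_mul_step (hm.integrable a z) (hq a) c

lemma meanField_eq_integral (z : Fin n → ℝ) (c : Cube p) :
    meanField σ m q z c = ∫ s, ∑ a, m a z s * step (q a s) c ∂σ := by
  rw [meanField, integral_finsetSum _ fun a _ => integrable_mass_mul_step hm hq a z c]

include hq'

lemma meanField_mem (z : Fin n → ℝ) : meanField σ m q z ∈ treeSpace p :=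
  (mem_treeSpace_mixture (fun a => hm.integrable a z) hq hq' fun _ => rfl).1

lemma exists_tvNorm_meanField_sub_le (R : ℝ) :
    ∃ C, 0 ≤ C ∧ ∀ z z', ‖z‖ ≤ R → ‖z'‖ ≤ R →
      tvNorm (fun c => meanField σ m q z c - meanField σ m q z' c) ≤ C * ‖z - z'‖ := by
  obtain ⟨C, hC, h⟩ := hm.lipschitz R
  refine ⟨Fintype.card ι * C, by positivity, fun z z' hz hz' => ?_⟩
  refine (mem_treeSpace_mixture (g := fun a s => m a z s - m a z' s)
    (fun a => (hm.integrable a z).sub (hm.integrable a z')) hq hq' fun c => ?_).2.trans ?_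
  · rw [meanField, meanField, ← Finset.sum_sub_distrib]
    refine Finset.sum_congr rfl fun a _ => ?_
    simp_rw [sub_mul]
    rw [integral_sub (integrable_mass_mul_step hm hq a z c)
      (integrable_mass_mul_step hm hq a z' c)]
  · refine (Finset.sum_le_sum fun a _ => h a z z' hz hz').trans_eq ?_
    simp [mul_assoc]

lemma abs_meanField_sub_le (R : ℝ) :
    ∃ C, 0 ≤ C ∧ ∀ z z' c, ‖z‖ ≤ R → ‖z'‖ ≤ R →
      |meanField σ m q z c - meanField σ m q z' c| ≤ C * ‖z - z'‖ := by
  obtain ⟨C, hC, h⟩ := exists_tvNorm_meanField_sub_le hm hq hq' R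
  refine ⟨C, hC, fun z z' c hz hz' => (abs_le_tvNorm (T := fun c => meanField σ m q z c -
    meanField σ m q z' c) ?_ c).trans (h z z' hz hz')⟩
  exact (treeSubmodule p).sub_mem (meanField_mem hm hq hq' z) (meanField_mem hm hq hq' z')

lemma continuous_meanField (c : Cube p) : Continuous fun z => meanField σ m q z c := by
  rw [continuous_iff_continuousAt]
  intro z
  obtain ⟨C, hC, h⟩ := abs_meanField_sub_le hm hq hq' (‖z‖ + 1)
  rw [ContinuousAt, tendsto_iff_dist_tendsto_zero]
  have h1 : Tendsto (fun z' => C * ‖z' - z‖) (𝓝 z) (𝓝 0) := by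
    have : Continuous fun z' : Fin n → ℝ => C * ‖z' - z‖ := by fun_prop
    simpa using this.tendsto z
  refine squeeze_zero' (Eventually.of_forall fun _ => dist_nonneg) ?_ h1
  have h2 : ∀ᶠ z' : Fin n → ℝ in 𝓝 z, ‖z'‖ < ‖z‖ + 1 :=
    continuous_norm.tendsto z |>.eventually (gt_mem_nhds (lt_add_one _))
  filter_upwards [h2] with z' hz'
  exact h z' z c hz'.le (by linarith)

variable {z : ℝ → Fin n → ℝ} (hz : Continuous z)

include hz

lemma intervalIntegrable_meanField (c : Cube p) (a b : ℝ) :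
    IntervalIntegrable (fun τ => meanField σ m q (z τ) c) volume a b :=
  ((continuous_meanField hm hq hq' c).comp hz).intervalIntegrable _ _

lemma integral_meanField_mem {a b : ℝ} (hab : a ≤ b) :
    (fun c => ∫ τ in a..b, meanField σ m q (z τ) c) ∈ treeSpace p ∧
    ((∀ a z s, 0 ≤ m a z s) →
      (fun c => ∫ τ in a..b, meanField σ m q (z τ) c) ∈ treeCone p) := by
  obtain ⟨R, hR⟩ := isCompact_Icc.exists_bound_of_continuousOn (s := Icc a b) hz.continuousOn
  obtain ⟨C, -, hC⟩ := hm.bounded R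
  have := mem_treeSpace_interval_mixture (σ := σ) (g := fun i y => m i (z y.1) y.2) hab
    (fun i => (hm.measurable i).comp
      ((hz.measurable.comp measurable_fst).prodMk measurable_snd))
    (fun i τ hτ s => hC i _ s (hR τ (Ioc_subset_Icc_self hτ))) hq hq'
    (T := fun c => ∫ τ in a..b, meanField σ m q (z τ) c) (fun c => rfl)
  exact ⟨this.1, fun h => this.2.2 fun i y => h _ _ _⟩

lemma integral_meanField_mem_treeSpace (a b : ℝ) :
    (fun c => ∫ τ in a..b, meanField σ m q (z τ) c) ∈ treeSpace p := by
  rcases le_total a b with h | h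
  · exact (integral_meanField_mem hm hq hq' hz h).1
  · simp_rw [intervalIntegral.integral_symm b a]
    exact (treeSubmodule p).neg_mem (integral_meanField_mem hm hq hq' hz h).1

lemma flowIntegral_mem (t : ℝ) : flowIntegral σ m q z t ∈ treeSpace p :=
  integral_meanField_mem_treeSpace hm hq hq' hz 0 t

lemma flowIntegral_mem_treeCone (h : ∀ a z s, 0 ≤ m a z s) {t : ℝ} (ht : 0 ≤ t) :
    flowIntegral σ m q z t ∈ treeCone p :=
  (integral_meanField_mem hm hq hq' hz ht).2 h

lemma flowIntegral_sub (s t : ℝ) (c : Cube p) :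
    flowIntegral σ m q z s c - flowIntegral σ m q z t c =
      ∫ τ in t..s, meanField σ m q (z τ) c :=
  intervalIntegral.integral_interval_sub_left
    (intervalIntegrable_meanField hm hq hq' hz c _ _)
    (intervalIntegrable_meanField hm hq hq' hz c _ _)

lemma tvNorm_slope_sub_le_of_lt (z₁ : Fin n → ℝ) {R : ℝ} :
    ∃ C, 0 ≤ C ∧ ∀ a b δ, a < b → (∀ τ ∈ Icc a b, ‖z τ‖ ≤ R) → ‖z₁‖ ≤ R →
      (∀ τ ∈ Icc a b, ‖z τ - z₁‖ ≤ δ) →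
      tvNorm (fun c => (flowIntegral σ m q z b c - flowIntegral σ m q z a c) / (b - a) -
        meanField σ m q z₁ c) ≤ C * δ := by
  obtain ⟨C, hC, hl⟩ := hm.lipschitz R
  obtain ⟨C', -, hb⟩ := hm.bounded R
  refine ⟨Fintype.card ι * C, by positivity, fun a b δ hab hR hR₁ hδ => ?_⟩
  have hba : 0 < b - a := sub_pos.2 hab
  have h1 := mem_treeSpace_interval_mixture (σ := σ)
    (g := fun i y => m i (z y.1) y.2 - m i z₁ y.2) (C := C' + C') hab.le
    (fun i => ((hm.measurable i).comp
      ((hz.measurable.comp measurable_fst).prodMk measurable_snd)).sub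
        ((hm.measurable i).comp (measurable_const.prodMk measurable_snd)))
    (fun i τ hτ s => (abs_sub _ _).trans
      (add_le_add (hb i _ s (hR τ (Ioc_subset_Icc_self hτ))) (hb i _ s hR₁))) hq hq'
    (T := fun c => ∫ τ in a..b, (meanField σ m q (z τ) c - meanField σ m q z₁ c)) (fun c => ?_)
  · have h2 : (fun c => (flowIntegral σ m q z b c - flowIntegral σ m q z a c) / (b - a) -
        meanField σ m q z₁ c) = fun c => (b - a)⁻¹ *
          ∫ τ in a..b, (meanField σ m q (z τ) c - meanField σ m q z₁ c) := by
      funext c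
      rw [flowIntegral_sub hm hq hq' hz, intervalIntegral.integral_sub
        (intervalIntegrable_meanField hm hq hq' hz c _ _) intervalIntegrable_const,
        intervalIntegral.integral_const, smul_eq_mul]
      field_simp
    rw [h2]
    refine (tvNorm_const_mul_le h1.1 _).trans ?_
    rw [abs_of_pos (inv_pos.2 hba), inv_mul_le_iff₀ hba]
    refine h1.2.1.trans ?_
    have h3 : ∀ i, ∫ τ in a..b, ∫ s, |m i (z τ) s - m i z₁ s| ∂σ ≤ (b - a) * (C * δ) := by
      intro i
      have : ∀ τ ∈ uIoc a b, ‖∫ s, |m i (z τ) s - m i z₁ s| ∂σ‖ ≤ C * δ := by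
        intro τ hτ
        rw [uIoc_of_le hab.le] at hτ
        have hτ' := Ioc_subset_Icc_self hτ
        rw [Real.norm_eq_abs, abs_of_nonneg (integral_nonneg fun _ => abs_nonneg _)]
        exact (hl i _ _ (hR τ hτ') hR₁).trans (mul_le_mul_of_nonneg_left (hδ τ hτ') hC)
      have := intervalIntegral.norm_integral_le_of_norm_le_const this
      rw [abs_of_pos hba] at this
      refine (le_abs_self _).trans (this.trans_eq (mul_comm _ _))
    refine (Finset.sum_le_sum fun i _ => h3 i).trans_eq ?_
    simp; ring
  · refine intervalIntegral.integral_congr fun τ _ => ?_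
    dsimp only
    rw [meanField, meanField, ← Finset.sum_sub_distrib]
    refine Finset.sum_congr rfl fun i _ => ?_
    simp_rw [sub_mul]
    rw [integral_sub (integrable_mass_mul_step hm hq i _ c)
      (integrable_mass_mul_step hm hq i _ c)]

/-- The integral of the mean field along a curve is differentiable in total variation. -/
lemma tendsto_tvNorm_slope (t : ℝ) :
    Tendsto (fun s => tvNorm fun c => (flowIntegral σ m q z s c - flowIntegral σ m q z t c) /
      (s - t) - meanField σ m q (z t) c) (𝓝[≠] t) (𝓝 0) := by
  obtain ⟨C, hC, h⟩ := tvNorm_slope_sub_le_of_lt hm hq hq' hz (z t) (R := ‖z t‖ + 1)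
  rw [Metric.tendsto_nhds]
  intro ε hε
  set δ := min 1 (ε / (2 * (C + 1))) with hδdef
  have hδ : 0 < δ := lt_min one_pos (by positivity)
  obtain ⟨η, hη, hzη⟩ := Metric.continuous_iff.1 hz t δ hδ
  filter_upwards [self_mem_nhdsWithin, mem_nhdsWithin_of_mem_nhds (Metric.ball_mem_nhds t hη)]
    with s hs hsη
  have hcl : ∀ τ, |τ - t| ≤ |s - t| → ‖z τ - z t‖ ≤ δ := by
    intro τ hτ
    have := hzη τ ((Real.dist_eq _ _).trans_le hτ |>.trans_lt
      (by rwa [Metric.mem_ball, Real.dist_eq] at hsη))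
    rw [dist_eq_norm] at this
    exact this.le
  have hbd : ∀ τ, |τ - t| ≤ |s - t| → ‖z τ‖ ≤ ‖z t‖ + 1 := by
    intro τ hτ
    have h1 := hcl τ hτ
    have h2 : ‖z τ‖ ≤ ‖z τ - z t‖ + ‖z t‖ := norm_le_norm_sub_add _ _
    have h3 : δ ≤ 1 := min_le_left _ _
    linarith
  have hfin : C * δ < ε := by
    have h1 : δ ≤ ε / (2 * (C + 1)) := min_le_right _ _
    have h2 : C * δ ≤ C * (ε / (2 * (C + 1))) := mul_le_mul_of_nonneg_left h1 hC
    have h3 : C * (ε / (2 * (C + 1))) < ε := by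
      rw [← mul_div_assoc, div_lt_iff₀ (by positivity)]
      nlinarith
    linarith
  rw [Real.dist_eq, sub_zero, abs_of_nonneg (tvNorm_nonneg _)]
  refine lt_of_le_of_lt ?_ hfin
  rcases lt_or_gt_of_ne (show s ≠ t from hs) with hst | hst
  · have e : ∀ τ ∈ Icc s t, |τ - t| ≤ |s - t| := by
      intro τ hτ
      rw [abs_of_nonpos (by linarith [hτ.2]), abs_of_neg (by linarith)]
      linarith [hτ.1]
    have := h s t δ hst (fun τ hτ => hbd τ (e τ hτ)) (by linarith) (fun τ hτ => hcl τ (e τ hτ))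
    have e2 : ∀ c, (flowIntegral σ m q z s c - flowIntegral σ m q z t c) / (s - t) =
        (flowIntegral σ m q z t c - flowIntegral σ m q z s c) / (t - s) := fun c => by
      rw [← neg_sub, ← neg_sub t s, neg_div_neg_eq]
    simp_rw [e2]
    exact this
  · have e : ∀ τ ∈ Icc t s, |τ - t| ≤ |s - t| := by
      intro τ hτ
      rw [abs_of_nonneg (by linarith [hτ.1]), abs_of_pos (by linarith)]
      linarith [hτ.2]
    exact h t s δ hst (fun τ hτ => hbd τ (e τ hτ)) (by linarith) (fun τ hτ => hcl τ (e τ hτ))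

end InfGB

end

noncomputable section

namespace InfGB

/-! ### The infinitesimal boosting operator -/

variable {p n d K : ℕ}

/-- The positive (`e = true`) or negative (`e = false`) part of a tree function. -/
def treePart (e : Bool) (T : Cube p → ℝ) : Cube p → ℝ := bif e then treePos T else treeNeg T

lemma treePart_mem_treeCone (e : Bool) {T : Cube p → ℝ} (hT : T ∈ treeSpace p) :
    treePart e T ∈ treeCone p := by
  cases e
  · exact treeNeg_mem_treeCone hT
  · exact treePos_mem_treeCone hT

namespace BoostingData

variable [NeZero K] (B : BoostingData p n d K)

open Classical in
/-- The masses of the atoms of the positive and negative parts of gradient trees. -/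
def partMass (e : Bool) (a : AtomIndex p d K) (z : Fin n → ℝ) (ζ : Aux p d K) : ℝ :=
  posMass (fun b => bif e then B.atomMass b z ζ else -B.atomMass b z ζ) (fun b => atomPos b ζ) a

lemma partMass_nonneg (e : Bool) (a : AtomIndex p d K) (z : Fin n → ℝ) (ζ : Aux p d K) :
    0 ≤ B.partMass e a z ζ := posMass_nonneg _ _ _

lemma treePart_gradTree (e : Bool) (z : Fin n → ℝ) (ζ : Aux p d K) (c : Cube p) :
    treePart e (B.gradTree z ζ) c = ∑ a, B.partMass e a z ζ * step (atomPos a ζ) c := by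
  have h := treePos_sum_step (m := fun a => B.atomMass a z ζ) (fun a => atomPos_notMem a ζ) c
  rw [show B.gradTree z ζ = _ from funext (B.gradTree_eq_sum_step z ζ)]
  cases e
  · exact h.2
  · exact h.1

lemma gradTree_mem (z : Fin n → ℝ) (ζ : Aux p d K) : B.gradTree z ζ ∈ treeSpace p := by
  refine (mem_treeSpace_mixture (ρ := Measure.dirac ()) (g := fun a _ => B.atomMass a z ζ)
    (q := fun a _ => atomPos a ζ) (fun _ => integrable_const _) (fun _ => measurable_const)
    (fun a _ => atomPos_notMem a ζ) fun c => ?_).1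
  rw [B.gradTree_eq_sum_step]
  simp

/-- The mean of the positive or negative part of the gradient tree. -/
def partOp (e : Bool) : (Fin n → ℝ) → Cube p → ℝ :=
  meanField (auxLaw p d K) (B.partMass e) atomPos

/-- The standing assumptions on the data. -/
structure Admissible : Prop where
  dim_pos : 1 ≤ p
  card_pos : 1 ≤ n
  beta_nonneg : 0 ≤ B.β
  loss : LossAssumption B.L

variable {B}

section Admissible

variable (hB : B.Admissible)

include hB

lemma Admissible.isProbabilityMeasure : IsProbabilityMeasure (auxLaw p d K) :=
  isProbabilityMeasure_auxLaw hB.dim_pos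

lemma Admissible.isProbabilityMeasure_nuX : IsProbabilityMeasure (nuX B.x) :=
  InfGB.isProbabilityMeasure_nuX hB.card_pos B.x

lemma Admissible.regularMass_partMass (e : Bool) : RegularMass (auxLaw p d K) (B.partMass e) := by
  have := hB.isProbabilityMeasure
  have h := B.regularMass_atomMass hB.dim_pos hB.beta_nonneg hB.loss
  cases e
  · exact h.neg.posMass measurable_atomPos
  · exact h.posMass measurable_atomPos

lemma Admissible.partOp_eq (e : Bool) (z : Fin n → ℝ) (c : Cube p) :
    B.partOp e z c = ∫ ζ, treePart e (B.gradTree z ζ) c ∂auxLaw p d K := by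
  have := hB.isProbabilityMeasure
  rw [partOp, meanField_eq_integral (hB.regularMass_partMass e) measurable_atomPos]
  simp_rw [B.treePart_gradTree]

lemma Admissible.integrable_treePart (e : Bool) (z : Fin n → ℝ) (c : Cube p) :
    Integrable (fun ζ => treePart e (B.gradTree z ζ) c) (auxLaw p d K) := by
  have := hB.isProbabilityMeasure
  simp_rw [B.treePart_gradTree]
  exact integrable_finsetSum _ fun a _ =>
    integrable_mass_mul_step (hB.regularMass_partMass e) measurable_atomPos a z c

lemma Admissible.opPos_eq (z : Fin n → ℝ) : B.opPos z = B.partOp true z :=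
  funext fun c => (hB.partOp_eq true z c).symm

lemma Admissible.opNeg_eq (z : Fin n → ℝ) : B.opNeg z = B.partOp false z :=
  funext fun c => (hB.partOp_eq false z c).symm

lemma Admissible.op_eq (z : Fin n → ℝ) : B.op z = B.partOp true z - B.partOp false z := by
  funext c
  rw [Pi.sub_apply, hB.partOp_eq, hB.partOp_eq,
    ← integral_sub (hB.integrable_treePart true z c) (hB.integrable_treePart false z c), op]
  refine integral_congr_ae (ae_of_all _ fun ζ => ?_)
  exact (treePos_sub_treeNeg (B.gradTree_mem z ζ) c).symm

lemma Admissible.integrable_gradTree (z : Fin n → ℝ) (c : Cube p) :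
    Integrable (fun ζ => B.gradTree z ζ c) (auxLaw p d K) := by
  refine ((hB.integrable_treePart true z c).sub (hB.integrable_treePart false z c)).congr
    (ae_of_all _ fun ζ => ?_)
  exact treePos_sub_treeNeg (B.gradTree_mem z ζ) c

lemma Admissible.partOp_mem (e : Bool) (z : Fin n → ℝ) : B.partOp e z ∈ treeSpace p := by
  have := hB.isProbabilityMeasure
  exact meanField_mem (hB.regularMass_partMass e) measurable_atomPos atomPos_notMem z

lemma Admissible.op_mem (z : Fin n → ℝ) : B.op z ∈ treeSpace p := by
  rw [hB.op_eq]
  exact (treeSubmodule p).sub_mem (hB.partOp_mem true z) (hB.partOp_mem false z)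

lemma Admissible.abs_partOp_sub_le (e : Bool) (R : ℝ) :
    ∃ C, 0 ≤ C ∧ ∀ z z' c, ‖z‖ ≤ R → ‖z'‖ ≤ R →
      |B.partOp e z c - B.partOp e z' c| ≤ C * ‖z - z'‖ := by
  have := hB.isProbabilityMeasure
  exact InfGB.abs_meanField_sub_le (hB.regularMass_partMass e) measurable_atomPos atomPos_notMem R

/-! ### The equation for the values at the data points -/

omit hB in
variable (B) in
/-- The right hand side of the differential equation for the values at the data points. -/
def velocity (z : Fin n → ℝ) (i : Fin n) : ℝ := B.op z (B.x i)

lemma Admissible.velocity_lipschitz (R : ℝ) :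
    ∃ C, LipschitzOnWith C B.velocity (Metric.closedBall 0 R) := by
  obtain ⟨C, hC, h⟩ := hB.abs_partOp_sub_le true R
  obtain ⟨C', hC', h'⟩ := hB.abs_partOp_sub_le false R
  refine ⟨(C + C').toNNReal, LipschitzOnWith.of_dist_le_mul fun z hz z' hz' => ?_⟩
  rw [mem_closedBall_zero_iff] at hz hz'
  rw [Real.coe_toNNReal _ (add_nonneg hC hC'), dist_eq_norm, dist_eq_norm]
  refine (pi_norm_le_iff_of_nonneg (by positivity)).2 fun i => ?_
  have h1 := abs_le.1 (h z z' (B.x i) hz hz')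
  have h2 := abs_le.1 (h' z z' (B.x i) hz hz')
  rw [Pi.sub_apply, velocity, velocity, hB.op_eq, hB.op_eq, Real.norm_eq_abs, abs_le, Pi.sub_apply,
    Pi.sub_apply]
  constructor <;> nlinarith

lemma Admissible.sum_deriv_mul_velocity_nonpos (z : Fin n → ℝ) :
    ∑ i, deriv (B.L (B.y i)) (z i) * B.velocity z i ≤ 0 := by
  have h1 : ∑ i, deriv (B.L (B.y i)) (z i) * B.velocity z i =
      ∫ ζ, ∑ i, deriv (B.L (B.y i)) (z i) * B.gradTree z ζ (B.x i) ∂auxLaw p d K := by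
    rw [integral_finsetSum _ fun i _ => (hB.integrable_gradTree z _).const_mul _]
    refine Finset.sum_congr rfl fun i _ => ?_
    rw [integral_const_mul]; rfl
  rw [h1]
  refine integral_nonpos fun ζ => ?_
  simp only [gradTree, Finset.mul_sum, Pi.zero_apply]
  rw [Finset.sum_comm]
  refine Finset.sum_nonpos fun w _ => ?_
  have h2 : ∑ i, deriv (B.L (B.y i)) (z i) *
      (B.leafValue z (B.leaf z ζ w) * ind (B.leaf z ζ w) (B.x i)) =
      B.leafValue z (B.leaf z ζ w) *
        ∑ i, deriv (B.L (B.y i)) (z i) * ind (B.leaf z ζ w) (B.x i) := by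
    rw [Finset.mul_sum]
    exact Finset.sum_congr rfl fun i _ => by ring
  rw [h2, leafValue, neg_mul, div_mul_eq_mul_div]
  refine neg_nonpos.2 (div_nonneg (mul_self_nonneg _) (Finset.sum_nonneg fun i _ => ?_))
  exact mul_nonneg (hB.loss.second_deriv_pos _ _).le (ind_nonneg _ _)

lemma Admissible.velocity_le {z : Fin n → ℝ} {M : ℝ} (hM : 0 ≤ M)
    (h : ∀ i, |deriv (B.L (B.y i)) (z i) / deriv (deriv (B.L (B.y i))) (z i)| ≤ M) :
    ‖B.velocity z‖ ≤ 2 ^ d * M := by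
  have := hB.isProbabilityMeasure
  have hleaf : ∀ A : Set (Cube p), |B.leafValue z A| ≤ M := by
    intro A
    have hD : 0 ≤ ∑ i, deriv (deriv (B.L (B.y i))) (z i) * ind A (B.x i) :=
      Finset.sum_nonneg fun i _ => mul_nonneg (hB.loss.second_deriv_pos _ _).le (ind_nonneg _ _)
    rw [leafValue, abs_neg, abs_div, abs_of_nonneg hD]
    refine div_le_of_le_mul₀ hD hM ?_
    rw [Finset.mul_sum]
    refine (Finset.abs_sum_le_sum_abs _ _).trans (Finset.sum_le_sum fun i _ => ?_)
    have hp := hB.loss.second_deriv_pos (B.y i) (z i)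
    have hi := h i
    rw [abs_div, abs_of_pos hp, div_le_iff₀ hp] at hi
    rw [abs_mul, abs_of_nonneg (ind_nonneg _ _), ← mul_assoc]
    exact mul_le_mul_of_nonneg_right hi (ind_nonneg _ _)
  refine (pi_norm_le_iff_of_nonneg (by positivity)).2 fun i => ?_
  have hb : ∀ ζ, ‖B.gradTree z ζ (B.x i)‖ ≤ 2 ^ d * M := by
    intro ζ
    rw [gradTree, Real.norm_eq_abs]
    refine (Finset.abs_sum_le_sum_abs _ _).trans
      ((Finset.sum_le_sum (g := fun _ => M) fun w _ => ?_).trans_eq (by simp))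
    rw [abs_mul]
    exact (mul_le_of_le_one_right (abs_nonneg _) (abs_ind_le_one _ _)).trans (hleaf _)
  have := norm_integral_le_of_norm_le_const (μ := auxLaw p d K) (ae_of_all _ hb)
  rwa [probReal_univ, mul_one] at this

lemma Admissible.exists_trajectory (z₀ : Fin n → ℝ) : ∃ z : ℝ → Fin n → ℝ, Continuous z ∧
    z 0 = z₀ ∧ ∀ t ≥ 0, HasDerivWithinAt z (B.velocity (z t)) (Ici 0) t := by
  have hV : ∀ z : Fin n → ℝ, HasFDerivAt (fun z : Fin n → ℝ => ∑ i, B.L (B.y i) (z i))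
      (∑ i, deriv (B.L (B.y i)) (z i) • ContinuousLinearMap.proj (R := ℝ) (φ := fun _ => ℝ) i) z := by
    intro z
    refine HasFDerivAt.fun_sum fun i _ => ?_
    exact (hB.loss.differentiable (B.y i) (z i)).hasDerivAt.comp_hasFDerivAt z
      (hasFDerivAt_apply (𝕜 := ℝ) i z)
  have hb : ∀ C, ∃ M, ∀ z, ∑ i, B.L (B.y i) (z i) ≤ C → ‖B.velocity z‖ ≤ M := by
    intro C
    obtain ⟨M, hM⟩ := hB.loss.ratio_bounded (|C| + 1) (by positivity)
    refine ⟨2 ^ d * |M|, fun z hz => hB.velocity_le (abs_nonneg M) fun i =>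
      (hM _ _ ?_).trans (le_abs_self M)⟩
    have h1 : B.L (B.y i) (z i) ≤ ∑ i, B.L (B.y i) (z i) :=
      Finset.single_le_sum (f := fun i => B.L (B.y i) (z i))
        (fun i _ => hB.loss.nonneg _ _) (Finset.mem_univ i)
    linarith [le_abs_self C]
  obtain ⟨f, hf0, hf⟩ := exists_solution_Ici hB.velocity_lipschitz hV
    (fun z => by simpa using hB.sum_deriv_mul_velocity_nonpos z) hb z₀
  have hfc : ContinuousOn f (Ici 0) := fun t ht => (hf t ht).continuousWithinAt
  refine ⟨fun t => f (max t 0), hfc.comp_continuous (by fun_prop) fun t =>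
    mem_Ici.2 (le_max_right _ _), by simpa using hf0, fun t ht => ?_⟩
  have ht' : max t 0 = t := max_eq_left ht
  simp only [ht']
  exact (hf t ht).congr (fun s hs => by rw [max_eq_left hs]) (by rw [ht'])

end Admissible

/-! ### The solution of the system -/

variable (B) in
/-- The integral of the positive or negative part of the boosting operator along a curve. -/
def partFlow (e : Bool) (z : ℝ → Fin n → ℝ) : ℝ → Cube p → ℝ :=
  flowIntegral (auxLaw p d K) (B.partMass e) atomPos z

section Flow

variable (hB : B.Admissible) {z : ℝ → Fin n → ℝ} (hz : Continuous z)

include hB hz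

lemma Admissible.partFlow_mem (e : Bool) (t : ℝ) : B.partFlow e z t ∈ treeSubmodule p := by
  have := hB.isProbabilityMeasure
  exact flowIntegral_mem (hB.regularMass_partMass e) measurable_atomPos atomPos_notMem hz t

lemma Admissible.partFlow_mem_treeCone (e : Bool) {t : ℝ} (ht : 0 ≤ t) :
    B.partFlow e z t ∈ treeCone p := by
  have := hB.isProbabilityMeasure
  exact flowIntegral_mem_treeCone (hB.regularMass_partMass e) measurable_atomPos atomPos_notMem hz
    (B.partMass_nonneg e) ht

omit hz [NeZero K] hB in
lemma partFlow_zero [NeZero K] (e : Bool) : B.partFlow e z 0 = 0 := by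
  funext c; simp [partFlow, flowIntegral]

lemma Admissible.tendsto_tvNorm_partFlow (e : Bool) (t : ℝ) :
    Tendsto (fun s => tvNorm fun c => (B.partFlow e z s c - B.partFlow e z t c) / (s - t) -
      B.partOp e (z t) c) (𝓝[≠] t) (𝓝 0) := by
  have := hB.isProbabilityMeasure
  exact tendsto_tvNorm_slope (hB.regularMass_partMass e) measurable_atomPos atomPos_notMem hz t

lemma Admissible.hasDerivAt_partFlow_apply (e : Bool) (t : ℝ) (c : Cube p) :
    HasDerivAt (fun t => B.partFlow e z t c) (B.partOp e (z t) c) t := by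
  have := hB.isProbabilityMeasure
  exact ((continuous_meanField (hB.regularMass_partMass e) measurable_atomPos atomPos_notMem
    c).comp hz).integral_hasStrictDerivAt 0 t |>.hasDerivAt

lemma Admissible.partFlow_slope_mem (e : Bool) (s t : ℝ) :
    (fun c => (B.partFlow e z s c - B.partFlow e z t c) / (s - t) - B.partOp e (z t) c) ∈
      treeSubmodule p := by
  have := (treeSubmodule p).sub_mem ((treeSubmodule p).smul_mem (s - t)⁻¹ ((treeSubmodule p).sub_mem
    (hB.partFlow_mem hz e s) (hB.partFlow_mem hz e t))) (hB.partOp_mem e (z t))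
  convert this using 1
  funext c
  simp [div_eq_inv_mul]

lemma Admissible.hasDerivAt_partFlow [IsProbabilityMeasure (nuX B.x)] (e : Bool) (t : ℝ) :
    HasDerivAt (fun t => treeToL2 B.x ⟨B.partFlow e z t, hB.partFlow_mem hz e t⟩)
      (treeToL2 B.x ⟨B.partOp e (z t), hB.partOp_mem e (z t)⟩) t := by
  rw [hasDerivAt_iff_tendsto_slope, tendsto_iff_norm_sub_tendsto_zero]
  refine squeeze_zero (fun _ => norm_nonneg _) (fun s => ?_) (hB.tendsto_tvNorm_partFlow hz e t)
  have h : slope (fun t => treeToL2 B.x ⟨B.partFlow e z t, hB.partFlow_mem hz e t⟩) t s -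
      treeToL2 B.x ⟨B.partOp e (z t), hB.partOp_mem e (z t)⟩ =
      treeToL2 B.x ⟨_, hB.partFlow_slope_mem hz e s t⟩ := by
    rw [slope_def_module, ← map_sub, ← map_smul, ← map_sub]
    congr 1
    ext c
    simp [div_eq_inv_mul]
  rw [h]
  exact norm_treeToL2_le_tvNorm _

variable (hsol : ∀ t ≥ 0, HasDerivWithinAt z (B.velocity (z t)) (Ici 0) t)

include hsol

lemma Admissible.trajectory_eq {t : ℝ} (ht : 0 ≤ t) (i : Fin n) :
    z t i = z 0 i + B.partFlow true z t (B.x i) - B.partFlow false z t (B.x i) := by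
  have hder : ∀ s ∈ Ico 0 t, HasDerivWithinAt (fun s => z s i -
      (B.partFlow true z s (B.x i) - B.partFlow false z s (B.x i))) 0 (Ici s) s := by
    intro s hs
    have h1 := (hasDerivWithinAt_pi.1 (hsol s hs.1) i).mono (Ici_subset_Ici.2 hs.1)
    have h2 := h1.sub (((hB.hasDerivAt_partFlow_apply hz true s (B.x i)).sub
      (hB.hasDerivAt_partFlow_apply hz false s (B.x i))).hasDerivWithinAt (s := Ici s))
    have e : B.velocity (z s) i - (B.partOp true (z s) (B.x i) - B.partOp false (z s) (B.x i)) = 0 := by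
      rw [velocity, hB.op_eq, Pi.sub_apply, sub_self]
    rw [e] at h2
    exact h2
  have hcont : ContinuousOn (fun s => z s i -
      (B.partFlow true z s (B.x i) - B.partFlow false z s (B.x i))) (Icc 0 t) := by
    have hc (e : Bool) : Continuous fun s => B.partFlow e z s (B.x i) :=
      continuous_iff_continuousAt.2 fun s =>
        (hB.hasDerivAt_partFlow_apply hz e s (B.x i)).continuousAt
    exact (((continuous_apply i).comp hz).sub ((hc true).sub (hc false))).continuousOn
  have := constant_of_has_deriv_right_zero hcont hder t ⟨ht, le_rfl⟩
  simp only [partFlow_zero, Pi.zero_apply] at this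
  linarith

end Flow

end BoostingData

end InfGB

end

noncomputable section

namespace InfGB

namespace BoostingData

variable {p n d K : ℕ} {B : BoostingData p n d K} [IsProbabilityMeasure (nuX B.x)]

/-- The values at the data points of the difference of the two components. -/
lemma evalL2_sub (F : L2x B.x × L2x B.x) (i : Fin n) :
    (F.1 - F.2 : L2x B.x) (B.x i) = evalL2 B.x i (F.1 - F.2) := (evalL2_apply _ _).symm

omit [IsProbabilityMeasure (nuX B.x)] in
lemma eq_treeToL2 {x : Fin n → Cube p} [IsProbabilityMeasure (nuX x)] {F : L2x x} {T : Cube p → ℝ}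
    (hT : T ∈ treeSubmodule p) (h : F =ᵐ[nuX x] T) : F = treeToL2 x ⟨T, hT⟩ :=
  Lp.ext (h.trans (treeToL2_ae ⟨T, hT⟩).symm)

section Flow

variable [NeZero K] (hB : B.Admissible) {z : ℝ → Fin n → ℝ} (hz : Continuous z)

/-- The candidate for the solution of the system, when the values at the data points are given by
the curve `z`. -/
def Admissible.flow (F₀ : L2x B.x × L2x B.x) (t : ℝ) : L2x B.x × L2x B.x :=
  (F₀.1 + treeToL2 B.x ⟨B.partFlow true z t, hB.partFlow_mem hz true t⟩,
   F₀.2 + treeToL2 B.x ⟨B.partFlow false z t, hB.partFlow_mem hz false t⟩)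

variable {F₀ : L2x B.x × L2x B.x}

lemma Admissible.flow_zero : hB.flow hz F₀ 0 = F₀ := by
  have h (e : Bool) : (⟨B.partFlow e z 0, hB.partFlow_mem hz e 0⟩ : treeSubmodule p) = 0 :=
    Subtype.ext (partFlow_zero e)
  simp [flow, h]

lemma Admissible.hasDerivAt_flow (t : ℝ) : HasDerivAt (hB.flow hz F₀)
    (treeToL2 B.x ⟨B.partOp true (z t), hB.partOp_mem true (z t)⟩,
      treeToL2 B.x ⟨B.partOp false (z t), hB.partOp_mem false (z t)⟩) t :=
  ((hB.hasDerivAt_partFlow hz true t).const_add _).prodMk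
    ((hB.hasDerivAt_partFlow hz false t).const_add _)

variable (hsol : ∀ t ≥ 0, HasDerivWithinAt z (B.velocity (z t)) (Ici 0) t)
  (h0 : ∀ i, z 0 i = (F₀.1 - F₀.2 : L2x B.x) (B.x i))

include hB hz hsol h0

lemma Admissible.flow_eval {t : ℝ} (ht : 0 ≤ t) (i : Fin n) :
    ((hB.flow hz F₀ t).1 - (hB.flow hz F₀ t).2 : L2x B.x) (B.x i) = z t i := by
  rw [hB.trajectory_eq hz hsol ht, h0, evalL2_sub, evalL2_sub, flow, map_sub, map_sub, map_add,
    map_add, evalL2_apply _ (treeToL2 B.x _), evalL2_apply _ (treeToL2 B.x _), treeToL2_apply,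
    treeToL2_apply]
  ring

lemma Admissible.isSolutionPM_flow : B.IsSolutionPM (hB.flow hz F₀) := by
  intro t ht
  refine ⟨_, ?_, ?_, (hB.hasDerivAt_flow hz t).hasDerivWithinAt⟩
  · simp_rw [hB.flow_eval hz hsol h0 ht, hB.opPos_eq]
    exact treeToL2_ae _
  · simp_rw [hB.flow_eval hz hsol h0 ht, hB.opNeg_eq]
    exact treeToL2_ae _

lemma Admissible.eval_eq_of_isSolutionPM {H V : ℝ → L2x B.x × L2x B.x}
    (hV1 : ∀ t ≥ 0, (V t).1 =ᵐ[nuX B.x] B.opPos fun i => ((H t).1 - (H t).2 : L2x B.x) (B.x i))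
    (hV2 : ∀ t ≥ 0, (V t).2 =ᵐ[nuX B.x] B.opNeg fun i => ((H t).1 - (H t).2 : L2x B.x) (B.x i))
    (hV : ∀ t ≥ 0, HasDerivWithinAt H (V t) (Ici 0) t) (hH0 : H 0 = F₀) {t : ℝ} (ht : 0 ≤ t) :
    (fun i => ((H t).1 - (H t).2 : L2x B.x) (B.x i)) = z t := by
  set w : ℝ → Fin n → ℝ := fun t i => ((H t).1 - (H t).2 : L2x B.x) (B.x i) with hw
  have hwder : ∀ s ≥ 0, HasDerivWithinAt w (B.velocity (w s)) (Ici 0) s := by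
    intro s hs
    refine hasDerivWithinAt_pi.2 fun i => ?_
    have h2 := ((evalL2 B.x i).comp (ContinuousLinearMap.fst ℝ (L2x B.x) (L2x B.x) -
      ContinuousLinearMap.snd ℝ (L2x B.x) (L2x B.x))).hasFDerivAt.comp_hasDerivWithinAt s (hV s hs)
    have e : ((evalL2 B.x i).comp (ContinuousLinearMap.fst ℝ (L2x B.x) (L2x B.x) -
        ContinuousLinearMap.snd ℝ (L2x B.x) (L2x B.x))) (V s) = B.velocity (w s) i := by
      have e1 := eq_of_ae_eq_nuX (hV1 s hs) i
      have e2 := eq_of_ae_eq_nuX (hV2 s hs) i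
      rw [hB.opPos_eq] at e1
      rw [hB.opNeg_eq] at e2
      rw [ContinuousLinearMap.comp_apply, sub_apply, map_sub,
        ContinuousLinearMap.coe_fst', ContinuousLinearMap.coe_snd', evalL2_apply, evalL2_apply,
        e1, e2, velocity, hB.op_eq, Pi.sub_apply]
    rw [e] at h2
    exact h2.congr (fun s _ => evalL2_sub (H s) i) (evalL2_sub (H s) i)
  refine eq_of_isSolution hB.velocity_lipschitz (T := t)
    (fun s hs => (hwder s hs.1).mono Icc_subset_Ici_self)
    (fun s hs => (hsol s hs.1).mono Icc_subset_Ici_self) ?_ ⟨ht, le_rfl⟩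
  funext i
  simp only [hw, h0, hH0]

lemma Admissible.eq_flow {H : ℝ → L2x B.x × L2x B.x} (hH : B.IsSolutionPM H) (hH0 : H 0 = F₀)
    {t : ℝ} (ht : 0 ≤ t) : H t = hB.flow hz F₀ t := by
  choose! V hV1 hV2 hV using hH
  have hder : ∀ s ∈ Icc 0 t, HasDerivWithinAt (fun s => H s - hB.flow hz F₀ s) 0 (Ici 0) s := by
    intro s hs
    have h1 := (hV s hs.1).sub (hB.hasDerivAt_flow hz (F₀ := F₀) s).hasDerivWithinAt
    have hws := hB.eval_eq_of_isSolutionPM hz hsol h0 hV1 hV2 hV hH0 hs.1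
    have e1 := hV1 s hs.1
    have e2 := hV2 s hs.1
    rw [hws, hB.opPos_eq] at e1
    rw [hws, hB.opNeg_eq] at e2
    have e : V s = (treeToL2 B.x ⟨B.partOp true (z s), hB.partOp_mem true (z s)⟩,
        treeToL2 B.x ⟨B.partOp false (z s), hB.partOp_mem false (z s)⟩) :=
      Prod.ext (eq_treeToL2 _ e1) (eq_treeToL2 _ e2)
    rw [e, sub_self] at h1
    exact h1
  have := constant_of_has_deriv_right_zero
    (fun s hs => (hder s hs).continuousWithinAt.mono Icc_subset_Ici_self)
    (fun s hs => (hder s (Ico_subset_Icc_self hs)).mono (Ici_subset_Ici.2 hs.1)) t ⟨ht, le_rfl⟩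
  rw [hB.flow_zero hz, hH0, sub_self] at this
  exact sub_eq_zero.1 this

omit hsol h0 in
lemma Admissible.flow_mem_treeConeL2 {t : ℝ} (ht : 0 ≤ t) :
    (F₀.1 ∈ treeConeL2 B.x → (hB.flow hz F₀ t).1 ∈ treeConeL2 B.x) ∧
    (F₀.2 ∈ treeConeL2 B.x → (hB.flow hz F₀ t).2 ∈ treeConeL2 B.x) := by
  constructor
  · rintro ⟨T, hT, hFT⟩
    refine ⟨T + B.partFlow true z t, add_mem_treeCone hT (hB.partFlow_mem_treeCone hz true ht), ?_⟩
    exact (Lp.coeFn_add _ _).trans (hFT.add (treeToL2_ae _))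
  · rintro ⟨T, hT, hFT⟩
    refine ⟨T + B.partFlow false z t, add_mem_treeCone hT (hB.partFlow_mem_treeCone hz false ht), ?_⟩
    exact (Lp.coeFn_add _ _).trans (hFT.add (treeToL2_ae _))

omit hsol h0 in
lemma Admissible.flow_sub_ae (t : ℝ) {G : Cube p → ℝ} (hG : (F₀.1 - F₀.2 : L2x B.x) =ᵐ[nuX B.x] G) :
    ((hB.flow hz F₀ t).1 - (hB.flow hz F₀ t).2 : L2x B.x) =ᵐ[nuX B.x]
      fun c => G c + (B.partFlow true z t c - B.partFlow false z t c) := by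
  have e : (hB.flow hz F₀ t).1 - (hB.flow hz F₀ t).2 = (F₀.1 - F₀.2) +
      (treeToL2 B.x ⟨B.partFlow true z t, hB.partFlow_mem hz true t⟩ -
        treeToL2 B.x ⟨B.partFlow false z t, hB.partFlow_mem hz false t⟩) := by
    simp only [flow]; abel
  rw [e]
  refine (Lp.coeFn_add _ _).trans (hG.add ((Lp.coeFn_sub _ _).trans ?_))
  exact (treeToL2_ae _).sub (treeToL2_ae _)

lemma Admissible.isTreeSolution_flow {T : Cube p → ℝ} (hT : T ∈ treeSpace p)
    (hFT : (F₀.1 - F₀.2 : L2x B.x) =ᵐ[nuX B.x] T) :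
    B.IsTreeSolution fun t c => T c + (B.partFlow true z t c - B.partFlow false z t c) := by
  intro t ht
  refine ⟨?_, hB.op_mem _, ?_⟩
  · exact (treeSubmodule p).add_mem hT
      ((treeSubmodule p).sub_mem (hB.partFlow_mem hz true t) (hB.partFlow_mem hz false t))
  · have hzt : (fun i => T (B.x i) +
        (B.partFlow true z t (B.x i) - B.partFlow false z t (B.x i))) = z t := by
      funext i
      rw [hB.trajectory_eq hz hsol ht, h0, eq_of_ae_eq_nuX hFT i]
      ring
    dsimp only
    rw [hzt]
    have hlim := (hB.tendsto_tvNorm_partFlow hz true t).add (hB.tendsto_tvNorm_partFlow hz false t)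
    rw [add_zero] at hlim
    refine squeeze_zero (fun _ => tvNorm_nonneg _) (fun s => ?_)
      (hlim.mono_left (nhdsWithin_mono t fun s hs => hs.2))
    refine le_trans (le_of_eq ?_) (tvNorm_sub_le (hB.partFlow_slope_mem hz true s t)
      (hB.partFlow_slope_mem hz false s t))
    congr 1
    funext c
    rw [hB.op_eq, Pi.sub_apply]
    ring

lemma Admissible.eq_of_isTreeSolution {G : ℝ → Cube p → ℝ} (hG : B.IsTreeSolution G)
    (hG0 : (F₀.1 - F₀.2 : L2x B.x) =ᵐ[nuX B.x] G 0) {t : ℝ} (ht : 0 ≤ t) (c : Cube p) :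
    G t c = G 0 c + (B.partFlow true z t c - B.partFlow false z t c) := by
  set w : ℝ → Fin n → ℝ := fun t i => G t (B.x i) with hw
  have hder : ∀ s ≥ 0, ∀ c, HasDerivWithinAt (fun s => G s c) (B.op (w s) c) (Ici 0) s := by
    intro s hs c
    rw [hasDerivWithinAt_iff_tendsto_slope, tendsto_iff_norm_sub_tendsto_zero]
    refine squeeze_zero' (Eventually.of_forall fun _ => norm_nonneg _) ?_ (hG s hs).2.2
    filter_upwards [self_mem_nhdsWithin] with r hr
    have hmem : (fun c => (G r c - G s c) / (r - s) - B.op (w s) c) ∈ treeSpace p := by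
      have := (treeSubmodule p).sub_mem ((treeSubmodule p).smul_mem (r - s)⁻¹
        ((treeSubmodule p).sub_mem (hG r hr.1).1 (hG s hs).1)) (hB.op_mem (w s))
      have e : (fun c => (G r c - G s c) / (r - s) - B.op (w s) c) =
          (r - s)⁻¹ • (G r - G s) - B.op (w s) := by
        funext c
        simp [div_eq_inv_mul]
      rwa [e]
    have := abs_le_tvNorm hmem c
    rwa [slope_def_field, Real.norm_eq_abs]
  have hwz : EqOn w z (Icc 0 t) := by
    refine eq_of_isSolution hB.velocity_lipschitz
      (fun s hs => hasDerivWithinAt_pi.2 fun i => (hder s hs.1 (B.x i)).mono Icc_subset_Ici_self)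
      (fun s hs => (hsol s hs.1).mono Icc_subset_Ici_self) ?_
    funext i
    rw [h0, hw]
    exact (eq_of_ae_eq_nuX hG0 i).symm
  have hder' : ∀ s ∈ Icc 0 t, HasDerivWithinAt
      (fun s => G s c - (B.partFlow true z s c - B.partFlow false z s c)) 0 (Ici 0) s := by
    intro s hs
    have h1 := (hder s hs.1 c).sub (((hB.hasDerivAt_partFlow_apply hz true s c).sub
      (hB.hasDerivAt_partFlow_apply hz false s c)).hasDerivWithinAt (s := Ici 0))
    have e : B.op (w s) c - (B.partOp true (z s) c - B.partOp false (z s) c) = 0 := by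
      rw [hwz hs, hB.op_eq, Pi.sub_apply, sub_self]
    rw [e] at h1
    exact h1
  have := constant_of_has_deriv_right_zero
    (fun s hs => (hder' s hs).continuousWithinAt.mono Icc_subset_Ici_self)
    (fun s hs => (hder' s (Ico_subset_Icc_self hs)).mono (Ici_subset_Ici.2 hs.1)) t ⟨ht, le_rfl⟩
  simp only [partFlow_zero, Pi.zero_apply, sub_self, sub_zero] at this
  linarith

end Flow

variable [NeZero K]

variable (B) in
/-- Existence and uniqueness for the system, and the equation in the space of tree functions. -/
theorem exists_unique_solution (hB : B.Admissible) (F₀ : L2x B.x × L2x B.x) :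
    ∃ F : ℝ → L2x B.x × L2x B.x,
      B.IsSolutionPM F ∧ F 0 = F₀ ∧
      (∀ H, B.IsSolutionPM H → H 0 = F₀ → ∀ t ≥ 0, H t = F t) ∧
      (F₀.1 ∈ treeConeL2 B.x → F₀.2 ∈ treeConeL2 B.x →
        (∀ t ≥ 0, (F t).1 ∈ treeConeL2 B.x ∧ (F t).2 ∈ treeConeL2 B.x) ∧
        (∃ G, B.IsTreeSolution G ∧ ∀ t ≥ 0, ((F t).1 - (F t).2 : L2x B.x) =ᵐ[nuX B.x] G t) ∧
        (∀ G, B.IsTreeSolution G → (F₀.1 - F₀.2 : L2x B.x) =ᵐ[nuX B.x] G 0 →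
          ∀ t ≥ 0, ((F t).1 - (F t).2 : L2x B.x) =ᵐ[nuX B.x] G t)) := by
  obtain ⟨z, hz, hz0, hsol⟩ := hB.exists_trajectory fun i => (F₀.1 - F₀.2 : L2x B.x) (B.x i)
  have h0 : ∀ i, z 0 i = (F₀.1 - F₀.2 : L2x B.x) (B.x i) := fun i => congrFun hz0 i
  refine ⟨hB.flow hz F₀, hB.isSolutionPM_flow hz hsol h0, hB.flow_zero hz,
    fun H hH hH0 t ht => hB.eq_flow hz hsol h0 hH hH0 ht, ?_⟩
  rintro hF1 hF2
  refine ⟨fun t ht => ⟨(hB.flow_mem_treeConeL2 hz ht).1 hF1, (hB.flow_mem_treeConeL2 hz ht).2 hF2⟩,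
    ?_, ?_⟩
  · obtain ⟨T, hT, hFT⟩ := hF1
    obtain ⟨T', hT', hFT'⟩ := hF2
    have hsub : (F₀.1 - F₀.2 : L2x B.x) =ᵐ[nuX B.x] T - T' :=
      (Lp.coeFn_sub _ _).trans (hFT.sub hFT')
    exact ⟨_, hB.isTreeSolution_flow hz hsol h0 ((treeSubmodule p).sub_mem
      (treeCone_subset_treeSpace hT) (treeCone_subset_treeSpace hT')) hsub,
      fun t _ => hB.flow_sub_ae hz t hsub⟩
  · intro G hG hG0 t ht
    rw [show G t = _ from funext (hB.eq_of_isTreeSolution hz hsol h0 hG hG0 ht)]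
    exact hB.flow_sub_ae hz t hG0

end BoostingData

end InfGB

end

noncomputable section

namespace InfGB

/-! ### Moments of martingales driven by independent variables -/

section Martingale

variable {Ω S : Type*} [MeasurableSpace Ω] [MeasurableSpace S] {P : Measure Ω}
  [IsProbabilityMeasure P] {σ : Measure S} [IsProbabilityMeasure σ] {ζ : ℕ → Ω → S}

/-- `G` depends on the first `m` steps of the path only. -/
def Adapted {α : Type*} (m : ℕ) (G : (ℕ → S) → α) : Prop :=
  ∀ w w', (∀ k < m, w k = w' k) → G w = G w'

lemma integral_adapted (hζ : ∀ m, Measurable (ζ m)) (hlaw : ∀ m, P.map (ζ m) = σ)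
    (hind : iIndepFun ζ P) {m : ℕ} {G : (ℕ → S) → S → ℝ} (hG : Measurable (Function.uncurry G))
    (hdep : Adapted m G) {C : ℝ} (hC : ∀ w s, |G w s| ≤ C) :
    ∫ ω, G (fun k => ζ k ω) (ζ m ω) ∂P = ∫ ω, ∫ s, G (fun k => ζ k ω) s ∂σ ∂P := by
  obtain ⟨s₀⟩ : Nonempty S := nonempty_of_isProbabilityMeasure σ
  let ext : (Finset.range m → S) → ℕ → S := fun a k => if h : k ∈ Finset.range m then a ⟨k, h⟩ else s₀
  have hext : Measurable ext := measurable_pi_lambda _ fun k => by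
    by_cases h : k ∈ Finset.range m
    · simpa only [ext, dif_pos h] using measurable_pi_apply _
    · simpa only [ext, dif_neg h] using measurable_const
  let W : Ω → ℕ → S := fun ω => ext fun k => ζ k ω
  have hW : Measurable W := hext.comp (measurable_pi_lambda _ fun k => hζ k)
  have hWG : ∀ ω, G (fun k => ζ k ω) = G (W ω) := fun ω => hdep _ _ fun k hk => by
    simp [W, ext, hk]
  have hWi : IndepFun W (ζ m) P := by
    have h := hind.indepFun_finset (Finset.range m) {m} (by simp) hζ
    exact h.comp (φ := ext) (ψ := fun b : (({m} : Finset ℕ) → S) => b ⟨m, by simp⟩) hext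
      (measurable_pi_apply _)
  have hmap := (indepFun_iff_map_prod_eq_prod_map_map hW.aemeasurable (hζ m).aemeasurable).1 hWi
  have : IsProbabilityMeasure (P.map W) := Measure.isProbabilityMeasure_map hW.aemeasurable
  simp_rw [hWG]
  calc ∫ ω, G (W ω) (ζ m ω) ∂P
      = ∫ q, Function.uncurry G q ∂(P.map fun ω => (W ω, ζ m ω)) :=
        (integral_map (hW.prodMk (hζ m)).aemeasurable hG.aestronglyMeasurable).symm
    _ = ∫ w, ∫ s, G w s ∂σ ∂(P.map W) := by
        rw [hmap, hlaw]
        refine integral_prod _ (Integrable.of_bound hG.aestronglyMeasurable C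
          (ae_of_all _ fun q => hC q.1 q.2))
    _ = _ := by
        rw [integral_map hW.aemeasurable]
        exact (hG.stronglyMeasurable.integral_prod_right).aestronglyMeasurable

/-- The partial sums of `g k`, evaluated along the path. -/
def pathSum (g : ℕ → (ℕ → S) → S → ℝ) (m : ℕ) (w : ℕ → S) : ℝ :=
  ∑ k ∈ Finset.range m, g k w (w k)

variable {g : ℕ → (ℕ → S) → S → ℝ}

omit [MeasurableSpace S] in
lemma adapted_pathSum (hdep : ∀ k, Adapted k (g k)) (m : ℕ) : Adapted m (pathSum g m) := by
  intro w w' h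
  refine Finset.sum_congr rfl fun k hk => ?_
  have hk := Finset.mem_range.1 hk
  rw [hdep k w w' fun j hj => h j (hj.trans hk), h k hk]

lemma measurable_pathSum (hg : ∀ k, Measurable (Function.uncurry (g k))) (m : ℕ) :
    Measurable (pathSum g m) :=
  Finset.measurable_sum _ fun k _ => (hg k).comp (measurable_id.prodMk (measurable_pi_apply k))

omit [MeasurableSpace S] in
lemma abs_pathSum_le {C : ℝ} (hC : ∀ k w s, |g k w s| ≤ C) (m : ℕ) (w : ℕ → S) :
    |pathSum g m w| ≤ m * C :=
  (Finset.abs_sum_le_sum_abs _ _).trans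
    ((Finset.sum_le_sum fun k _ => hC k w (w k)).trans_eq (by simp))

lemma integral_pathSum_pow_le (hζ : ∀ m, Measurable (ζ m)) (hlaw : ∀ m, P.map (ζ m) = σ)
    (hind : iIndepFun ζ P) (hg : ∀ k, Measurable (Function.uncurry (g k)))
    (hdep : ∀ k, Adapted k (g k)) {C : ℝ} (hC : ∀ k w s, |g k w s| ≤ C)
    (hmean : ∀ k w, ∫ s, g k w s ∂σ = 0) (m : ℕ) :
    ∫ ω, pathSum g m (fun k => ζ k ω) ^ 2 ∂P ≤ C ^ 2 * m ∧
      ∫ ω, pathSum g m (fun k => ζ k ω) ^ 4 ∂P ≤ 4 * C ^ 4 * m ^ 2 := by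
  have hζm : Measurable fun ω k => ζ k ω := measurable_pi_lambda _ hζ
  have hC0 : 0 ≤ C := by
    obtain ⟨s₀⟩ := nonempty_of_isProbabilityMeasure σ
    exact (abs_nonneg _).trans (hC 0 (fun _ => s₀) s₀)
  have hint : ∀ m j, Integrable (fun ω => pathSum g m (fun k => ζ k ω) ^ j) P := fun m j =>
    Integrable.of_bound (((measurable_pathSum hg m).comp hζm).pow_const j).aestronglyMeasurable
      ((m * C) ^ j) (ae_of_all _ fun ω => by
        rw [norm_pow]; exact pow_le_pow_left₀ (norm_nonneg _) (abs_pathSum_le hC m _) j)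
  have hgi : ∀ k w j, Integrable (fun s => g k w s ^ j) σ := fun k w j =>
    Integrable.of_bound (((hg k).comp measurable_prodMk_left).pow_const j).aestronglyMeasurable
      (C ^ j) (ae_of_all _ fun s => by
        rw [norm_pow]; exact pow_le_pow_left₀ (norm_nonneg _) (hC k w s) j)
  have hgj : ∀ k w j, ∫ s, g k w s ^ j ∂σ ≤ C ^ j := fun k w j => by
    have := norm_integral_le_of_norm_le_const (μ := σ) (C := C ^ j) (f := fun s => g k w s ^ j)
      (ae_of_all _ fun s => by
        rw [norm_pow]; exact pow_le_pow_left₀ (norm_nonneg _) (hC k w s) j)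
    rw [probReal_univ, mul_one] at this
    exact (le_abs_self _).trans this
  have hstep : ∀ m j, ∫ ω, pathSum g (m + 1) (fun k => ζ k ω) ^ j ∂P =
      ∫ ω, ∫ s, (pathSum g m (fun k => ζ k ω) + g m (fun k => ζ k ω) s) ^ j ∂σ ∂P := by
    intro m j
    refine Eq.trans ?_ (integral_adapted hζ hlaw hind (m := m) (C := (m * C + C) ^ j)
      (G := fun w s => (pathSum g m w + g m w s) ^ j)
      ((((measurable_pathSum hg m).comp measurable_fst).add (hg m)).pow_const j)
      (fun w w' h => ?_) fun w s => ?_)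
    · simp only [pathSum, Finset.sum_range_succ]
    · funext s; simp only [adapted_pathSum hdep m w w' h, hdep m w w' h]
    · rw [abs_pow]
      exact pow_le_pow_left₀ (abs_nonneg _) ((abs_add_le _ _).trans
        (add_le_add (abs_pathSum_le hC m w) (hC m w s))) j
  have hinner : ∀ m j, Integrable (fun ω => ∫ s,
      (pathSum g m (fun k => ζ k ω) + g m (fun k => ζ k ω) s) ^ j ∂σ) P := by
    intro m j
    have hm : Measurable (Function.uncurry fun (w : ℕ → S) s => (pathSum g m w + g m w s) ^ j) :=
      (((measurable_pathSum hg m).comp measurable_fst).add (hg m)).pow_const j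
    refine Integrable.of_bound ((hm.stronglyMeasurable.integral_prod_right).measurable.comp
      hζm).aestronglyMeasurable ((m * C + C) ^ j) (ae_of_all _ fun ω => ?_)
    have := norm_integral_le_of_norm_le_const (μ := σ) (C := (m * C + C) ^ j)
      (f := fun s => (pathSum g m (fun k => ζ k ω) + g m (fun k => ζ k ω) s) ^ j)
      (ae_of_all _ fun s => by
        rw [norm_pow]
        exact pow_le_pow_left₀ (norm_nonneg _) ((abs_add_le _ _).trans
          (add_le_add (abs_pathSum_le hC m _) (hC m _ s))) j)
    rwa [probReal_univ, mul_one] at this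
  have h2 : ∀ m : ℕ, ∫ ω, pathSum g m (fun k => ζ k ω) ^ 2 ∂P ≤ C ^ 2 * m := by
    intro m
    induction m with
    | zero => simp [pathSum]
    | succ m ih =>
      rw [hstep]
      refine (integral_mono (hinner m 2) ((hint m 2).add (integrable_const (C ^ 2)))
        fun ω => ?_).trans ?_
      · have e : ∀ s, (pathSum g m (fun k => ζ k ω) + g m (fun k => ζ k ω) s) ^ 2 =
            pathSum g m (fun k => ζ k ω) ^ 2 + 2 * pathSum g m (fun k => ζ k ω) *
              g m (fun k => ζ k ω) s + g m (fun k => ζ k ω) s ^ 2 := fun s => by ring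
        have i1 : Integrable (fun s => g m (fun k => ζ k ω) s) σ := by simpa using hgi m _ 1
        have i3 : Integrable (fun s => pathSum g m (fun k => ζ k ω) ^ 2 +
            2 * pathSum g m (fun k => ζ k ω) * g m (fun k => ζ k ω) s) σ :=
          (integrable_const _).add (i1.const_mul _)
        simp only [e]
        rw [integral_add i3 (hgi m _ 2),
          integral_add (integrable_const _) (i1.const_mul _), integral_const_mul, hmean]
        simpa using hgj m _ 2
      · simp only [Pi.add_apply]
        rw [integral_add (hint m 2) (integrable_const _)]
        simp only [integral_const, probReal_univ, smul_eq_mul, one_mul]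
        push_cast
        linarith
  refine ⟨h2 m, ?_⟩
  induction m with
  | zero => simp [pathSum]
  | succ m ih =>
    rw [hstep]
    refine (integral_mono (hinner m 4) (((hint m 4).add ((hint m 2).const_mul (8 * C ^ 2))).add
      (integrable_const (3 * C ^ 4))) fun ω => ?_).trans ?_
    · have i1 : Integrable (fun s => g m (fun k => ζ k ω) s) σ := by simpa using hgi m _ 1
      set M := pathSum g m (fun k => ζ k ω)
      have e : ∀ s, (M + g m (fun k => ζ k ω) s) ^ 4 ≤ M ^ 4 + 4 * M ^ 3 * g m (fun k => ζ k ω) s +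
          8 * M ^ 2 * g m (fun k => ζ k ω) s ^ 2 + 3 * g m (fun k => ζ k ω) s ^ 4 := fun s => by
        nlinarith [mul_nonneg (sq_nonneg (g m (fun k => ζ k ω) s))
          (sq_nonneg (M - g m (fun k => ζ k ω) s))]
      have i3 : Integrable (fun s => M ^ 4 + 4 * M ^ 3 * g m (fun k => ζ k ω) s) σ :=
        (integrable_const _).add (i1.const_mul _)
      have i4 : Integrable (fun s => M ^ 4 + 4 * M ^ 3 * g m (fun k => ζ k ω) s +
          8 * M ^ 2 * g m (fun k => ζ k ω) s ^ 2) σ :=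
        i3.add ((hgi m (fun k => ζ k ω) 2).const_mul (8 * M ^ 2))
      have i5 := (hgi m (fun k => ζ k ω) 4).const_mul 3
      refine (integral_mono_of_nonneg (ae_of_all _ fun s => Even.pow_nonneg (by decide) _) (i4.add i5)
        (ae_of_all _ e)).trans ?_
      simp only [Pi.add_apply]
      rw [integral_add i4 i5, integral_add i3 ((hgi m _ 2).const_mul _),
          integral_add (integrable_const _) (i1.const_mul _), integral_const_mul, hmean,
          integral_const_mul, integral_const_mul]
      have q2 := mul_le_mul_of_nonneg_left (hgj m (fun k => ζ k ω) 2)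
        (show 0 ≤ 8 * M ^ 2 by positivity)
      have q4 := hgj m (fun k => ζ k ω) 4
      simp only [integral_const, probReal_univ, smul_eq_mul, one_mul]
      linarith
    · simp only [Pi.add_apply]
      have i4 : Integrable (fun ω => pathSum g m (fun k => ζ k ω) ^ 4 +
          8 * C ^ 2 * pathSum g m (fun k => ζ k ω) ^ 2) P :=
        (hint m 4).add ((hint m 2).const_mul _)
      rw [integral_add i4 (integrable_const _), integral_add (hint m 4) ((hint m 2).const_mul _), integral_const_mul]
      simp only [integral_const, probReal_univ, smul_eq_mul, one_mul]
      have q := mul_le_mul_of_nonneg_left (h2 m) (show 0 ≤ 8 * C ^ 2 by positivity)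
      push_cast
      nlinarith [show 0 ≤ C ^ 4 by positivity]

end Martingale

end InfGB

end

noncomputable section

namespace InfGB

/-! ### Chains driven by independent variables and their fluid limit -/

section MeanSquare

variable {Ω S Γ : Type*} [MeasurableSpace Ω] [MeasurableSpace S] [MeasurableSpace Γ]
  {P : Measure Ω} [IsProbabilityMeasure P] {σ : Measure S} [IsProbabilityMeasure σ]
  {ν : Measure Γ} [IsProbabilityMeasure ν] {ζ : ℕ → Ω → S} {g : ℕ → (ℕ → S) → S → Γ → ℝ}

lemma measurable_pathSum_prod (hg : ∀ k, Measurable fun q : (ℕ → S) × S × Γ => g k q.1 q.2.1 q.2.2)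
    (m : ℕ) : Measurable fun q : (ℕ → S) × Γ => pathSum (fun k w s => g k w s q.2) m q.1 :=
  Finset.measurable_sum _ fun k _ => (hg k).comp
    (measurable_fst.prodMk (((measurable_pi_apply k).comp measurable_fst).prodMk measurable_snd))

lemma measureReal_integral_pathSum_sq_le (hζ : ∀ m, Measurable (ζ m))
    (hlaw : ∀ m, P.map (ζ m) = σ) (hind : iIndepFun ζ P)
    (hg : ∀ k, Measurable fun q : (ℕ → S) × S × Γ => g k q.1 q.2.1 q.2.2)
    (hdep : ∀ k, Adapted k (g k)) {C : ℝ} (hC : ∀ k w s c, |g k w s c| ≤ C)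
    (hmean : ∀ k w c, ∫ s, g k w s c ∂σ = 0) {η : ℝ} (hη : 0 < η) (m : ℕ) :
    P.real {ω | η ≤ ∫ c, pathSum (fun k w s => g k w s c) m (fun k => ζ k ω) ^ 2 ∂ν} ≤
      4 * C ^ 4 * m ^ 2 / η ^ 2 := by
  have hζm : Measurable fun ω k => ζ k ω := measurable_pi_lambda _ hζ
  have hmeas : Measurable fun q : Ω × Γ =>
      pathSum (fun k w s => g k w s q.2) m (fun k => ζ k q.1) :=
    (measurable_pathSum_prod hg m).comp ((hζm.comp measurable_fst).prodMk measurable_snd)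
  have hbound : ∀ c w, |pathSum (fun k w s => g k w s c) m w| ≤ m * C := fun c w =>
    abs_pathSum_le (fun k w s => hC k w s c) m w
  have hpow : ∀ j c w, ‖pathSum (fun k w s => g k w s c) m w ^ j‖ ≤ (m * C) ^ j := fun j c w => by
    rw [norm_pow]; exact pow_le_pow_left₀ (norm_nonneg _) (hbound c w) j
  have hint : ∀ j ω, Integrable (fun c =>
      pathSum (fun k w s => g k w s c) m (fun k => ζ k ω) ^ j) ν := fun j ω =>
    Integrable.of_bound ((hmeas.comp measurable_prodMk_left).pow_const j).aestronglyMeasurable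
      _ (ae_of_all _ fun c => hpow j c _)
  have hprod : Integrable (fun q : Ω × Γ =>
      pathSum (fun k w s => g k w s q.2) m (fun k => ζ k q.1) ^ 4) (P.prod ν) :=
    Integrable.of_bound (hmeas.pow_const 4).aestronglyMeasurable _ (ae_of_all _ fun q => hpow 4 _ _)
  have h4 : ∫ ω, ∫ c, pathSum (fun k w s => g k w s c) m (fun k => ζ k ω) ^ 4 ∂ν ∂P ≤
      4 * C ^ 4 * m ^ 2 := by
    rw [integral_integral_swap hprod]
    refine (integral_mono hprod.integral_prod_right (integrable_const (4 * C ^ 4 * (m : ℝ) ^ 2))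
      fun c => ?_).trans_eq (by simp)
    refine (integral_pathSum_pow_le (g := fun k w s => g k w s c) hζ hlaw hind (fun k => ?_)
      (fun k w w' h => ?_) (fun k w s => hC k w s c) (fun k w => hmean k w c) m).2
    · exact (hg k).comp (measurable_fst.prodMk (measurable_snd.prodMk measurable_const))
    · funext s; simp only [hdep k w w' h]
  have hsub : {ω | η ≤ ∫ c, pathSum (fun k w s => g k w s c) m (fun k => ζ k ω) ^ 2 ∂ν} ⊆
      {ω | η ^ 2 ≤ ∫ c, pathSum (fun k w s => g k w s c) m (fun k => ζ k ω) ^ 4 ∂ν} := by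
    intro ω hω
    have h : ∫ c, 2 * η * pathSum (fun k w s => g k w s c) m (fun k => ζ k ω) ^ 2 ∂ν ≤
        ∫ c, (pathSum (fun k w s => g k w s c) m (fun k => ζ k ω) ^ 4 + η ^ 2) ∂ν := by
      refine integral_mono ((hint 2 ω).const_mul _) ((hint 4 ω).add (integrable_const _))
        fun c => ?_
      simp only
      nlinarith [sq_nonneg (pathSum (fun k w s => g k w s c) m (fun k => ζ k ω) ^ 2 - η)]
    rw [integral_const_mul, integral_add (hint 4 ω) (integrable_const _)] at h
    simp only [integral_const, probReal_univ, smul_eq_mul, one_mul] at h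
    rw [mem_ofPred_eq] at hω ⊢
    nlinarith
  rw [le_div_iff₀ (by positivity), mul_comm]
  refine (mul_le_mul_of_nonneg_left (measureReal_mono hsub) (by positivity)).trans ?_
  exact (mul_meas_ge_le_integral_of_nonneg
    (ae_of_all _ fun ω => integral_nonneg fun c => Even.pow_nonneg (by decide) _)
    hprod.integral_prod_left _).trans h4

end MeanSquare

section Chain

variable {n : ℕ} {S Γ : Type*} (T : Bool → (Fin n → ℝ) → S → Γ → ℝ) (x : Fin n → Γ)
  (F₀ : Bool → Γ → ℝ) (lam : ℝ)

/-- The pair of functions obtained after `m` steps of size `lam`, driven by the path `w`. -/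
def pathChain (w : ℕ → S) : ℕ → Bool → Γ → ℝ
  | 0 => F₀
  | m + 1 => fun e c => pathChain w m e c +
      lam * T e (fun i => pathChain w m true (x i) - pathChain w m false (x i)) (w m) c

/-- The values of the chain at the data points. -/
def pathState (m : ℕ) (w : ℕ → S) (i : Fin n) : ℝ :=
  pathChain T x F₀ lam w m true (x i) - pathChain T x F₀ lam w m false (x i)

lemma pathChain_succ (w : ℕ → S) (m : ℕ) (e : Bool) (c : Γ) :
    pathChain T x F₀ lam w (m + 1) e c = pathChain T x F₀ lam w m e c +
      lam * T e (pathState T x F₀ lam m w) (w m) c := rfl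

lemma adapted_pathChain (m : ℕ) : Adapted m fun w : ℕ → S => pathChain T x F₀ lam w m := by
  induction m with
  | zero => intro w w' _; rfl
  | succ m ih =>
    intro w w' h
    have := ih w w' fun k hk => h k (hk.trans (Nat.lt_succ_self m))
    funext e c
    simp only at this ⊢
    rw [pathChain_succ, pathChain_succ, this, h m (Nat.lt_succ_self m)]
    unfold pathState
    rw [this]

lemma adapted_pathState (m : ℕ) : Adapted m fun w : ℕ → S => pathState T x F₀ lam m w := by
  intro w w' h
  have := adapted_pathChain T x F₀ lam m w w' h
  simp only at this
  funext i
  simp only [pathState, this]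

variable {T x F₀ lam}

/-- Chains with kernels that agree at the visited states are equal. -/
lemma pathChain_congr {T' : Bool → (Fin n → ℝ) → S → Γ → ℝ} {w : ℕ → S} {m : ℕ}
    (h : ∀ k < m, ∀ e, T e (pathState T x F₀ lam k w) = T' e (pathState T x F₀ lam k w)) :
    pathChain T' x F₀ lam w m = pathChain T x F₀ lam w m := by
  induction m with
  | zero => rfl
  | succ m ih =>
    have := ih fun k hk => h k (hk.trans (Nat.lt_succ_self m))
    funext e c
    have h1 : pathState T' x F₀ lam m w = pathState T x F₀ lam m w := by
      funext i; simp only [pathState, this]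
    rw [pathChain_succ, pathChain_succ, this, h1, h m (Nat.lt_succ_self m)]

section Measurable

variable [MeasurableSpace S] [MeasurableSpace Γ]

lemma measurable_pathChain
    (hT : ∀ e, Measurable fun q : (Fin n → ℝ) × S × Γ => T e q.1 q.2.1 q.2.2)
    (hF₀ : ∀ e, Measurable (F₀ e)) (m : ℕ) (e : Bool) :
    Measurable fun q : (ℕ → S) × Γ => pathChain T x F₀ lam q.1 m e q.2 := by
  induction m generalizing e with
  | zero => exact (hF₀ e).comp measurable_snd
  | succ m ih =>
    have hs : Measurable fun (q : (ℕ → S) × Γ) (i : Fin n) =>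
        pathChain T x F₀ lam q.1 m true (x i) - pathChain T x F₀ lam q.1 m false (x i) :=
      measurable_pi_lambda _ fun i =>
        ((ih true).comp (measurable_fst.prodMk measurable_const)).sub
          ((ih false).comp (measurable_fst.prodMk measurable_const))
    exact (ih e).add (((hT e).comp (hs.prodMk
      (((measurable_pi_apply m).comp measurable_fst).prodMk measurable_snd))).const_mul lam)

lemma measurable_pathState
    (hT : ∀ e, Measurable fun q : (Fin n → ℝ) × S × Γ => T e q.1 q.2.1 q.2.2)
    (hF₀ : ∀ e, Measurable (F₀ e)) (m : ℕ) : Measurable (pathState T x F₀ lam m) :=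
  measurable_pi_lambda _ fun _ =>
    ((measurable_pathChain hT hF₀ m true).comp (measurable_id.prodMk measurable_const)).sub
      ((measurable_pathChain hT hF₀ m false).comp (measurable_id.prodMk measurable_const))

end Measurable

section FluidLimit

/-- The difference of the increment of the chain and its conditional mean. -/
def noise (T : Bool → (Fin n → ℝ) → S → Γ → ℝ) (x : Fin n → Γ) (F₀ : Bool → Γ → ℝ) (lam : ℝ)
    (U : Bool → (Fin n → ℝ) → Γ → ℝ) (e : Bool) (k : ℕ) (w : ℕ → S) (s : S) (c : Γ) : ℝ :=
  T e (pathState T x F₀ lam k w) s c - U e (pathState T x F₀ lam k w) c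

variable {U : Bool → (Fin n → ℝ) → Γ → ℝ} {Φ : Bool → ℝ → Γ → ℝ} {z : ℝ → Fin n → ℝ}
  {L C a tmax : ℝ} {N : ℕ}

lemma abs_flow_sub_le (hUC : ∀ e z c, |U e z c| ≤ C)
    (hΦ : ∀ e c, ∀ t ∈ Icc 0 tmax, HasDerivAt (fun t => Φ e t c) (U e (z t) c) t)
    {s t : ℝ} (hs : s ∈ Icc 0 tmax) (ht : t ∈ Icc 0 tmax) (e : Bool) (c : Γ) :
    |Φ e t c - Φ e s c| ≤ C * |t - s| :=
  (convex_Icc 0 tmax).norm_image_sub_le_of_norm_hasDerivWithin_le (f := fun t => Φ e t c)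
    (fun r hr => (hΦ e c r hr).hasDerivWithinAt) (fun r _ => hUC e (z r) c) hs ht

/-- A discrete Gronwall estimate for the distance of the chain to the fluid limit. -/
lemma abs_pathChain_sub_le (hL : 0 ≤ L) (hlam : 0 ≤ lam)
    (hU : ∀ e z z' c, |U e z c - U e z' c| ≤ L * ‖z - z'‖) (hUC : ∀ e z c, |U e z c| ≤ C)
    (hC : 0 ≤ C) (hΦ0 : ∀ e c, Φ e 0 c = 0)
    (hΦ : ∀ e c, ∀ t ∈ Icc 0 tmax, HasDerivAt (fun t => Φ e t c) (U e (z t) c) t)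
    (hz : ∀ t ∈ Icc 0 tmax, ∀ i,
      z t i = F₀ true (x i) - F₀ false (x i) + Φ true t (x i) - Φ false t (x i))
    (hN : N * lam ≤ tmax) {w : ℕ → S} (ha0 : 0 ≤ a)
    (ha : ∀ m ≤ N, ∀ e i, |lam * pathSum (fun k w s => noise T x F₀ lam U e k w s (x i)) m w| ≤ a)
    {m : ℕ} (hm : m ≤ N) :
    (∀ e c, |pathChain T x F₀ lam w m e c - F₀ e c - Φ e (m * lam) c -
      lam * pathSum (fun k w s => noise T x F₀ lam U e k w s c) m w| ≤
        (a + C * lam) * ((1 + 2 * L * lam) ^ m - 1)) ∧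
    ‖pathState T x F₀ lam m w - z (m * lam)‖ ≤ 2 * (a + C * lam) * (1 + 2 * L * lam) ^ m := by
  have hCl : 0 ≤ C * lam := mul_nonneg hC hlam
  have hmem : ∀ m ≤ N, (m : ℝ) * lam ∈ Icc 0 tmax := fun m hm =>
    ⟨by positivity, (mul_le_mul_of_nonneg_right (Nat.cast_le.2 hm) hlam).trans hN⟩
  have hstate : ∀ m ≤ N, (∀ e c, |pathChain T x F₀ lam w m e c - F₀ e c - Φ e (m * lam) c -
      lam * pathSum (fun k w s => noise T x F₀ lam U e k w s c) m w| ≤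
        (a + C * lam) * ((1 + 2 * L * lam) ^ m - 1)) →
      ‖pathState T x F₀ lam m w - z (m * lam)‖ ≤
        2 * (a + C * lam) * (1 + 2 * L * lam) ^ m - 2 * (C * lam) := by
    intro m hm h
    have h5 : 1 ≤ (1 + 2 * L * lam) ^ m := one_le_pow₀ (by nlinarith [mul_nonneg hL hlam])
    have h0 : 0 ≤ 2 * (a + C * lam) * (1 + 2 * L * lam) ^ m - 2 * (C * lam) := by nlinarith
    refine (pi_norm_le_iff_of_nonneg h0).2 fun i => ?_
    have h1 := abs_le.1 (h true (x i))
    have h2 := abs_le.1 (h false (x i))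
    have h3 := abs_le.1 (ha m hm true i)
    have h4 := abs_le.1 (ha m hm false i)
    rw [Pi.sub_apply, hz _ (hmem m hm), pathState, Real.norm_eq_abs, abs_le]
    constructor <;> linarith
  have hsup : ∀ s ∈ Icc 0 tmax, ∀ t ∈ Icc 0 tmax, ‖z t - z s‖ ≤ 2 * C * |t - s| := by
    intro s hs t ht
    refine (pi_norm_le_iff_of_nonneg (by positivity)).2 fun i => ?_
    have h1 := abs_le.1 (abs_flow_sub_le hUC hΦ hs ht true (x i))
    have h2 := abs_le.1 (abs_flow_sub_le hUC hΦ hs ht false (x i))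
    rw [Pi.sub_apply, hz t ht, hz s hs, Real.norm_eq_abs, abs_le]
    constructor <;> linarith
  suffices h : ∀ m ≤ N, ∀ e c, |pathChain T x F₀ lam w m e c - F₀ e c - Φ e (m * lam) c -
      lam * pathSum (fun k w s => noise T x F₀ lam U e k w s c) m w| ≤
        (a + C * lam) * ((1 + 2 * L * lam) ^ m - 1) from
    ⟨h m hm, (hstate m hm (h m hm)).trans (sub_le_self _ (by positivity))⟩
  clear hm m
  intro m
  induction m with
  | zero => intro _ e c; simp [pathChain, hΦ0, pathSum]
  | succ m ih =>
    intro hm e c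
    have hm' : m ≤ N := (Nat.le_succ m).trans hm
    have hD := hstate m hm' (ih hm')
    have h0 := hmem m hm'
    have h1 := hmem (m + 1) hm
    have e1 : ((m + 1 : ℕ) : ℝ) * lam - m * lam = lam := by push_cast; ring
    set D := pathState T x F₀ lam m w with hDdef
    have hinc : |Φ e ((m + 1 : ℕ) * lam) c - Φ e (m * lam) c - lam * U e D c| ≤
        2 * L * lam * (a + C * lam) * (1 + 2 * L * lam) ^ m := by
      have := (convex_Icc ((m : ℝ) * lam) ((m + 1 : ℕ) * lam)).norm_image_sub_le_of_norm_hasDerivWithin_le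
        (f := fun t => Φ e t c - t * U e D c) (f' := fun t => U e (z t) c - 1 * U e D c)
        (C := L * (2 * (a + C * lam) * (1 + 2 * L * lam) ^ m))
        (x := m * lam) (y := (m + 1 : ℕ) * lam)
        (fun r hr => ((hΦ e c r ⟨h0.1.trans hr.1, hr.2.trans h1.2⟩).sub
          ((hasDerivAt_id r).mul_const _)).hasDerivWithinAt)
        (fun r hr => ?_) ⟨le_rfl, by linarith⟩ ⟨by linarith, le_rfl⟩
      · rw [Real.norm_eq_abs, Real.norm_eq_abs, e1, abs_of_nonneg hlam] at this
        convert this using 1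
        · congr 1
          linear_combination (U e D c) * e1
        · ring
      · rw [one_mul]
        refine (hU e (z r) D c).trans (mul_le_mul_of_nonneg_left ?_ hL)
        have hr1 := hsup _ h0 r ⟨h0.1.trans hr.1, hr.2.trans h1.2⟩
        have hr2 : |r - m * lam| ≤ lam := by
          rw [abs_of_nonneg (by linarith [hr.1])]; linarith [hr.2]
        have hr3 : ‖z r - D‖ ≤ ‖z r - z (m * lam)‖ + ‖D - z (m * lam)‖ := by
          rw [norm_sub_rev D]; exact norm_sub_le_norm_sub_add_norm_sub _ _ _
        have hr4 := mul_le_mul_of_nonneg_left hr2 (show 0 ≤ 2 * C by positivity)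
        linarith
    have hsum : pathSum (fun k w s => noise T x F₀ lam U e k w s c) (m + 1) w =
        pathSum (fun k w s => noise T x F₀ lam U e k w s c) m w + (T e D (w m) c - U e D c) := by
      rw [pathSum, Finset.sum_range_succ]; rfl
    rw [pathChain_succ, hsum, ← hDdef]
    have h2 := abs_le.1 (ih hm' e c)
    have h3 := abs_le.1 hinc
    have h7 : (a + C * lam) * ((1 + 2 * L * lam) ^ (m + 1) - 1) =
        (a + C * lam) * ((1 + 2 * L * lam) ^ m - 1) +
          2 * L * lam * (a + C * lam) * (1 + 2 * L * lam) ^ m := by ring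
    rw [h7, abs_le]
    constructor <;> linarith

end FluidLimit

end Chain

end InfGB

end

noncomputable section

namespace InfGB

/-! ### Step paths and convergence in distribution in the Skorokhod space -/

section Skorokhod

variable {E : Type*} [PseudoMetricSpace E]

/-- The path that takes the value `a m` on `[m l, (m + 1) l)`. -/
def stepPath {l : ℝ} (hl : 0 < l) (a : ℕ → E) : CadlagPath E where
  toFun t := a ⌊(t : ℝ) / l⌋₊
  right_continuous t := by
    refine (continuousWithinAt_const (b := a ⌊(t : ℝ) / l⌋₊)).congr_of_eventuallyEq ?_ rfl
    have h : (t : ℝ) < (⌊(t : ℝ) / l⌋₊ + 1) * l := by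
      rw [← div_lt_iff₀ hl]; exact Nat.lt_floor_add_one _
    filter_upwards [self_mem_nhdsWithin, nhdsWithin_le_nhds
      ((continuous_subtype_val.tendsto t).eventually_lt_const h)] with s hs hs'
    congr 1
    rw [Nat.floor_eq_iff (by positivity), ← div_lt_iff₀ hl] at *
    exact ⟨(Nat.floor_le (by positivity)).trans
      (div_le_div_of_nonneg_right (NNReal.coe_le_coe.2 hs) hl.le), hs'⟩
  left_limit t := by
    rcases eq_or_ne t 0 with rfl | ht
    · exact ⟨a 0, by rw [show Iio (0 : ℝ≥0) = ∅ from by ext; simp, nhdsWithin_empty]; exact tendsto_bot⟩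
    have htl : 0 < (t : ℝ) / l := div_pos (NNReal.coe_pos.2 (pos_iff_ne_zero.2 ht)) hl
    have hc : 0 < ⌈(t : ℝ) / l⌉₊ := Nat.ceil_pos.2 htl
    refine ⟨a (⌈(t : ℝ) / l⌉₊ - 1), tendsto_const_nhds.congr' ?_⟩
    have h : ((⌈(t : ℝ) / l⌉₊ - 1 : ℕ) : ℝ) * l < t := by
      rw [← lt_div_iff₀ hl]
      exact Nat.lt_ceil.1 (Nat.sub_lt hc one_pos)
    filter_upwards [self_mem_nhdsWithin, nhdsWithin_le_nhds
      ((continuous_subtype_val.tendsto t).eventually_const_lt h)] with s hs hs'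
    congr 1
    symm
    rw [Nat.floor_eq_iff (by positivity), le_div_iff₀ hl]
    refine ⟨hs'.le, ?_⟩
    have h1 : ((⌈(t : ℝ) / l⌉₊ - 1 : ℕ) : ℝ) + 1 = ⌈(t : ℝ) / l⌉₊ := by
      exact_mod_cast Nat.sub_add_cancel hc
    rw [h1]
    exact (div_lt_div_of_pos_right (NNReal.coe_lt_coe.2 hs) hl).trans_le (Nat.le_ceil _)

lemma stepPath_apply {l : ℝ} (hl : 0 < l) (a : ℕ → E) (t : ℝ≥0) :
    stepPath hl a t = a ⌊(t : ℝ) / l⌋₊ := rfl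

lemma mem_j1Nbhd_of_dist_lt {f g : CadlagPath E} {T : ℝ≥0} {ε : ℝ} (hε : 0 < ε)
    (h : ∀ t ≤ T, dist (g t) (f t) < ε) : g ∈ j1Nbhd f T ε :=
  ⟨OrderIso.refl _, fun t ht => ⟨by simpa using hε, h t ht⟩⟩

lemma continuous_stepPath {l : ℝ} (hl : 0 < l) : Continuous (stepPath (E := E) hl) := by
  refine continuous_def.2 fun U hU => isOpen_iff_mem_nhds.2 fun a ha => ?_
  obtain ⟨T, ε, hε, hsub⟩ := hU _ ha
  have h : ∀ᶠ b in 𝓝 a, ∀ k ∈ Finset.range (⌊(T : ℝ) / l⌋₊ + 1), dist (b k) (a k) < ε :=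
    (Finset.eventually_all _).2 fun k _ =>
      (continuous_apply k).continuousAt.eventually (Metric.ball_mem_nhds (a k) hε)
  filter_upwards [h] with b hb
  refine hsub (mem_j1Nbhd_of_dist_lt hε fun t ht => hb _ (Finset.mem_range.2
    (Nat.lt_succ_of_le (Nat.floor_le_floor
      (div_le_div_of_nonneg_right (NNReal.coe_le_coe.2 ht) hl.le)))))

lemma measurable_of_measurable_edist {α F : Type*} [MeasurableSpace α] [PseudoEMetricSpace F]
    [SecondCountableTopology F] [MeasurableSpace F] [BorelSpace F] {f : α → F}
    (h : ∀ y, Measurable fun a => edist (f a) y) : Measurable f := by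
  refine measurable_of_isOpen fun U hU => ?_
  choose! r hr hrU using fun y (hy : y ∈ U) => EMetric.isOpen_iff.1 hU y hy
  obtain ⟨I, hIU, hI, hIeq⟩ := TopologicalSpace.isOpen_biUnion_countable U
    (fun y => Metric.eball y (r y)) fun y _ => Metric.isOpen_eball
  have hU' : U = ⋃ y ∈ I, Metric.eball y (r y) := by
    rw [hIeq]
    exact Subset.antisymm (fun y hy => mem_iUnion₂.2 ⟨y, hy, Metric.mem_eball_self (hr y hy)⟩)
      (iUnion₂_subset hrU)
  rw [hU', preimage_iUnion₂]
  exact .biUnion hI fun y _ => measurableSet_lt (h y) measurable_const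

lemma measurable_stepPath [SecondCountableTopology E] {Ω : Type*} [MeasurableSpace Ω] {l : ℝ}
    (hl : 0 < l) {A : Ω → ℕ → E} (hA : ∀ m y, Measurable fun ω => edist (A ω m) y) :
    Measurable fun ω => stepPath hl (A ω) := by
  borelize E
  exact (continuous_stepPath hl).measurable.comp
    (measurable_pi_lambda _ fun m => measurable_of_measurable_edist (hA m))

lemma tendstoInDistribution_of_tendsto_j1Nbhd {ι : Type*} {F : Filter ι} {Ω : ι → Type*}
    [∀ i, MeasurableSpace (Ω i)] {P : ∀ i, Measure (Ω i)} [∀ i, IsProbabilityMeasure (P i)]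
    {X : ∀ i, Ω i → CadlagPath E} {Z : CadlagPath E} (hX : ∀ i, Measurable (X i))
    (h : ∀ T ε, 0 < ε → Tendsto (fun i => (P i).real {ω | X i ω ∉ j1Nbhd Z T ε}) F (𝓝 0)) :
    TendstoInDistribution X F (fun _ : Unit => Z) P (Measure.dirac ()) := by
  refine ⟨fun i => (hX i).aemeasurable, measurable_const.aemeasurable,
    ProbabilityMeasure.tendsto_iff_forall_integral_tendsto.2 fun f => ?_⟩
  have hf : Measurable f := f.continuous.measurable
  simp only [ProbabilityMeasure.coe_mk]
  simp_rw [fun i => integral_map (hX i).aemeasurable (μ := P i) hf.aestronglyMeasurable]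
  rw [integral_map measurable_const.aemeasurable hf.aestronglyMeasurable, integral_const,
    probReal_univ, one_smul]
  rw [Metric.tendsto_nhds]
  intro η hη
  have hU : IsOpen {g : CadlagPath E | |f g - f Z| < η / 2} :=
    isOpen_lt (by fun_prop) continuous_const
  obtain ⟨T, ε, hε, hsub⟩ := hU Z (by simpa using hη)
  have hev : ∀ᶠ i in F, (P i).real {ω | X i ω ∉ j1Nbhd Z T ε} * (2 * ‖f‖) < η / 2 :=
    ((h T ε hε).mul_const (2 * ‖f‖)).eventually_lt_const (by simpa using hη)
  filter_upwards [hev] with i hi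
  have hfX : Measurable fun ω => f (X i ω) := hf.comp (hX i)
  have hint : Integrable (fun ω => f (X i ω)) (P i) :=
    Integrable.of_bound hfX.aestronglyMeasurable ‖f‖ (ae_of_all _ fun ω => f.norm_coe_le_norm _)
  have hbad : MeasurableSet {ω | η / 2 ≤ |f (X i ω) - f Z|} :=
    measurableSet_le measurable_const ((hfX.sub_const _).abs)
  calc dist (∫ ω, f (X i ω) ∂P i) (f Z) = |∫ ω, (f (X i ω) - f Z) ∂P i| := by
        rw [integral_sub hint (integrable_const _), integral_const, probReal_univ, one_smul,
          Real.dist_eq]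
    _ ≤ ∫ ω, |f (X i ω) - f Z| ∂P i := abs_integral_le_integral_abs
    _ ≤ ∫ ω, (η / 2 + {ω | η / 2 ≤ |f (X i ω) - f Z|}.indicator (fun _ => 2 * ‖f‖) ω) ∂P i := by
        refine integral_mono (hint.sub (integrable_const _)).abs
          ((integrable_const _).add ((integrable_const _).indicator hbad)) fun ω => ?_
        by_cases hω : η / 2 ≤ |f (X i ω) - f Z|
        · simp only [indicator_of_mem (s := {ω | η / 2 ≤ |f (X i ω) - f Z|}) hω]
          have := (abs_sub (f (X i ω)) (f Z)).trans
            (add_le_add (f.norm_coe_le_norm (X i ω)) (f.norm_coe_le_norm Z))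
          linarith
        · simp only [indicator_of_notMem (s := {ω | η / 2 ≤ |f (X i ω) - f Z|}) hω]
          linarith
    _ = η / 2 + (P i).real {ω | η / 2 ≤ |f (X i ω) - f Z|} * (2 * ‖f‖) := by
        rw [integral_add (integrable_const _) ((integrable_const _).indicator hbad),
          integral_indicator_const _ hbad, integral_const, probReal_univ, one_smul, smul_eq_mul]
    _ ≤ η / 2 + (P i).real {ω | X i ω ∉ j1Nbhd Z T ε} * (2 * ‖f‖) := by
        have hincl : {ω | η / 2 ≤ |f (X i ω) - f Z|} ⊆ {ω | X i ω ∉ j1Nbhd Z T ε} :=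
          fun ω hω hmem => (not_lt.2 hω) (mem_ofPred_eq ▸ hsub hmem)
        have := mul_le_mul_of_nonneg_right (measureReal_mono (μ := P i) hincl)
          (show 0 ≤ 2 * ‖f‖ by positivity)
        linarith
    _ < η := by linarith

end Skorokhod

section L2

variable {Γ : Type*} [MeasurableSpace Γ] {ν : Measure Γ} [SFinite ν]

lemma measurable_edist_Lp {Ω : Type*} [MeasurableSpace Ω] {X : Ω → Γ → ℝ}
    (hX : Measurable (Function.uncurry X)) {A : Ω → Lp ℝ 2 ν} (hA : ∀ ω, A ω =ᵐ[ν] X ω)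
    (g : Lp ℝ 2 ν) : Measurable fun ω => edist (A ω) g := by
  obtain ⟨G, hG, hgG⟩ := (Lp.aestronglyMeasurable g)
  have h : ∀ ω, edist (A ω) g = (∫⁻ c, ‖X ω c - G c‖ₑ ^ (2 : ℝ) ∂ν) ^ (1 / (2 : ℝ)) := by
    intro ω
    rw [Lp.edist_def, eLpNorm_congr_ae ((hA ω).sub hgG),
      eLpNorm_eq_lintegral_rpow_enorm_toReal two_ne_zero ENNReal.ofNat_ne_top]
    rfl
  simp_rw [h]
  refine Measurable.pow_const (Measurable.lintegral_prod_right' (f := fun q : Ω × Γ =>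
    ‖X q.1 q.2 - G q.2‖ₑ ^ (2 : ℝ)) ?_) _
  exact ((hX.sub (hG.measurable.comp measurable_snd)).enorm).pow_const _

end L2

end InfGB

end

noncomputable section

namespace InfGB

/-! ### The fluid limit of chains with a bounded kernel -/

section FluidLimit

variable {n : ℕ} {S Γ : Type*} [MeasurableSpace S] [MeasurableSpace Γ]

/-- Measurable bounded kernels with Lipschitz means. -/
structure BoundedKernel (σ : Measure S) (T : Bool → (Fin n → ℝ) → S → Γ → ℝ)
    (U : Bool → (Fin n → ℝ) → Γ → ℝ) (C L : ℝ) : Prop where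
  bound_nonneg : 0 ≤ C
  lipschitz_nonneg : 0 ≤ L
  measurable : ∀ e, Measurable fun q : (Fin n → ℝ) × S × Γ => T e q.1 q.2.1 q.2.2
  bound : ∀ e z s c, |T e z s c| ≤ C
  mean : ∀ e z c, U e z c = ∫ s, T e z s c ∂σ
  lipschitz : ∀ e z z' c, |U e z c - U e z' c| ≤ L * ‖z - z'‖

namespace BoundedKernel

variable {σ : Measure S} [IsProbabilityMeasure σ] {T : Bool → (Fin n → ℝ) → S → Γ → ℝ}
  {U : Bool → (Fin n → ℝ) → Γ → ℝ} {C L : ℝ} (h : BoundedKernel σ T U C L)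

include h

lemma abs_mean_le (e : Bool) (z : Fin n → ℝ) (c : Γ) : |U e z c| ≤ C := by
  have := norm_integral_le_of_norm_le_const (μ := σ) (f := fun s => T e z s c)
    (ae_of_all _ fun s => h.bound e z s c)
  rwa [probReal_univ, mul_one, ← h.mean] at this

lemma measurable_mean (e : Bool) : Measurable fun q : (Fin n → ℝ) × Γ => U e q.1 q.2 := by
  have hm : Measurable fun q : ((Fin n → ℝ) × Γ) × S => T e q.1.1 q.2 q.1.2 :=
    (h.measurable e).comp ((measurable_fst.comp measurable_fst).prodMk
      (measurable_snd.prodMk (measurable_snd.comp measurable_fst)))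
  simp_rw [h.mean]
  exact (hm.stronglyMeasurable.integral_prod_right' (ν := σ)).measurable

variable {x : Fin n → Γ} {F₀ : Bool → Γ → ℝ} (hF₀ : ∀ e, Measurable (F₀ e)) {lam : ℝ}

include hF₀ in
lemma measurable_noise (e : Bool) (k : ℕ) :
    Measurable fun q : (ℕ → S) × S × Γ => noise T x F₀ lam U e k q.1 q.2.1 q.2.2 := by
  have hs : Measurable fun q : (ℕ → S) × S × Γ => pathState T x F₀ lam k q.1 :=
    (measurable_pathState h.measurable hF₀ k).comp measurable_fst
  exact ((h.measurable e).comp (hs.prodMk measurable_snd)).sub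
    ((h.measurable_mean e).comp (hs.prodMk (measurable_snd.comp measurable_snd)))

lemma abs_noise_le (e : Bool) (k : ℕ) (w : ℕ → S) (s : S) (c : Γ) :
    |noise T x F₀ lam U e k w s c| ≤ 2 * C := by
  have h1 := abs_le.1 (h.bound e (pathState T x F₀ lam k w) s c)
  have h2 := abs_le.1 (h.abs_mean_le e (pathState T x F₀ lam k w) c)
  rw [noise, abs_le]
  constructor <;> linarith

lemma integral_noise (e : Bool) (k : ℕ) (w : ℕ → S) (c : Γ) :
    ∫ s, noise T x F₀ lam U e k w s c ∂σ = 0 := by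
  have hm : Measurable fun s => T e (pathState T x F₀ lam k w) s c :=
    (h.measurable e).comp (measurable_const.prodMk (measurable_id.prodMk measurable_const))
  have hi : Integrable (fun s => T e (pathState T x F₀ lam k w) s c) σ :=
    Integrable.of_bound hm.aestronglyMeasurable C (ae_of_all _ fun s => h.bound e _ s c)
  simp only [noise]
  rw [integral_sub hi (integrable_const _), ← h.mean]
  simp

variable {ν : Measure Γ} [IsProbabilityMeasure ν]

include hF₀ in
/-- The accumulated noise is small with high probability. -/
lemma measureReal_noise_le {Ω : Type*} [MeasurableSpace Ω] {P : Measure Ω} [IsProbabilityMeasure P]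
    {ζ : ℕ → Ω → S} (hζ : ∀ m, Measurable (ζ m)) (hlaw : ∀ m, P.map (ζ m) = σ)
    (hind : iIndepFun ζ P) (hlam : 0 < lam) {δ : ℝ} (hδ : 0 < δ) (N : ℕ) :
    P.real {ω | ∃ m ≤ N, ∃ e, δ ≤ lam ^ 2 * ∫ c, pathSum (fun k w s =>
      noise T x F₀ lam U e k w s c) m (fun k => ζ k ω) ^ 2 ∂ν} ≤
      (N + 1) * (128 * C ^ 4 * N ^ 2 * lam ^ 4 / δ ^ 2) := by
  have hone : ∀ m ≤ N, ∀ e, P.real {ω | δ / lam ^ 2 ≤ ∫ c, pathSum (fun k w s =>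
      noise T x F₀ lam U e k w s c) m (fun k => ζ k ω) ^ 2 ∂ν} ≤
      64 * C ^ 4 * N ^ 2 * lam ^ 4 / δ ^ 2 := by
    intro m hm e
    refine (measureReal_integral_pathSum_sq_le hζ hlaw hind (h.measurable_noise hF₀ e)
      (fun k w w' hw => ?_) (h.abs_noise_le e) (h.integral_noise e) (by positivity) m).trans ?_
    · have hs : pathState T x F₀ lam k w = pathState T x F₀ lam k w' :=
        adapted_pathState T x F₀ lam k w w' hw
      funext s c
      rw [noise, noise, hs]
    · have hmN : (m : ℝ) ^ 2 ≤ (N : ℝ) ^ 2 := by gcongr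
      have hC := h.bound_nonneg
      rw [div_pow, div_div_eq_mul_div, ← pow_mul, mul_pow]
      gcongr ?_ / _
      have : 4 * (2 ^ 4 * C ^ 4) * (m : ℝ) ^ 2 * lam ^ (2 * 2) =
        64 * C ^ 4 * lam ^ 4 * (m : ℝ) ^ 2 := by ring
      rw [this]
      calc 64 * C ^ 4 * lam ^ 4 * (m : ℝ) ^ 2 ≤ 64 * C ^ 4 * lam ^ 4 * (N : ℝ) ^ 2 := by gcongr
        _ = _ := by ring
  have hsub : {ω | ∃ m ≤ N, ∃ e, δ ≤ lam ^ 2 * ∫ c, pathSum (fun k w s =>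
      noise T x F₀ lam U e k w s c) m (fun k => ζ k ω) ^ 2 ∂ν} ⊆
      ⋃ q ∈ Finset.range (N + 1) ×ˢ (Finset.univ : Finset Bool), {ω | δ / lam ^ 2 ≤ ∫ c, pathSum
        (fun k w s => noise T x F₀ lam U q.2 k w s c) q.1 (fun k => ζ k ω) ^ 2 ∂ν} := by
    rintro ω ⟨m, hm, e, hω⟩
    refine mem_iUnion₂.2 ⟨(m, e), by simpa using Nat.lt_succ_of_le hm, ?_⟩
    rw [mem_ofPred_eq, div_le_iff₀' (by positivity)]
    exact hω
  refine (measureReal_mono hsub (measure_ne_top P _)).trans ((measureReal_biUnion_finset_le _ _).trans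
    ((Finset.sum_le_sum fun q hq => hone q.1 ?_ q.2).trans_eq ?_))
  · have := (Finset.mem_product.1 hq).1
    exact Nat.le_of_lt_succ (Finset.mem_range.1 this)
  · rw [Finset.sum_const, Finset.card_product, Finset.card_range, Finset.card_univ,
      Fintype.card_bool, nsmul_eq_mul]
    push_cast
    ring

variable [MeasurableSingletonClass Γ] {Φ : Bool → ℝ → Γ → ℝ} {z : ℝ → Fin n → ℝ}
  {a κ tmax : ℝ} {N : ℕ}

include hF₀ in
/-- If the accumulated noise is small, then the chain is close to the fluid limit. -/
lemma pathChain_near (hlam : 0 ≤ lam) (hΦ0 : ∀ e c, Φ e 0 c = 0)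
    (hΦ : ∀ e c, ∀ t ∈ Icc 0 tmax, HasDerivAt (fun t => Φ e t c) (U e (z t) c) t)
    (hz : ∀ t ∈ Icc 0 tmax, ∀ i,
      z t i = F₀ true (x i) - F₀ false (x i) + Φ true t (x i) - Φ false t (x i))
    (hN : N * lam ≤ tmax) {w : ℕ → S} (ha : 0 ≤ a) (hκ : 0 < κ) (hκ1 : κ ≤ 1)
    (hκx : ∀ i, κ ≤ ν.real {x i})
    (hw : ∀ m ≤ N, ∀ e, lam ^ 2 * ∫ c, pathSum (fun k w s =>
      noise T x F₀ lam U e k w s c) m w ^ 2 ∂ν ≤ κ * a ^ 2) {m : ℕ} (hm : m ≤ N) :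
    ‖pathState T x F₀ lam m w - z (m * lam)‖ ≤
        2 * (a + C * lam) * Real.exp (2 * L * tmax) ∧
    ∀ t ∈ Icc (m * lam) ((m + 1) * lam), t ≤ tmax → ∀ e,
      ∫ c, (pathChain T x F₀ lam w m e c - F₀ e c - Φ e t c) ^ 2 ∂ν ≤
        (2 * (a + C * lam) * Real.exp (2 * L * tmax)) ^ 2 := by
  have hC := h.bound_nonneg
  have hL := h.lipschitz_nonneg
  have hCl : 0 ≤ C * lam := mul_nonneg hC hlam
  have hLl : 0 ≤ 2 * L * lam := by positivity
  have hmeas : ∀ m e, Measurable fun c => pathSum (fun k w s =>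
      noise T x F₀ lam U e k w s c) m w := fun m e =>
    (measurable_pathSum_prod (h.measurable_noise hF₀ e) m).comp measurable_prodMk_left
  have hint : ∀ m e, Integrable (fun c => (lam * pathSum (fun k w s =>
      noise T x F₀ lam U e k w s c) m w) ^ 2) ν := fun m e =>
    Integrable.of_bound (((hmeas m e).const_mul lam).pow_const 2).aestronglyMeasurable
      ((lam * (m * (2 * C))) ^ 2) (ae_of_all _ fun c => by
        rw [norm_pow, norm_mul, Real.norm_of_nonneg hlam]
        gcongr
        exact abs_pathSum_le (fun k w s => h.abs_noise_le e k w s c) m w)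
  have hw' : ∀ m ≤ N, ∀ e, ∫ c, (lam * pathSum (fun k w s =>
      noise T x F₀ lam U e k w s c) m w) ^ 2 ∂ν ≤ κ * a ^ 2 := by
    intro m hm e
    simp_rw [mul_pow]
    rw [integral_const_mul]
    exact hw m hm e
  have hpt : ∀ m ≤ N, ∀ e i, |lam * pathSum (fun k w s =>
      noise T x F₀ lam U e k w s (x i)) m w| ≤ a := by
    intro m hm e i
    have h1 := (setIntegral_le_integral (s := {x i}) (hint m e)
      (ae_of_all _ fun c => sq_nonneg _)).trans (hw' m hm e)
    rw [integral_singleton, smul_eq_mul] at h1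
    have h2 := (mul_le_mul_of_nonneg_right (hκx i) (sq_nonneg _)).trans h1
    exact abs_le_of_sq_le_sq (le_of_mul_le_mul_left h2 hκ) ha
  obtain ⟨h1, h2⟩ := abs_pathChain_sub_le hL hlam h.lipschitz h.abs_mean_le hC hΦ0 hΦ hz hN ha hpt hm
  have hmt : (m : ℝ) * lam ≤ tmax :=
    (mul_le_mul_of_nonneg_right (Nat.cast_le.2 hm) hlam).trans hN
  have hQ : (1 + 2 * L * lam) ^ m ≤ Real.exp (2 * L * tmax) := by
    calc (1 + 2 * L * lam) ^ m ≤ Real.exp (2 * L * lam) ^ m := by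
          gcongr; linarith [Real.add_one_le_exp (2 * L * lam)]
      _ = Real.exp (2 * L * (m * lam)) := by rw [← Real.exp_nat_mul]; ring_nf
      _ ≤ _ := by gcongr
  have hQ1 : 1 ≤ Real.exp (2 * L * tmax) :=
    Real.one_le_exp (mul_nonneg (by positivity) ((mul_nonneg m.cast_nonneg hlam).trans hmt))
  set Q := Real.exp (2 * L * tmax)
  have haC : 0 ≤ a + C * lam := by positivity
  refine ⟨h2.trans (by gcongr), fun t ht htmax e => ?_⟩
  have hm0 : 0 ≤ (m : ℝ) * lam := by positivity
  have hrem : ∀ c, |pathChain T x F₀ lam w m e c - F₀ e c - Φ e t c -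
      lam * pathSum (fun k w s => noise T x F₀ lam U e k w s c) m w| ≤ (a + C * lam) * Q := by
    intro c
    have h3 := abs_le.1 (abs_flow_sub_le h.abs_mean_le hΦ (s := m * lam) ⟨hm0, hmt⟩
      (t := t) ⟨hm0.trans ht.1, htmax⟩ e c)
    have h4 : C * |t - m * lam| ≤ C * lam := by
      refine mul_le_mul_of_nonneg_left ?_ hC
      rw [abs_of_nonneg (by linarith [ht.1])]
      linarith [ht.2]
    have h5 := abs_le.1 (h1 e c)
    have h6 := mul_le_mul_of_nonneg_left hQ haC
    rw [abs_le]
    constructor <;> linarith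
  have hpw : ∀ c, (pathChain T x F₀ lam w m e c - F₀ e c - Φ e t c) ^ 2 ≤
      2 * (lam * pathSum (fun k w s => noise T x F₀ lam U e k w s c) m w) ^ 2 +
        2 * ((a + C * lam) * Q) ^ 2 := by
    intro c
    have h7 := sq_le_sq' (abs_le.1 (hrem c)).1 (abs_le.1 (hrem c)).2
    nlinarith [sq_nonneg (pathChain T x F₀ lam w m e c - F₀ e c - Φ e t c -
      2 * (lam * pathSum (fun k w s => noise T x F₀ lam U e k w s c) m w))]
  refine (integral_mono_of_nonneg (ae_of_all _ fun c => sq_nonneg _)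
    (((hint m e).const_mul 2).add (integrable_const _)) (ae_of_all _ hpw)).trans ?_
  simp only [Pi.add_apply]
  rw [integral_add ((hint m e).const_mul 2) (integrable_const _), integral_const_mul,
    integral_const, probReal_univ, one_smul]
  have h8 := hw' m hm e
  have h9 : κ * a ^ 2 ≤ ((a + C * lam) * Q) ^ 2 := by
    refine (mul_le_of_le_one_left (sq_nonneg a) hκ1).trans (pow_le_pow_left₀ ha ?_ 2)
    exact (le_add_of_nonneg_right hCl).trans (le_mul_of_one_le_right haC hQ1)
  nlinarith

end BoundedKernel

end FluidLimit

end InfGB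

end

noncomputable section

namespace InfGB

/-! ### Convergence of the rescaled boosting chains -/

variable {p n d K : ℕ}

section Clamp

/-- Truncation of the coordinates to `[-R, R]`. -/
def clamp (R : ℝ) (z : Fin n → ℝ) (i : Fin n) : ℝ := max (-R) (min R (z i))

lemma norm_clamp_le {R : ℝ} (hR : 0 ≤ R) (z : Fin n → ℝ) : ‖clamp R z‖ ≤ R :=
  (pi_norm_le_iff_of_nonneg hR).2 fun i => abs_le.2
    ⟨le_max_left _ _, max_le (by linarith) (min_le_left _ _)⟩

lemma norm_clamp_sub_le (R : ℝ) (z z' : Fin n → ℝ) : ‖clamp R z - clamp R z'‖ ≤ ‖z - z'‖ :=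
  (pi_norm_le_iff_of_nonneg (norm_nonneg _)).2 fun i =>
    ((abs_max_sub_max_le_max _ _ _ _).trans (by
      rw [sub_self, abs_zero]
      exact max_le (abs_nonneg _) ((abs_min_sub_min_le_max _ _ _ _).trans (by
        rw [sub_self, abs_zero]; exact max_le (abs_nonneg _) le_rfl)))).trans
      (norm_le_pi_norm (z - z') i)

lemma clamp_eq {R : ℝ} {z : Fin n → ℝ} (h : ‖z‖ ≤ R) : clamp R z = z := by
  funext i
  have := abs_le.1 ((norm_le_pi_norm z i).trans h)
  rw [clamp, min_eq_right this.2, max_eq_right this.1]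

lemma measurable_clamp (R : ℝ) : Measurable (clamp (n := n) R) :=
  measurable_pi_lambda _ fun i =>
    measurable_const.max (measurable_const.min (measurable_pi_apply i))

lemma measurable_comp_clamp {S Γ : Type*} [MeasurableSpace S] [MeasurableSpace Γ]
    {T : (Fin n → ℝ) → S → Γ → ℝ}
    (hT : Measurable fun q : (Fin n → ℝ) × S × Γ => T q.1 q.2.1 q.2.2) (R : ℝ) :
    Measurable fun q : (Fin n → ℝ) × S × Γ => T (clamp R q.1) q.2.1 q.2.2 :=
  hT.comp (((measurable_clamp R).comp measurable_fst).prodMk measurable_snd)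

end Clamp

lemma const_mem_treeSpace (z₀ : ℝ) : (fun _ : Cube p => z₀) ∈ treeSpace p := by
  have h : (fun _ : Cube p => (1 : ℝ)) ∈ treeSpace p := by
    refine mem_treeSpace_of_sub (P := Measure.dirac 0) (Q := 0) ?_ (by simp) fun c => ?_
    · rw [Measure.dirac_apply' _ measurableSet_upperBoundary, indicator_of_notMem]
      rintro ⟨j, hj⟩
      exact zero_ne_one hj
    · have : (0 : Cube p) ∈ Iic c := fun j => (c j).2.1
      rw [measureReal_def, Measure.dirac_apply' _ (measurableSet_Iic_cube c),
        indicator_of_mem this]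
      simp
  have h2 := (treeSubmodule p).smul_mem z₀ h
  convert! h2 using 1
  funext c
  simp

section RegularMass

variable {ι S : Type*} [Fintype ι] [MeasurableSpace S] {σ : Measure S}
  {m : ι → (Fin n → ℝ) → S → ℝ} {q : ι → S → Cube p}

lemma RegularMass.measurable_sum_mul_step (h : RegularMass σ m) (hq : ∀ a, Measurable (q a)) :
    Measurable fun y : (Fin n → ℝ) × S × Cube p => ∑ a, m a y.1 y.2.1 * step (q a y.2.1) y.2.2 := by
  refine Finset.measurable_sum _ fun a _ => Measurable.mul ?_ ?_
  · exact (h.measurable a).comp (measurable_fst.prodMk (measurable_fst.comp measurable_snd))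
  · exact measurable_step.comp (((hq a).comp (measurable_fst.comp measurable_snd)).prodMk
      (measurable_snd.comp measurable_snd))

lemma RegularMass.abs_sum_mul_step_le (h : RegularMass σ m) (R : ℝ) : ∃ C, 0 ≤ C ∧
    ∀ z s c, ‖z‖ ≤ R → |∑ a, m a z s * step (q a s) c| ≤ C := by
  obtain ⟨C, hC, hb⟩ := h.bounded R
  exact ⟨∑ _ : ι, C, Finset.sum_nonneg fun _ _ => hC, fun z s c hz =>
    (InfGB.abs_sum_mul_step_le _ _ _).trans (Finset.sum_le_sum fun a _ => hb a z s hz)⟩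

end RegularMass

namespace BoostingData

variable [NeZero K] (B : BoostingData p n d K)

/-- The positive or negative part of the gradient tree. -/
def partTree (e : Bool) (z : Fin n → ℝ) (ζ : Aux p d K) : Cube p → ℝ := treePart e (B.gradTree z ζ)

/-- The components of the boosting chain, as functions of the path of the auxiliary randomness. -/
abbrev partChain (z₀ lam : ℝ) : (ℕ → Aux p d K) → ℕ → Bool → Cube p → ℝ :=
  pathChain B.partTree B.x (fun e => treePart e fun _ => z₀) lam

lemma chain_eq (z₀ lam : ℝ) (w : ℕ → Aux p d K) (m : ℕ) :
    B.chain z₀ lam w m = (B.partChain z₀ lam w m true, B.partChain z₀ lam w m false) := by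
  induction m with
  | zero => rfl
  | succ m ih =>
    rw [chain]
    simp only [ih]
    rfl

lemma partChain_mem (z₀ : ℝ) {lam : ℝ} (hlam : 0 ≤ lam) (w : ℕ → Aux p d K) (m : ℕ) (e : Bool) :
    B.partChain z₀ lam w m e ∈ treeCone p := by
  induction m with
  | zero => exact treePart_mem_treeCone e (const_mem_treeSpace z₀)
  | succ m ih =>
    exact add_mem_treeCone ih (smul_mem_treeCone (treePart_mem_treeCone e (B.gradTree_mem _ _)) hlam)

variable {B}

lemma measurable_treePart_const (z₀ : ℝ) (e : Bool) :
    Measurable (treePart e fun _ : Cube p => z₀) :=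
  measurable_of_mem_treeSpace
    (treeCone_subset_treeSpace (treePart_mem_treeCone e (const_mem_treeSpace z₀)))

section Admissible

variable (hB : B.Admissible)

include hB

lemma Admissible.measurable_partTree (e : Bool) :
    Measurable fun q : (Fin n → ℝ) × Aux p d K × Cube p => B.partTree e q.1 q.2.1 q.2.2 := by
  simp only [partTree, B.treePart_gradTree]
  exact (hB.regularMass_partMass e).measurable_sum_mul_step measurable_atomPos

lemma Admissible.exists_boundedKernel {R : ℝ} (hR : 0 ≤ R) : ∃ C L,
    BoundedKernel (auxLaw p d K) (fun e z => B.partTree e (clamp R z))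
      (fun e z => B.partOp e (clamp R z)) C L := by
  have hb : ∀ e, ∃ C, 0 ≤ C ∧ ∀ z ζ c, ‖z‖ ≤ R → |B.partTree e z ζ c| ≤ C := by
    intro e
    simp only [partTree, B.treePart_gradTree]
    exact (hB.regularMass_partMass e).abs_sum_mul_step_le R
  choose C hC hCb using hb
  choose L hL hLb using fun e => hB.abs_partOp_sub_le e R
  refine ⟨max (C true) (C false), max (L true) (L false), (hC true).trans (le_max_left _ _),
    (hL true).trans (le_max_left _ _), fun e => ?_, fun e z ζ c => ?_, fun e z c => ?_,
    fun e z z' c => ?_⟩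
  · exact measurable_comp_clamp (hB.measurable_partTree e) R
  · refine (hCb e _ ζ c (norm_clamp_le hR z)).trans ?_
    cases e
    exacts [le_max_right _ _, le_max_left _ _]
  · exact hB.partOp_eq e _ c
  · refine (hLb e _ _ c (norm_clamp_le hR z) (norm_clamp_le hR z')).trans ?_
    refine mul_le_mul ?_ (norm_clamp_sub_le R z z') (norm_nonneg _)
      ((hL true).trans (le_max_left _ _))
    cases e
    exacts [le_max_right _ _, le_max_left _ _]

end Admissible

section Convergence

variable (B) in
/-- The state of the boosting chain in the product of the cones. -/
def conePoint [IsProbabilityMeasure (nuX B.x)] (z₀ : ℝ) {lam : ℝ} (hlam : 0 < lam)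
    (w : ℕ → Aux p d K) (m : ℕ) : TreeConeClosure B.x × TreeConeClosure B.x :=
  have h (e : Bool) := B.partChain_mem z₀ hlam.le w m e
  have hmem (e : Bool) : treeToL2 B.x ⟨_, treeCone_subset_treeSpace (h e)⟩ ∈
      closure (treeConeL2 B.x) := subset_closure ⟨_, h e, treeToL2_ae _⟩
  (⟨_, hmem true⟩, ⟨_, hmem false⟩)

variable [IsProbabilityMeasure (nuX B.x)]

lemma conePoint_ae (z₀ : ℝ) {lam : ℝ} (hlam : 0 < lam) (w : ℕ → Aux p d K) (m : ℕ) :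
    ((B.conePoint z₀ hlam w m).1 : L2x B.x) =ᵐ[nuX B.x] B.partChain z₀ lam w m true ∧
    ((B.conePoint z₀ hlam w m).2 : L2x B.x) =ᵐ[nuX B.x] B.partChain z₀ lam w m false :=
  ⟨treeToL2_ae _, treeToL2_ae _⟩

lemma Admissible.measurable_edist_conePoint (hB : B.Admissible) (z₀ : ℝ) {lam : ℝ} (hlam : 0 < lam)
    {Ω : Type*} [MeasurableSpace Ω] {ζ : ℕ → Ω → Aux p d K} (hζ : ∀ m, Measurable (ζ m)) (m : ℕ)
    (y : TreeConeClosure B.x × TreeConeClosure B.x) :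
    Measurable fun ω => edist (B.conePoint z₀ hlam (fun k => ζ k ω) m) y := by
  have hmeas (e : Bool) : Measurable fun q : Ω × Cube p =>
      B.partChain z₀ lam (fun k => ζ k q.1) m e q.2 :=
    (measurable_pathChain hB.measurable_partTree (measurable_treePart_const z₀) m e).comp
      (((measurable_pi_lambda _ hζ).comp measurable_fst).prodMk measurable_snd)
  simp only [Prod.edist_eq, Subtype.edist_eq]
  exact (measurable_edist_Lp (hmeas true) (fun ω => (conePoint_ae z₀ hlam _ m).1) _).max
    (measurable_edist_Lp (hmeas false) (fun ω => (conePoint_ae z₀ hlam _ m).2) _)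

omit [IsProbabilityMeasure (nuX B.x)] in
lemma dist_le_of_integral_sq_le {x : Fin n → Cube p} {F G : L2x x} {f : Cube p → ℝ}
    (h : ((F - G : L2x x) : Cube p → ℝ) =ᵐ[nuX x] f) {r : ℝ} (hr : 0 ≤ r)
    (hf : ∫ c, f c ^ 2 ∂nuX x ≤ r ^ 2) : dist F G ≤ r := by
  rw [dist_eq_norm]
  refine le_of_sq_le_sq ?_ hr
  rw [← real_inner_self_eq_norm_sq, L2.inner_def]
  refine le_trans (integral_congr_ae ?_).le hf
  filter_upwards [h] with c hc
  rw [hc]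
  simp [sq]

omit [NeZero K] in
lemma exists_atom_bound (hn : 1 ≤ n) (x : Fin n → Cube p) [IsProbabilityMeasure (nuX x)] :
    ∃ κ, 0 < κ ∧ κ ≤ 1 ∧ ∀ i, κ ≤ (nuX x).real {x i} := by
  have : Nonempty (Fin n) := ⟨⟨0, hn⟩⟩
  obtain ⟨i, hi⟩ := Finite.exists_min fun i => (nuX x).real {x i}
  exact ⟨_, ENNReal.toReal_pos (nuX_singleton_ne_zero x i) (measure_ne_top _ _),
    measureReal_le_one, hi⟩

/-- The rescaled chains are close to the solution of the system with high probability. -/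
lemma Admissible.tendsto_measureReal_notMem_j1Nbhd (hB : B.Admissible) (z₀ : ℝ)
    {z : ℝ → Fin n → ℝ} (hz : Continuous z)
    (hsol : ∀ t ≥ 0, HasDerivWithinAt z (B.velocity (z t)) (Ici 0) t)
    {F₀ : L2x B.x × L2x B.x} (hF₁ : F₀.1 =ᵐ[nuX B.x] treePos fun _ => z₀)
    (hF₂ : F₀.2 =ᵐ[nuX B.x] treeNeg fun _ => z₀)
    (h0 : ∀ i, z 0 i = (F₀.1 - F₀.2 : L2x B.x) (B.x i))
    {Z : CadlagPath (TreeConeClosure B.x × TreeConeClosure B.x)}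
    (hZ : ∀ t : ℝ≥0, ((Z t).1 : L2x B.x) = (hB.flow hz F₀ t).1 ∧
      ((Z t).2 : L2x B.x) = (hB.flow hz F₀ t).2)
    {Ω : Ioi (0 : ℝ) → Type*} [∀ l, MeasurableSpace (Ω l)] {P : ∀ l, Measure (Ω l)}
    [∀ l, IsProbabilityMeasure (P l)] {ζ : ∀ l, ℕ → Ω l → Aux p d K}
    (hζ : ∀ l m, Measurable (ζ l m)) (hlaw : ∀ l m, (P l).map (ζ l m) = auxLaw p d K)
    (hind : ∀ l, iIndepFun (ζ l) (P l)) (T : ℝ≥0) {ε : ℝ} (hε : 0 < ε) :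
    Tendsto (fun l => (P l).real {ω | stepPath l.2 (B.conePoint z₀ l.2 fun m => ζ l m ω) ∉
      j1Nbhd Z T ε}) (comap Subtype.val (𝓝 (0 : ℝ))) (𝓝 0) := by
  have := hB.isProbabilityMeasure
  have hT0 : (0 : ℝ) ≤ T := T.2
  obtain ⟨R₀, hR₀⟩ := isCompact_Icc.exists_bound_of_continuousOn (s := Icc 0 (T : ℝ)) hz.continuousOn
  have hR₀0 : 0 ≤ R₀ := (norm_nonneg _).trans (hR₀ 0 ⟨le_rfl, hT0⟩)
  set R := R₀ + 1
  obtain ⟨C, L, hker⟩ := hB.exists_boundedKernel (R := R) (by positivity)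
  obtain ⟨κ, hκ, hκ1, hκx⟩ := exists_atom_bound hB.card_pos B.x
  set Q := Real.exp (2 * L * T)
  have hQ : 0 < Q := Real.exp_pos _
  set ε' := min ε 1
  have hε' : 0 < ε' := lt_min hε one_pos
  set a := ε' / (8 * Q) with hadef
  have ha : 0 < a := by positivity
  have haQ : a * Q = ε' / 8 := by rw [hadef]; field_simp
  have hC := hker.bound_nonneg
  have hlim : Tendsto (fun l : Ioi (0 : ℝ) => (l : ℝ)) (comap Subtype.val (𝓝 0)) (𝓝 0) :=
    tendsto_comap
  have hsmall : ∀ᶠ l : Ioi (0 : ℝ) in comap Subtype.val (𝓝 (0 : ℝ)), C * (l : ℝ) < a :=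
    (hlim.const_mul C).eventually_lt_const (by simpa using ha)
  refine squeeze_zero' (g := fun l : Ioi (0 : ℝ) =>
    (T + (l : ℝ)) * (T : ℝ) ^ 2 * (l : ℝ) * (128 * C ^ 4 / (κ * a ^ 2) ^ 2))
    (Eventually.of_forall fun l => measureReal_nonneg) ?_ ?_
  · filter_upwards [hsmall] with l hl
    obtain ⟨lam, hlam⟩ := l
    rw [mem_Ioi] at hlam
    simp only at hl ⊢
    set N := ⌊(T : ℝ) / lam⌋₊
    have hNT : N * lam ≤ T := by
      rw [← le_div_iff₀ hlam]; exact Nat.floor_le (by positivity)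
    have hsub : {ω | stepPath hlam (B.conePoint z₀ hlam fun m => ζ ⟨lam, hlam⟩ m ω) ∉ j1Nbhd Z T ε} ⊆
        {ω | ∃ m ≤ N, ∃ e, κ * a ^ 2 ≤ lam ^ 2 * ∫ c, pathSum (fun k w s =>
          noise (fun e z => B.partTree e (clamp R z)) B.x (fun e => treePart e fun _ => z₀) lam
            (fun e z => B.partOp e (clamp R z)) e k w s c) m
              (fun k => ζ ⟨lam, hlam⟩ k ω) ^ 2 ∂nuX B.x} := by
      intro ω
      contrapose
      intro hω
      simp only [mem_ofPred_eq, not_exists, not_and, not_le, not_not] at hω ⊢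
      set w : ℕ → Aux p d K := fun k => ζ ⟨lam, hlam⟩ k ω
      have hclamp : ∀ t ∈ Icc 0 (T : ℝ), clamp R (z t) = z t := fun t ht =>
        clamp_eq ((hR₀ t ht).trans (by simp [R]))
      have hnear := fun m (hm : m ≤ N) => hker.pathChain_near (ν := nuX B.x) (x := B.x)
        (measurable_treePart_const z₀) hlam.le (Φ := fun e => B.partFlow e z) (z := z)
        (tmax := T) (a := a) (κ := κ) (w := w)
        (fun e c => by rw [partFlow_zero]; rfl)
        (fun e c t ht => by
          simp only [hclamp t ht]; exact hB.hasDerivAt_partFlow_apply hz e t c)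
        (fun t ht i => by
          rw [hB.trajectory_eq hz hsol ht.1, h0,
            eq_of_ae_eq_nuX ((Lp.coeFn_sub _ _).trans (hF₁.sub hF₂)) i]
          rfl) hNT ha.le hκ hκ1 hκx (fun m hm e => (hω m hm e).le) hm
      have hclose : 2 * (a + C * lam) * Q < ε' := by nlinarith
      have hstate : ∀ m ≤ N, ‖pathState (fun e z => B.partTree e (clamp R z)) B.x
          (fun e => treePart e fun _ => z₀) lam m w‖ ≤ R := by
        intro m hm
        have h1 := (hnear m hm).1
        have h2 := hR₀ (m * lam) ⟨by positivity,
          (mul_le_mul_of_nonneg_right (Nat.cast_le.2 hm) hlam.le).trans hNT⟩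
        have h3 : ε' ≤ 1 := min_le_right _ _
        have h4 := norm_le_norm_add_norm_sub' (pathState (fun e z => B.partTree e (clamp R z)) B.x
          (fun e => treePart e fun _ => z₀) lam m w) (z (m * lam))
        simp only [R]
        linarith
      have hchain : ∀ m ≤ N, B.partChain z₀ lam w m = pathChain
          (fun e z => B.partTree e (clamp R z)) B.x (fun e => treePart e fun _ => z₀) lam w m :=
        fun m hm => pathChain_congr fun k hk e => by
          rw [clamp_eq (hstate k (hk.le.trans hm))]
      refine mem_j1Nbhd_of_dist_lt hε fun t ht => ?_
      have htT : (t : ℝ) ≤ T := NNReal.coe_le_coe.2 ht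
      set m := ⌊(t : ℝ) / lam⌋₊
      have hm : m ≤ N := Nat.floor_le_floor (div_le_div_of_nonneg_right htT hlam.le)
      have htm : (t : ℝ) ∈ Icc (m * lam) ((m + 1) * lam) := by
        constructor
        · rw [← le_div_iff₀ hlam]; exact Nat.floor_le (by positivity)
        · rw [← div_le_iff₀ hlam]; exact (Nat.lt_floor_add_one _).le
      have hint := (hnear m hm).2 t htm htT
      rw [← hchain m hm] at hint
      have hr : 0 ≤ 2 * (a + C * lam) * Q := by positivity
      have hpt := conePoint_ae (B := B) z₀ hlam w m
      rw [stepPath_apply, Prod.dist_eq]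
      refine (max_le ?_ ?_).trans_lt (hclose.trans_le (min_le_left _ _))
      · rw [Subtype.dist_eq, (hZ t).1]
        refine dist_le_of_integral_sq_le ?_ hr (hint true)
        filter_upwards [Lp.coeFn_sub ((B.conePoint z₀ hlam w m).1 : L2x B.x) (hB.flow hz F₀ t).1,
          Lp.coeFn_add F₀.1 (treeToL2 B.x ⟨B.partFlow true z t, hB.partFlow_mem hz true t⟩), hpt.1,
          hF₁, treeToL2_ae ⟨B.partFlow true z t, hB.partFlow_mem hz true t⟩] with c h1 h2 h3 h4 h5
        rw [h1, Pi.sub_apply, h3, flow, h2, Pi.add_apply, h4, h5]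
        exact (sub_sub _ _ _).symm
      · rw [Subtype.dist_eq, (hZ t).2]
        refine dist_le_of_integral_sq_le ?_ hr (hint false)
        filter_upwards [Lp.coeFn_sub ((B.conePoint z₀ hlam w m).2 : L2x B.x) (hB.flow hz F₀ t).2,
          Lp.coeFn_add F₀.2 (treeToL2 B.x ⟨B.partFlow false z t, hB.partFlow_mem hz false t⟩), hpt.2,
          hF₂, treeToL2_ae ⟨B.partFlow false z t, hB.partFlow_mem hz false t⟩] with c h1 h2 h3 h4 h5
        rw [h1, Pi.sub_apply, h3, flow, h2, Pi.add_apply, h4, h5]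
        exact (sub_sub _ _ _).symm
    refine (measureReal_mono hsub (measure_ne_top _ _)).trans
      ((hker.measureReal_noise_le (measurable_treePart_const z₀) (hζ _) (hlaw _) (hind _) hlam
        (by positivity) N).trans ?_)
    have h1 : (N + 1) * lam ≤ T + lam := by linarith
    have h2 : (N * lam) ^ 2 ≤ (T : ℝ) ^ 2 := by gcongr
    calc ((N : ℝ) + 1) * (128 * C ^ 4 * N ^ 2 * lam ^ 4 / (κ * a ^ 2) ^ 2)
        = ((N + 1) * lam) * (N * lam) ^ 2 * lam * (128 * C ^ 4 / (κ * a ^ 2) ^ 2) := by ring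
      _ ≤ _ := by gcongr
  · have h1 := (((tendsto_const_nhds (x := (T : ℝ))).add hlim).mul_const ((T : ℝ) ^ 2)).mul hlim
    have h2 := h1.mul_const (128 * C ^ 4 / (κ * a ^ 2) ^ 2)
    simpa using h2

end Convergence

end BoostingData

end InfGB

end

noncomputable section

namespace InfGB

/-! ### The limit path -/

/-- A continuous curve as a càdlàg path. -/
def CadlagPath.ofContinuous {E : Type*} [TopologicalSpace E] (f : ℝ≥0 → E) (hf : Continuous f) :
    CadlagPath E where
  toFun := f
  right_continuous _ := hf.continuousWithinAt
  left_limit t := ⟨f t, hf.continuousAt.continuousWithinAt⟩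

namespace BoostingData

variable {p n d K : ℕ} [NeZero K] {B : BoostingData p n d K} [IsProbabilityMeasure (nuX B.x)]

omit [NeZero K] in
lemma secondCountableTopology_L2x : SecondCountableTopology (L2x B.x) := by
  have : Fact ((2 : ℝ≥0∞) ≠ ∞) := ⟨ENNReal.ofNat_ne_top⟩
  have : MeasureTheory.IsSeparable (nuX B.x) := isSeparable_of_sigmaFinite _
  infer_instance

/-- The solution of the system, as a path in the product of the cones. -/
def Admissible.limitPath (hB : B.Admissible) {z : ℝ → Fin n → ℝ} (hz : Continuous z)
    {F₀ : L2x B.x × L2x B.x} (h₁ : F₀.1 ∈ treeConeL2 B.x) (h₂ : F₀.2 ∈ treeConeL2 B.x) :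
    CadlagPath (TreeConeClosure B.x × TreeConeClosure B.x) :=
  CadlagPath.ofContinuous
    (fun t => (⟨(hB.flow hz F₀ t).1, subset_closure ((hB.flow_mem_treeConeL2 hz t.2).1 h₁)⟩,
      ⟨(hB.flow hz F₀ t).2, subset_closure ((hB.flow_mem_treeConeL2 hz t.2).2 h₂)⟩)) <| by
    have hc : Continuous fun t : ℝ≥0 => hB.flow hz F₀ t :=
      (continuous_iff_continuousAt.2 fun t => (hB.hasDerivAt_flow hz t).continuousAt).comp
        continuous_subtype_val
    exact (hc.fst.subtype_mk _).prodMk (hc.snd.subtype_mk _)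

variable (B) in
/-- Convergence of the rescaled boosting chains to the solution of the system. -/
theorem exists_tendstoInDistribution (hB : B.Admissible) (z₀ : ℝ) (Ω : Ioi (0 : ℝ) → Type*)
    [∀ l, MeasurableSpace (Ω l)] (P : ∀ l, Measure (Ω l)) [∀ l, IsProbabilityMeasure (P l)]
    (ζ : ∀ l, ℕ → Ω l → Aux p d K) (hζ : ∀ l m, Measurable (ζ l m))
    (hlaw : ∀ l m, (P l).map (ζ l m) = auxLaw p d K) (hind : ∀ l, iIndepFun (ζ l) (P l)) :
    ∃ (X : ∀ l, Ω l → CadlagPath (TreeConeClosure B.x × TreeConeClosure B.x))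
      (F : ℝ → L2x B.x × L2x B.x)
      (Z : CadlagPath (TreeConeClosure B.x × TreeConeClosure B.x)),
      (∀ l ω t,
        ((X l ω t).1 : L2x B.x) =ᵐ[nuX B.x]
          (B.chain z₀ l (fun m => ζ l m ω) ⌊(t : ℝ) / l⌋₊).1 ∧
        ((X l ω t).2 : L2x B.x) =ᵐ[nuX B.x]
          (B.chain z₀ l (fun m => ζ l m ω) ⌊(t : ℝ) / l⌋₊).2) ∧
      B.IsSolutionPM F ∧
      ((F 0).1 =ᵐ[nuX B.x] treePos fun _ => z₀) ∧ ((F 0).2 =ᵐ[nuX B.x] treeNeg fun _ => z₀) ∧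
      (∀ t : ℝ≥0, ((Z t).1 : L2x B.x) = (F t).1 ∧ ((Z t).2 : L2x B.x) = (F t).2) ∧
      TendstoInDistribution X (comap Subtype.val (𝓝 (0 : ℝ))) (fun _ : Unit => Z) P
        (Measure.dirac ()) := by
  have hpos := treePos_mem_treeCone (const_mem_treeSpace (p := p) z₀)
  have hneg := treeNeg_mem_treeCone (const_mem_treeSpace (p := p) z₀)
  let F₀ : L2x B.x × L2x B.x := (treeToL2 B.x ⟨_, treeCone_subset_treeSpace hpos⟩,
    treeToL2 B.x ⟨_, treeCone_subset_treeSpace hneg⟩)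
  have hF₁ : F₀.1 =ᵐ[nuX B.x] treePos fun _ => z₀ := treeToL2_ae _
  have hF₂ : F₀.2 =ᵐ[nuX B.x] treeNeg fun _ => z₀ := treeToL2_ae _
  obtain ⟨z, hz, hz0, hsol⟩ := hB.exists_trajectory fun i => (F₀.1 - F₀.2 : L2x B.x) (B.x i)
  have h0 : ∀ i, z 0 i = (F₀.1 - F₀.2 : L2x B.x) (B.x i) := fun i => congrFun hz0 i
  refine ⟨fun l ω => stepPath (mem_Ioi.1 l.2) (B.conePoint z₀ (mem_Ioi.1 l.2) fun m => ζ l m ω), hB.flow hz F₀,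
    hB.limitPath hz (F₀ := F₀) ⟨_, hpos, hF₁⟩ ⟨_, hneg, hF₂⟩, fun l ω t => ?_,
    hB.isSolutionPM_flow hz hsol h0, by rwa [hB.flow_zero hz], by rwa [hB.flow_zero hz],
    fun t => ⟨rfl, rfl⟩, ?_⟩
  · rw [chain_eq]
    exact conePoint_ae z₀ l.2 _ _
  · have := secondCountableTopology_L2x (B := B)
    exact tendstoInDistribution_of_tendsto_j1Nbhd
      (fun l => measurable_stepPath (mem_Ioi.1 l.2) (hB.measurable_edist_conePoint z₀ l.2 (hζ l)))
      fun T ε hε => hB.tendsto_measureReal_notMem_j1Nbhd z₀ hz hsol hF₁ hF₂ h0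
        (fun t => ⟨rfl, rfl⟩) hζ hlaw hind T hε

end BoostingData

end InfGB

end

theorem theorem4p3 {p n d K : ℕ} [NeZero K] (hp : 1 ≤ p) (hn : 1 ≤ n) (hd : 1 ≤ d)
    (B : BoostingData p n d K) (hβ : 0 ≤ B.β) (hL : LossAssumption B.L) :
    -- existence and uniqueness for the system in `L²_x × L²_x`, and invariance of `𝕋⁺ × 𝕋⁺`
    (∀ F₀ : L2x B.x × L2x B.x, ∃ F : ℝ → L2x B.x × L2x B.x,
      B.IsSolutionPM F ∧ F 0 = F₀ ∧
      (∀ H, B.IsSolutionPM H → H 0 = F₀ → ∀ t ≥ 0, H t = F t) ∧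
      (F₀.1 ∈ treeConeL2 B.x → F₀.2 ∈ treeConeL2 B.x →
        (∀ t ≥ 0, (F t).1 ∈ treeConeL2 B.x ∧ (F t).2 ∈ treeConeL2 B.x) ∧
        -- `F⁺ - F⁻` is the unique solution of the main equation started from `F₀⁺ - F₀⁻`
        (∃ G, B.IsTreeSolution G ∧ ∀ t ≥ 0, ((F t).1 - (F t).2 : L2x B.x) =ᵐ[nuX B.x] G t) ∧
        (∀ G, B.IsTreeSolution G → (F₀.1 - F₀.2 : L2x B.x) =ᵐ[nuX B.x] G 0 →
          ∀ t ≥ 0, ((F t).1 - (F t).2 : L2x B.x) =ᵐ[nuX B.x] G t))) ∧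
    -- convergence in distribution of the rescaled chains
    (∀ (z₀ : ℝ), IsMinOn (fun z => (1 / (n : ℝ)) * ∑ i, B.L (B.y i) z) univ z₀ →
      ∀ (Ω : Ioi (0 : ℝ) → Type*) [∀ l, MeasurableSpace (Ω l)] (P : ∀ l, Measure (Ω l))
        [∀ l, IsProbabilityMeasure (P l)] (ζ : ∀ l, ℕ → Ω l → Aux p d K),
      (∀ l m, Measurable (ζ l m)) → (∀ l m, (P l).map (ζ l m) = auxLaw p d K) →
      (∀ l, iIndepFun (ζ l) (P l)) →
      ∃ (X : ∀ l, Ω l → CadlagPath (TreeConeClosure B.x × TreeConeClosure B.x))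
        (F : ℝ → L2x B.x × L2x B.x)
        (Z : CadlagPath (TreeConeClosure B.x × TreeConeClosure B.x)),
        -- `X l` is the rescaled chain with learning rate `l`
        (∀ l ω t,
          ((X l ω t).1 : L2x B.x) =ᵐ[nuX B.x]
            (B.chain z₀ l (fun m => ζ l m ω) ⌊(t : ℝ) / l⌋₊).1 ∧
          ((X l ω t).2 : L2x B.x) =ᵐ[nuX B.x]
            (B.chain z₀ l (fun m => ζ l m ω) ⌊(t : ℝ) / l⌋₊).2) ∧
        -- `Z` is the solution of the system with the same initial condition
        B.IsSolutionPM F ∧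
        ((F 0).1 =ᵐ[nuX B.x] treePos fun _ => z₀) ∧ ((F 0).2 =ᵐ[nuX B.x] treeNeg fun _ => z₀) ∧
        (∀ t : ℝ≥0, ((Z t).1 : L2x B.x) = (F t).1 ∧ ((Z t).2 : L2x B.x) = (F t).2) ∧
        TendstoInDistribution X (comap Subtype.val (𝓝 (0 : ℝ))) (fun _ : Unit => Z) P
          (Measure.dirac ())) := by
  have hB : B.Admissible := ⟨hp, hn, hβ, hL⟩
  have := hB.isProbabilityMeasure_nuX
  exact ⟨B.exists_unique_solution hB, fun z₀ _ Ω _ P _ ζ hζ hlaw hind =>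
    B.exists_tendstoInDistribution hB z₀ Ω P ζ hζ hlaw hind⟩
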